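/- Let $d\ge 3$ be odd, $\Delta_\pm=\frac d2\pm\nu$ with $\nu>0$, and consider global AdS$_{d+1}$ with metric $(\cos\rho)^{-2}\left(-dt^2+d\rho^2+\sin^2\!\rho\,d\Omega^2\right)$, $0\le\rho<\pi/2$, $\Omega\in S^{d-1}$. For every $\nu>0$ let $\Phi_D=\Phi_D^{(\nu)}$ be a smooth complex solution of the Klein-Gordon equation $\Box\Phi_D=\Delta_+(\Delta_+-d)\,\Phi_D$ with Dirichlet boundary condition, i.e. $\Phi_D/(\cos\rho)^{\Delta_+}$ extends smoothly to the conformal boundary $\rho=\pi/2$, and suppose that at each bulk point $\Phi_D^{(\nu)}$ is (real-)analytic in $\nu\in(0,\infty)$. Let $$\phi(t,\Omega)=\lim_{\rho\to\pi/2}\frac{\Phi_D(t,\rho,\Omega)}{(\cos\rho)^{\Delta_+}},\qquad \widetilde\Phi(\nu)=\Phi_D(t=0,\rho=0),\qquad C(\Delta_+)=\frac{(-1)^{(d-1)/2}\,2^{\Delta_+-d-1}\,\Gamma(\Delta_+-\frac d2+1)}{\pi^{d/2}\,\Gamma(\Delta_+-d+1)},$$ $$f(\nu)=\int K\phi=C(\Delta_+)\int_{S^{d-1}}d\Omega\int_{-\pi/2}^{\pi/2}dt\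 \phi(t,\Omega)(\cos t)^{-\Delta_-},$$ where $d\Omega$ is the surface measure of $S^{d-1}$. Let $b_j^\pm=b_j^\pm(\Omega)$ be the Taylor coefficients of $\phi(t,\Omega)\left(\frac{\cos t}{\pi/2\mp t}\right)^{-\Delta_-}$ at $t=\pm\pi/2$ in powers of $\pi/2\mp t$. Then: 1. (Divergence.) If $\Delta_+\le d-1$, the integral over $t$ is not absolutely convergent for any $\Omega$ with $\phi(\pi/2,\Omega)\neq0$ or $\phi(-\pi/2,\Omega)\ne0$; if such an $\Omega$ exists, the integral over $(-\pi/2,\pi/2)\times S^{d-1}$ is not absolutely convergent. 2. (Extension.) Let $n_0\ge0$ be an integer and $I_{n_0}=\{\nu>0:\ \nu>\frac d2-1-n_0\}$. There is a real-analytic function $g$ on $I_{n_0}$ such that for all $\nu\in I_{n_0}$ with $-\Delta_-+1+j\ne0$ for $0\le j<n_0$ $$g(\nu)=C(\Delta_+)\int_{S^{d-1}} d\Omega\,\lim_{\epsilon\to0^+}\left(\sum_{j=0}^{n_0-1}(b_j^++b_j^-)\frac{\epsilon^{-\Delta_-+1+j}}{-\Delta_-+1+j}+\int_{-\pi/2+\epsilon}^{\pi/2-\epsilon}dt\,\phi(t,\Omega)(\cos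 t)^{-\Delta_-}\right),$$ where the limit exists for every $\Omega$ and is integrable over $S^{d-1}$. If $\nu>\frac d2-1$, the original integral converges absolutely and $g(\nu)=f(\nu)$. Moreover $g(\nu)=\widetilde\Phi(\nu)$ for all $\nu\in I_{n_0}$; in particular for all $\nu>0$ if $n_0>\frac d2-1$. 3. (Kernel.) Let $\nu\in I_{n_0}$ with $-\Delta_-+1+j\neq0$ for $0\le j<n_0$, and let $c_k$ be the Taylor coefficients of $\left(\frac{\sin s}{s}\right)^{-\Delta_-}$ at $s=0$ (so $c_0=1$). Let $b_j^\pm[\psi]$ denote the coefficients $b_j^\pm$ formed with a function $\psi(t)$ in place of $\phi(t,\Omega)$. As distributions acting on Schwartz functions $\psi$, for every $j\ge 0$, $$b_j^+[\psi]+b_j^-[\psi]=\Big\langle\sum_{k=0}^{j}\frac{c_{j-k}}{k!}\left(\delta^{(k)}(t-\tfrac\pi2)+(-1)^k\delta^{(k)}(t+\tfrac\pi2)\right),\psi\Big\rangle ,$$ so that each regulating term is a combination of derivatives of delta functions (the $j$-th one containing $\delta^{(j)}$ with nonzero coefficient). The distributional limit as $\epsilon\to0^+$ $$K=\lim_{\epsilon\to0^+}C(\Delta_+)\left(\sum_{j=0}^{n_0-1}\frac{\epsilon^{-\Delta_-+1+j}}{-\Delta_-+1+j}\sum_{k=0}^{j}\frac{c_{j-k}}{k!}\left(\delta^{(k)}(t-\tfrac\pi2)+(-1)^k\delta^{(k)}(t+\tfrac\pi2)\right)+\mathbf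 1_{|t|<\pi/2-\epsilon}(\cos t)^{-\Delta_-}\right)$$ exists as a tempered distribution, and for every $\Omega$, $\langle K,\phi(\cdot,\Omega)\rangle$ (computed with any Schwartz function that agrees with $\phi(\cdot,\Omega)$ near $[-\pi/2,\pi/2]$) is $C(\Delta_+)$ times the limit in part 2. If $\Delta_+\le d-1$, then $K$ is not an integral kernel, i.e. it is not given on compactly supported test functions by a locally integrable function. -/

import Mathlib

open Set Filter Topology MeasureTheory
open scoped Real ContDiff SchwartzMap

noncomputable section

namespace HKLL

/-- `Δ₊ = d/2 + ν`. -/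
def deltaPlus (d : ℕ) (ν : ℝ) : ℝ := (d : ℝ) / 2 + ν

/-- `Δ₋ = d/2 - ν`, so that `Δ₊ - d = -Δ₋`. -/
def deltaMinus (d : ℕ) (ν : ℝ) : ℝ := (d : ℝ) / 2 - ν

/-- The Euclidean space whose unit sphere is `S^{d-1}`. -/
abbrev Space (d : ℕ) : Type := EuclideanSpace ℝ (Fin d)

/-- The unit sphere `S^{d-1}`. -/
abbrev Sph (d : ℕ) : Type := Metric.sphere (0 : Space d) 1

/-- The surface measure `dΩ √(-h)` of `S^{d-1}` (the boundary metric is `-dt² + dΩ²`). -/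
abbrev sphereMeasure (d : ℕ) : Measure (Sph d) := (volume : Measure (Space d)).toSphere

/-! ### The bulk field

The bulk point of global AdS with coordinates `(t, ρ, Ω)`, `0 ≤ ρ < π/2`, is represented by the
pair `(t, x)`, `x = ρ • Ω` (so that `ρ = ‖x‖`).  The metric is
`(cos ρ)⁻² (-dt² + dρ² + sin² ρ dΩ²)`. -/

/-- Laplace-Beltrami operator of `S^{d-1}`: the Euclidean Laplacian, on the unit sphere, of the
extension that is homogeneous of degree `0`. -/
def sphericalLaplacian {d : ℕ} (h : Space d → ℂ) (Ω : Sph d) : ℂ :=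
  Laplacian.laplacian (fun x : Space d => h (‖x‖⁻¹ • x)) (Ω : Space d)

/-- The d'Alembertian `□` of global AdS of dimension `d + 1`, at the point `(t, ρ, Ω)`. -/
def dAlembertian {d : ℕ} (F : ℝ → Space d → ℂ) (t ρ : ℝ) (Ω : Sph d) : ℂ :=
  ((Real.cos ρ ^ 2 : ℝ) : ℂ) *
    (-(iteratedDeriv 2 (fun τ : ℝ => F τ (ρ • (Ω : Space d))) t)
      + iteratedDeriv 2 (fun r : ℝ => F t (r • (Ω : Space d))) ρ
      + ((((d : ℝ) - 1) / (Real.sin ρ * Real.cos ρ) : ℝ) : ℂ)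
          * deriv (fun r : ℝ => F t (r • (Ω : Space d))) ρ
      + ((1 / Real.sin ρ ^ 2 : ℝ) : ℂ)
          * sphericalLaplacian (fun x : Space d => F t (ρ • x)) Ω)

/-- A smooth solution of the Klein-Gordon equation `□Φ = M² Φ`, `M² = Δ₊ (Δ₊ - d) = ν² - d²/4`,
on global AdS with the Dirichlet boundary condition: `Φ / (cos ρ)^{Δ₊}` extends smoothly to the
conformal boundary `ρ = π/2` (in particular there is no `(cos ρ)^{Δ₋}` component). -/
structure IsDirichletField (d : ℕ) (ν : ℝ) (F : ℝ → Space d → ℂ) : Prop where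
  dirichlet : ∃ U : ℝ × Space d → ℂ,
    ContDiffOn ℝ ∞ U (univ ×ˢ Metric.closedBall (0 : Space d) (π / 2)) ∧
    ∀ t : ℝ, ∀ x : Space d, ‖x‖ < π / 2 →
      F t x = ((Real.cos ‖x‖ ^ deltaPlus d ν : ℝ) : ℂ) * U (t, x)
  kleinGordon : ∀ t : ℝ, ∀ ρ ∈ Ioo (0 : ℝ) (π / 2), ∀ Ω : Sph d,
    dAlembertian F t ρ Ω
      = ((deltaPlus d ν * (deltaPlus d ν - d) : ℝ) : ℂ) * F t (ρ • (Ω : Space d))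

/-- `φ = lim_{ρ → π/2} F / (cos ρ)^{Δ₊}`. -/
def IsBoundaryValue (d : ℕ) (ν : ℝ) (F : ℝ → Space d → ℂ) (φ : ℝ → Sph d → ℂ) : Prop :=
  ∀ (t : ℝ) (Ω : Sph d),
    Tendsto (fun ρ : ℝ => F t (ρ • (Ω : Space d)) / ((Real.cos ρ ^ deltaPlus d ν : ℝ) : ℂ))
      (𝓝[<] (π / 2)) (𝓝 (φ t Ω))

/-! ### The HKLL integral and its extension -/

/-- The constant `C(Δ₊)` of the kernel, for odd `d`. -/
def hkllConst (d : ℕ) (ν : ℝ) : ℝ :=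
  (-1) ^ ((d - 1) / 2) * 2 ^ (deltaPlus d ν - d - 1) * Real.Gamma (deltaPlus d ν - d / 2 + 1)
    / (π ^ ((d : ℝ) / 2) * Real.Gamma (deltaPlus d ν - d + 1))

/-- The integrand `f(t) (cos t)^{-Δ₋}`: for the bulk point at the origin, `σ cos ρ = cos t`, and the
spacelike separated region of the boundary is `|t| < π/2`. -/
def integrand (d : ℕ) (ν : ℝ) (f : ℝ → ℂ) (t : ℝ) : ℂ :=
  f t * ((Real.cos t ^ (-deltaMinus d ν) : ℝ) : ℂ)

/-- The original HKLL expression `∫ K φ` at the origin of AdS. -/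
def originalIntegral (d : ℕ) (ν : ℝ) (φ : ℝ → Sph d → ℂ) : ℂ :=
  (hkllConst d ν : ℂ) *
    ∫ Ω, (∫ t in (-(π / 2))..(π / 2), integrand d ν (fun τ => φ τ Ω) t) ∂(sphereMeasure d)

/-- `b_j⁺`: the Taylor coefficients, in powers of `s = π/2 - t`, of
`f(t) (cos t / (π/2 - t))^{-Δ₋}`; here `cos t / (π/2 - t) = sin s / s = sinc s`. -/
def taylorPlus (d : ℕ) (ν : ℝ) (f : ℝ → ℂ) (j : ℕ) : ℂ :=
  iteratedDeriv j
    (fun s : ℝ => f (π / 2 - s) * ((Real.sinc s ^ (-deltaMinus d ν) : ℝ) : ℂ)) 0 / (j.factorial : ℂ)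

/-- `b_j⁻`: the Taylor coefficients, in powers of `s = t + π/2`, of
`f(t) (cos t / (t + π/2))^{-Δ₋}`; here `cos t / (t + π/2) = sin s / s = sinc s`. -/
def taylorMinus (d : ℕ) (ν : ℝ) (f : ℝ → ℂ) (j : ℕ) : ℂ :=
  iteratedDeriv j
    (fun s : ℝ => f (s - π / 2) * ((Real.sinc s ^ (-deltaMinus d ν) : ℝ) : ℂ)) 0 / (j.factorial : ℂ)

/-- The expression whose limit `ε → 0` is taken: `n₀` regulating terms plus the cut-off integral. -/
def regularized (d n₀ : ℕ) (ν : ℝ) (f : ℝ → ℂ) (ε : ℝ) : ℂ :=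
  (∑ j ∈ Finset.range n₀, (taylorPlus d ν f j + taylorMinus d ν f j)
      * ((ε ^ (-deltaMinus d ν + 1 + j) / (-deltaMinus d ν + 1 + j) : ℝ) : ℂ))
    + ∫ t in (-(π / 2) + ε)..(π / 2 - ε), integrand d ν f t

/-- The limit `ε → 0⁺` of the regularized expression. -/
def regularizedLimit (d n₀ : ℕ) (ν : ℝ) (f : ℝ → ℂ) : ℂ :=
  limUnder (𝓝[>] (0 : ℝ)) (regularized d n₀ ν f)

/-- The formula for the extension `g(ν)` with `n₀` regulating terms. -/
def extendedIntegral (d n₀ : ℕ) (ν : ℝ) (φ : ℝ → Sph d → ℂ) : ℂ :=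
  (hkllConst d ν : ℂ) * ∫ Ω, regularizedLimit d n₀ ν (fun τ => φ τ Ω) ∂(sphereMeasure d)

/-- The range of `ν > 0` reached with `n₀` regulating terms: `-Δ₋ + 1 + n₀ > 0`. -/
def extendedRange (d n₀ : ℕ) : Set ℝ := {ν | 0 < ν ∧ (d : ℝ) / 2 - 1 - n₀ < ν}

/-- None of the denominators `-Δ₋ + 1 + j`, `j < n₀`, vanishes. -/
def Nonexceptional (d n₀ : ℕ) (ν : ℝ) : Prop := ∀ j < n₀, -deltaMinus d ν + 1 + (j : ℝ) ≠ 0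

/-- The integrand on the whole region of integration `(-π/2, π/2) × S^{d-1}` is integrable. -/
def ConvergesAbsolutely (d : ℕ) (ν : ℝ) (φ : ℝ → Sph d → ℂ) : Prop :=
  Integrable (fun p : ℝ × Sph d => integrand d ν (fun τ => φ τ p.2) p.1)
    ((volume.restrict (Ioo (-(π / 2)) (π / 2))).prod (sphereMeasure d))

/-! ### Derivatives of delta functions -/

/-- The `k`-th derivative `δ^{(k)}(t - a)` as a distribution. -/
def deltaDeriv (a : ℝ) (k : ℕ) : 𝓢'(ℝ, ℂ) :=
  (TemperedDistribution.derivCLM ℂ)^[k] (TemperedDistribution.delta a)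

/-- The Taylor coefficients at `0` of `(sin s / s)^{-Δ₋}`. -/
def sincCoeff (d : ℕ) (ν : ℝ) (k : ℕ) : ℝ :=
  iteratedDeriv k (fun s : ℝ => Real.sinc s ^ (-deltaMinus d ν)) 0 / (k.factorial : ℝ)

/-- The leading coefficient is `1`. -/
theorem sincCoeff_zero (d : ℕ) (ν : ℝ) : sincCoeff d ν 0 = 1 := by
  simp [sincCoeff]

/-- `∑_{k ≤ j} c_{j-k}/k! (δ^{(k)}(t - π/2) + (-1)^k δ^{(k)}(t + π/2))`, in which `δ^{(j)}` has the
nonzero coefficients `1/j!` and `(-1)^j/j!`. -/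
def regulatingDistribution (d : ℕ) (ν : ℝ) (j : ℕ) : 𝓢'(ℝ, ℂ) :=
  ∑ k ∈ Finset.range (j + 1), ((sincCoeff d ν (j - k) / (k.factorial : ℝ) : ℝ) : ℂ) •
    (deltaDeriv (π / 2) k + ((-1 : ℂ) ^ k) • deltaDeriv (-(π / 2)) k)

/-- `K` is the extended kernel (at the origin the kernel depends on `t` only) : the limit, in the
sense of distributions, of `C(Δ₊) (∑_j (regulating term)_j + 1_{|t| < π/2 - ε} (cos t)^{-Δ₋})`. -/
def IsExtendedKernel (d n₀ : ℕ) (ν : ℝ) (K : 𝓢'(ℝ, ℂ)) : Prop :=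
  ∀ ψ : 𝓢(ℝ, ℂ),
    Tendsto (fun ε : ℝ => (hkllConst d ν : ℂ) *
        ((∑ j ∈ Finset.range n₀,
            ((ε ^ (-deltaMinus d ν + 1 + j) / (-deltaMinus d ν + 1 + j) : ℝ) : ℂ)
              * regulatingDistribution d ν j ψ)
          + ∫ t in (-(π / 2) + ε)..(π / 2 - ε), integrand d ν ψ t))
      (𝓝[>] (0 : ℝ)) (𝓝 (K ψ))

/-- `K` is an integral kernel: it is given by a locally integrable function. -/
def IsIntegralKernel (K : 𝓢'(ℝ, ℂ)) : Prop :=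
  ∃ k : ℝ → ℂ, LocallyIntegrable k volume ∧
    ∀ ψ : 𝓢(ℝ, ℂ), HasCompactSupport (ψ : ℝ → ℂ) → K ψ = ∫ t, k t * ψ t

end HKLL

end

/-! The whole theorem rests on one identity. If `Φ` is a Dirichlet field with boundary value `φ`,
then at every nonexceptional `ν` the value `Φ(0,0)` is `C(Δ₊)` times the sphere integral of the
Hadamard finite part of `∫ φ (cos t)^{-Δ₋} dt`. Analyticity in `ν` is then free: `g(ν) = Φ_D(0,0)`
is analytic by hypothesis, and what has to be proved is that the regularised integrals compute it.

Reduction to a radial problem. Dividing by `(cos ρ)^{Δ₊}` and averaging over `S^{d-1}` kills the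
spherical Laplacian (`integral_sphere_laplacian_eq_zero`). This leaves a 1+1 dimensional equation,
`RadialWave`, with first-order coefficient `p cot ρ - q tan ρ`, where `p = d - 1` and `q = 2Δ - d +
1` (`IsDirichletField.exists_family`).

Lowering the dimension. The operator `tan ρ ∂_ρ + (p - 1)` sends solutions for `(p, q)` to solutions
for `(p - 2, q + 2)` with the same `Δ`. At the origin it multiplies by `p - 1`. At the boundary the
wave equation turns it into a multiple of `∂_t² + (Δ - p + 1)²`, once `p + q = 2Δ` is used. Since
`d` is odd, `(d - 1)/2` applications reach `p = 0`.

The case `p = 0`. The field `(cos ρ)^Δ u` satisfies a wave equation with potential `Δ(Δ - 1)/cos²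
ρ`. Its Riemann function with vertex at the origin is the Legendre function of degree `Δ - 1` at
`cos t / cos ρ`, which equals 1 on the light cone. Green's identity in the wedge `|t| < ρ` gives a
quantity independent of `ρ`. Its limit at `ρ → 0` is `-2u(0,0)`, and its limit at `ρ → π/2` is a
multiple of `∫ (cos t)^{Δ-1} u(t, π/2) dt`. The multiple is the value of a hypergeometric series at
1, found by Gauss's theorem (`tsum_hypCoeff`).

Finite parts. Going back up, each boundary operator `∂_t² + (b + 2)²` is what two integrations by
parts produce from `(cos t)^b`. So `finitePart`, defined by iterating these, inverts the lowering on
the boundary (`RadialWave.reconstruct`). The discarded boundary terms are `ε^{b+1}` times smooth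
functions of `ε`, so the finite part is the limit of the cut-off integral modulo terms `ε^{b+1+j}`.
If no exponent `b + 1 + j` vanishes that limit is unique, hence it agrees with the limit taken with
the explicit counterterms (`tendsto_regularized`).

Kernel and divergence. The finite part is a tempered distribution, because after finitely many
derivatives it is integration against an integrable weight. In the open interval `|t| < π/2` it is
the function `(cos t)^{-Δ₋}`. This function is not integrable at the end points when `Δ₊ ≤ d - 1`,
which excludes a locally integrable kernel and also gives the divergence statement. -/

namespace HKLL

/-! ### The Gauss hypergeometric series -/

/-- The coefficients of the Gauss hypergeometric series. -/
noncomputable def hypCoeff (A B C : ℝ) : ℕ → ℝ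
  | 0 => 1
  | k + 1 => hypCoeff A B C k * ((A + k) * (B + k) / ((C + k) * (k + 1)))

theorem hypCoeff_succ_mul {A B C : ℝ} (hC : 0 < C) (k : ℕ) :
    (k + 1) * (C + k) * hypCoeff A B C (k + 1) = (A + k) * (B + k) * hypCoeff A B C k := by
  have h1 : (C + k) ≠ 0 := by positivity
  have h2 : ((k : ℝ) + 1) ≠ 0 := by positivity
  simp only [hypCoeff]
  field_simp

/-- The left side telescopes. Once `k * hypCoeff A B C k → 0`, the right side therefore sums to
zero, and this vanishing sum is the contiguous relation in disguise. -/
theorem hypCoeff_telescope {A B C : ℝ} (hC : 0 < C) (k : ℕ) :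
    k * hypCoeff A B C k - (k + 1) * hypCoeff A B C (k + 1)
      = hypCoeff A B C k * ((k * (C - A - B) - A * B) / (C + k)) := by
  have h1 : (C + k) ≠ 0 := by positivity
  have h2 := hypCoeff_succ_mul (A := A) (B := B) hC k
  rw [mul_div_assoc', eq_div_iff h1]
  linear_combination -h2

/-- Raabe's test: for large `k`, the sequence `k |c_k|` drops at step `k` by at least `(s/2) |c_k|`,
where `s = C - A - B`. The tail of the series is thus bounded by a telescoping sum. -/
theorem summable_abs_hypCoeff {A B C : ℝ} (hC : 0 < C) (hs : 0 < C - A - B) :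
    Summable fun k => |hypCoeff A B C k| := by
  set s := C - A - B with hsdef
  -- The last condition is `k s - A B ≥ (s/2)(C + k)` rearranged; the first two fix the sign of the
  -- ratio of successive terms.
  have hev : ∀ᶠ k : ℕ in atTop, (0 ≤ A + k ∧ 0 ≤ B + k) ∧ A * B + s * C / 2 ≤ s / 2 * k := by
    refine ((tendsto_natCast_atTop_atTop (R := ℝ)).eventually_ge_atTop (-A)).and
      ((tendsto_natCast_atTop_atTop (R := ℝ)).eventually_ge_atTop (-B)) |>.and
      ((tendsto_natCast_atTop_atTop (R := ℝ)).eventually_ge_atTop ((A * B + s * C / 2) / (s / 2)))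
      |>.mono ?_
    rintro k ⟨⟨h1, h2⟩, h3⟩
    refine ⟨⟨by linarith, by linarith⟩, ?_⟩
    rw [div_le_iff₀ (by positivity)] at h3
    linarith
  obtain ⟨N, hN⟩ := eventually_atTop.1 hev
  have key : ∀ k ≥ N, s / 2 * |hypCoeff A B C k| ≤
      k * |hypCoeff A B C k| - (k + 1) * |hypCoeff A B C (k + 1)| := by
    intro k hk
    obtain ⟨⟨h1, h2⟩, h3⟩ := hN k hk
    have hCk : 0 < C + k := by positivity
    have h4 : ((k : ℝ) + 1) * (C + k) * |hypCoeff A B C (k + 1)|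
        = (A + k) * (B + k) * |hypCoeff A B C k| := by
      have := congrArg abs (hypCoeff_succ_mul (A := A) (B := B) hC k)
      rw [abs_mul, abs_mul, abs_mul, abs_mul, abs_of_nonneg h1, abs_of_nonneg h2,
        abs_of_pos hCk, abs_of_pos (by positivity : (0 : ℝ) < (k : ℝ) + 1)] at this
      exact this
    have h5 : ((k : ℝ) + 1) * |hypCoeff A B C (k + 1)|
        = (A + k) * (B + k) * |hypCoeff A B C k| / (C + k) := by
      rw [eq_div_iff hCk.ne']; linear_combination h4
    have h6 : (k : ℝ) * |hypCoeff A B C k| - (A + k) * (B + k) * |hypCoeff A B C k| / (C + k)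
        = |hypCoeff A B C k| * (k * s - A * B) / (C + k) := by
      rw [hsdef]; field_simp; ring
    rw [h5, h6, le_div_iff₀ hCk]
    have := abs_nonneg (hypCoeff A B C k)
    nlinarith
  rw [← summable_nat_add_iff N]
  refine summable_of_sum_range_le (c := 2 / s * (N * |hypCoeff A B C N|))
    (fun _ => abs_nonneg _) fun n => ?_
  have : ∀ n : ℕ, s / 2 * ∑ i ∈ Finset.range n, |hypCoeff A B C (i + N)| ≤
      N * |hypCoeff A B C N| - ((n + N : ℕ) : ℝ) * |hypCoeff A B C (n + N)| := by
    intro n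
    induction n with
    | zero => simp
    | succ n ih =>
      rw [Finset.sum_range_succ, mul_add]
      have := key (n + N) (by omega)
      have e : n + 1 + N = n + N + 1 := by ring
      rw [e]
      push_cast at *
      linarith
  have h := this n
  have h' : 0 ≤ ((n + N : ℕ) : ℝ) * |hypCoeff A B C (n + N)| := by positivity
  rw [div_mul_eq_mul_div, le_div_iff₀ hs]
  linarith

theorem summable_hypCoeff {A B C : ℝ} (hC : 0 < C) (hs : 0 < C - A - B) :
    Summable (hypCoeff A B C) := (summable_abs_hypCoeff hC hs).of_abs

theorem summable_hypCoeff_telescope {A B C : ℝ} (hC : 0 < C) (hs : 0 < C - A - B) :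
    Summable fun k : ℕ => hypCoeff A B C k * ((k * (C - A - B) - A * B) / (C + k)) := by
  refine Summable.of_norm_bounded (g := fun k => |hypCoeff A B C k| * (|C - A - B| + |A * B| / C))
    ((summable_abs_hypCoeff hC hs).mul_right _) fun k => ?_
  have hCk : 0 < C + k := by positivity
  rw [norm_mul, Real.norm_eq_abs, Real.norm_eq_abs]
  gcongr
  rw [abs_div, abs_of_pos hCk, div_le_iff₀ hCk]
  have h1 : |k * (C - A - B) - A * B| ≤ k * |C - A - B| + |A * B| := by
    refine (abs_sub _ _).trans ?_
    rw [abs_mul, Nat.abs_cast]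
  refine h1.trans ?_
  have h2 : |A * B| / C * C = |A * B| := div_mul_cancel₀ _ hC.ne'
  have h3 : 0 ≤ |A * B| / C := by positivity
  have h4 : (0:ℝ) ≤ k := by positivity
  nlinarith [abs_nonneg (C - A - B), mul_nonneg h3 h4, mul_nonneg (abs_nonneg (C - A - B)) hC.le]

/-- The limit exists because the telescoped series converges. A nonzero limit would make `|c_k|` at
least a multiple of `1/k`, against absolute summability. -/
theorem tendsto_nat_mul_hypCoeff {A B C : ℝ} (hC : 0 < C) (hs : 0 < C - A - B) :
    Tendsto (fun k : ℕ => (k : ℝ) * hypCoeff A B C k) atTop (𝓝 0) := by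
  have h1 := (summable_hypCoeff_telescope hC hs).hasSum.tendsto_sum_nat
  have h2 : ∀ n : ℕ, ∑ k ∈ Finset.range n,
      hypCoeff A B C k * ((k * (C - A - B) - A * B) / (C + k)) = -(n * hypCoeff A B C n) := by
    intro n
    induction n with
    | zero => simp
    | succ n ih =>
      rw [Finset.sum_range_succ, ih, ← hypCoeff_telescope hC]
      push_cast; ring
  simp_rw [h2] at h1
  set L := ∑' k : ℕ, hypCoeff A B C k * ((k * (C - A - B) - A * B) / (C + k))
  have h3 : Tendsto (fun k : ℕ => (k : ℝ) * hypCoeff A B C k) atTop (𝓝 (-L)) := by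
    simpa using h1.neg
  by_cases hL : L = 0
  · simpa [hL] using h3
  exfalso
  have h4 : ∀ᶠ k : ℕ in atTop, |L| / 2 < |(k : ℝ) * hypCoeff A B C k| := by
    have := h3.abs
    rw [abs_neg] at this
    exact this.eventually_const_lt (by have := abs_pos.2 hL; linarith)
  obtain ⟨N, hN⟩ := eventually_atTop.1 h4
  refine Real.not_summable_natCast_inv ?_
  rw [← summable_nat_add_iff (N + 1)]
  refine Summable.of_nonneg_of_le (fun _ => by positivity) (fun k => ?_)
    (((summable_nat_add_iff (N + 1)).2 (summable_abs_hypCoeff hC hs)).mul_left (2 / |L|))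
  have := hN (k + (N + 1)) (by omega)
  rw [abs_mul, Nat.abs_cast] at this
  have hL' := abs_pos.2 hL
  have hk : (0 : ℝ) < ((k + (N + 1) : ℕ) : ℝ) := by positivity
  rw [inv_le_iff_one_le_mul₀ hk, div_mul_eq_mul_div, div_mul_eq_mul_div, le_div_iff₀ hL']
  linarith

theorem hypCoeff_add_one {A B C : ℝ} (hC : 0 < C) (k : ℕ) :
    hypCoeff A B (C + 1) k = hypCoeff A B C k * (C / (C + k)) := by
  induction k with
  | zero => simp [hypCoeff, hC.ne']
  | succ k ih =>
    have h1 : (C + k) ≠ 0 := by positivity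
    have h2 : (C + 1 + k) ≠ 0 := by positivity
    have h3 : (C + (k + 1)) ≠ 0 := by positivity
    simp only [hypCoeff, ih]
    push_cast
    field_simp
    ring

/-- The contiguous relation for the value of the hypergeometric function at `1`. -/
theorem tsum_hypCoeff_contiguous {A B C : ℝ} (hC : 0 < C) (hs : 0 < C - A - B) :
    C * (C - A - B) * ∑' k, hypCoeff A B C k
      = (C - A) * (C - B) * ∑' k, hypCoeff A B (C + 1) k := by
  have h1 := (summable_hypCoeff_telescope hC hs).hasSum
  have h1' : HasSum (fun k : ℕ => hypCoeff A B C k * ((k * (C - A - B) - A * B) / (C + k))) 0 := by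
    have h2 := h1.tendsto_sum_nat
    have h3 : ∀ n : ℕ, ∑ k ∈ Finset.range n,
        hypCoeff A B C k * ((k * (C - A - B) - A * B) / (C + k)) = -(n * hypCoeff A B C n) := by
      intro n
      induction n with
      | zero => simp
      | succ n ih =>
        rw [Finset.sum_range_succ, ih, ← hypCoeff_telescope hC]
        push_cast; ring
    simp_rw [h3] at h2
    have h4 := tendsto_nhds_unique h2 (tendsto_nat_mul_hypCoeff hC hs).neg
    rw [h4, neg_zero] at h1
    exact h1
  have h2 := (summable_hypCoeff hC hs).hasSum
  have h3 := (summable_hypCoeff (A := A) (B := B) (C := C + 1) (by positivity)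
    (by linarith)).hasSum
  have h4 := (h2.mul_left (C * (C - A - B))).sub (h3.mul_left ((C - A) * (C - B)))
  have h5 := h1'.mul_left C
  rw [mul_zero] at h5
  -- Since `hypCoeff A B (C + 1) k` is `C / (C + k)` times `hypCoeff A B C k`, the contiguous
  -- relation holds termwise up to `C` times the telescoping term, whose sum is zero.
  have h6 : (fun k : ℕ => C * (hypCoeff A B C k * ((k * (C - A - B) - A * B) / (C + k)))) =
      fun k : ℕ => C * (C - A - B) * hypCoeff A B C k
        - (C - A) * (C - B) * hypCoeff A B (C + 1) k := by
    funext k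
    have h1 : (C + k) ≠ 0 := by positivity
    rw [hypCoeff_add_one hC]
    field_simp
    ring
  rw [h6] at h5
  exact sub_eq_zero.1 (h4.unique h5)

/-- Supplies the dominating series for the limit `C → ∞`, in which only the constant term 1
survives. -/
theorem abs_hypCoeff_add_nat_le {A B C : ℝ} (hC : 0 < C) (n k : ℕ) :
    |hypCoeff A B (C + n) k| ≤ |hypCoeff A B C k| := by
  induction n with
  | zero => simp
  | succ n ih =>
    refine le_trans ?_ ih
    have e : C + ((n + 1 : ℕ) : ℝ) = C + n + 1 := by push_cast; ring
    have hpos : 0 < C + n := by positivity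
    rw [e, hypCoeff_add_one hpos, abs_mul]
    refine mul_le_of_le_one_right (abs_nonneg _) ?_
    rw [abs_of_nonneg (by positivity)]
    exact div_le_one_of_le₀ (by linarith [(Nat.cast_nonneg k : (0 : ℝ) ≤ k)]) (by positivity)

theorem tendsto_hypCoeff_add_nat {A B C : ℝ} (hC : 0 < C) (k : ℕ) :
    Tendsto (fun n : ℕ => hypCoeff A B (C + n) k) atTop (𝓝 (if k = 0 then 1 else 0)) := by
  rcases k with _ | k
  · simp [hypCoeff]
  simp only [Nat.add_eq_zero_iff, one_ne_zero, and_false, if_false]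
  have hb : ∀ n : ℕ, ‖hypCoeff A B (C + n) (k + 1)‖ ≤
      |hypCoeff A B C k| * |(A + k) * (B + k)| * (1 / ((n : ℝ) + C)) := by
    intro n
    simp only [hypCoeff]
    rw [norm_mul, Real.norm_eq_abs, Real.norm_eq_abs, abs_div, mul_assoc]
    have hd : |(C + n + k) * ((k : ℝ) + 1)| = (C + n + k) * ((k : ℝ) + 1) :=
      abs_of_pos (by positivity)
    have hd' : (n : ℝ) + C ≤ (C + n + k) * ((k : ℝ) + 1) := by
      have h1 : (0 : ℝ) ≤ k := by positivity
      have h2 : (0 : ℝ) ≤ n := by positivity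
      nlinarith [mul_nonneg h1 h1, mul_nonneg h1 h2, mul_nonneg h1 hC.le]
    rw [hd, mul_one_div]
    exact mul_le_mul (abs_hypCoeff_add_nat_le hC n k)
      (div_le_div_of_nonneg_left (abs_nonneg _) (by positivity) hd') (by positivity)
      (abs_nonneg _)
  refine squeeze_zero_norm hb ?_
  have : Tendsto (fun n : ℕ => 1 / ((n : ℝ) + C)) atTop (𝓝 0) := by
    simp_rw [one_div]
    exact tendsto_inv_atTop_zero.comp (tendsto_atTop_add_const_right _ _ tendsto_natCast_atTop_atTop)
  simpa using this.const_mul (|hypCoeff A B C k| * |(A + k) * (B + k)|)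

theorem tendsto_tsum_hypCoeff {A B C : ℝ} (hC : 0 < C) (hs : 0 < C - A - B) :
    Tendsto (fun n : ℕ => ∑' k, hypCoeff A B (C + n) k) atTop (𝓝 1) := by
  have h := tendsto_tsum_of_dominated_convergence (𝓕 := atTop)
    (f := fun (n : ℕ) k => hypCoeff A B (C + n) k) (g := fun k : ℕ => if k = 0 then (1 : ℝ) else 0)
    (summable_abs_hypCoeff hC hs) (tendsto_hypCoeff_add_nat hC)
    (Eventually.of_forall fun n k => abs_hypCoeff_add_nat_le hC n k)
  simpa using h

/-- Gauss's summation theorem. -/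
theorem tsum_hypCoeff {A B C : ℝ} (hC : 0 < C) (hs : 0 < C - A - B) (hA : 0 < C - A)
    (hB : 0 < C - B) :
    ∑' k, hypCoeff A B C k
      = Real.Gamma C * Real.Gamma (C - A - B) / (Real.Gamma (C - A) * Real.Gamma (C - B)) := by
  -- The contiguous relation iterated `n` times. The sum on the right tends to 1, so the series
  -- equals the limit of a ratio of Pochhammer products.
  have hprod : ∀ n : ℕ,
      (∏ j ∈ Finset.range n, (C + j)) * (∏ j ∈ Finset.range n, (C - A - B + j))
        * ∑' k, hypCoeff A B C k
      = (∏ j ∈ Finset.range n, (C - A + j)) * (∏ j ∈ Finset.range n, (C - B + j))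
        * ∑' k, hypCoeff A B (C + n) k := by
    intro n
    induction n with
    | zero => simp
    | succ n ih =>
      have hn : (0 : ℝ) ≤ n := by positivity
      have h1 := tsum_hypCoeff_contiguous (A := A) (B := B) (C := C + n) (by positivity)
        (by linarith)
      have e : C + ((n + 1 : ℕ) : ℝ) = C + n + 1 := by push_cast; ring
      rw [e]
      simp only [Finset.prod_range_succ]
      linear_combination (C + n) * (C - A - B + n) * ih +
        (∏ j ∈ Finset.range n, (C - A + j)) * (∏ j ∈ Finset.range n, (C - B + j)) * h1
  have hpos : ∀ s : ℝ, 0 < s → ∀ n : ℕ, 0 < ∏ j ∈ Finset.range n, (s + j) := fun s hs n =>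
    Finset.prod_pos fun j _ => by positivity
  have hseq : ∀ n : ℕ, n ≠ 0 → (∑' k, hypCoeff A B C k)
      = Real.GammaSeq C n * Real.GammaSeq (C - A - B) n
          / (Real.GammaSeq (C - A) n * Real.GammaSeq (C - B) n)
        * ∑' k, hypCoeff A B (C + (n + 1 : ℕ)) k := by
    intro n hn
    have h := hprod (n + 1)
    have p1 := (hpos C hC (n + 1)).ne'
    have p2 := (hpos _ hs (n + 1)).ne'
    have p3 := (hpos _ hA (n + 1)).ne'
    have p4 := (hpos _ hB (n + 1)).ne'
    have hn' : (0 : ℝ) < n := by positivity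
    have hp : (n : ℝ) ^ C * (n : ℝ) ^ (C - A - B) = (n : ℝ) ^ (C - A) * (n : ℝ) ^ (C - B) := by
      rw [← Real.rpow_add hn', ← Real.rpow_add hn']; ring_nf
    have q3 := (Real.rpow_pos_of_pos hn' (C - A)).ne'
    have q4 := (Real.rpow_pos_of_pos hn' (C - B)).ne'
    have hf : (n.factorial : ℝ) ≠ 0 := by positivity
    simp only [Real.GammaSeq]
    set P1 := ∏ j ∈ Finset.range (n + 1), (C + (j : ℝ))
    set P2 := ∏ j ∈ Finset.range (n + 1), (C - A - B + (j : ℝ))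
    set P3 := ∏ j ∈ Finset.range (n + 1), (C - A + (j : ℝ))
    set P4 := ∏ j ∈ Finset.range (n + 1), (C - B + (j : ℝ))
    have : (n : ℝ) ^ C * n.factorial / P1 * ((n : ℝ) ^ (C - A - B) * n.factorial / P2)
        / ((n : ℝ) ^ (C - A) * n.factorial / P3 * ((n : ℝ) ^ (C - B) * n.factorial / P4))
        = P3 * P4 / (P1 * P2) := by
      have : (n : ℝ) ^ C * n.factorial / P1 * ((n : ℝ) ^ (C - A - B) * n.factorial / P2)
        = ((n : ℝ) ^ (C - A) * (n : ℝ) ^ (C - B)) * n.factorial ^ 2 / (P1 * P2) := by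
        rw [← hp]; field_simp
      rw [this]
      field_simp
    rw [this, div_mul_eq_mul_div, eq_div_iff (mul_ne_zero p1 p2)]
    linear_combination h
  have hlim : Tendsto (fun n : ℕ => Real.GammaSeq C n * Real.GammaSeq (C - A - B) n
          / (Real.GammaSeq (C - A) n * Real.GammaSeq (C - B) n)
        * ∑' k, hypCoeff A B (C + (n + 1 : ℕ)) k) atTop
      (𝓝 (Real.Gamma C * Real.Gamma (C - A - B)
        / (Real.Gamma (C - A) * Real.Gamma (C - B)) * 1)) := by
    refine Tendsto.mul (Tendsto.div ((Real.GammaSeq_tendsto_Gamma _).mul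
      (Real.GammaSeq_tendsto_Gamma _)) ((Real.GammaSeq_tendsto_Gamma _).mul
      (Real.GammaSeq_tendsto_Gamma _)) ?_) ?_
    · exact mul_ne_zero (Real.Gamma_pos_of_pos hA).ne' (Real.Gamma_pos_of_pos hB).ne'
    · exact (tendsto_tsum_hypCoeff hC hs).comp (tendsto_add_atTop_nat 1)
  rw [mul_one] at hlim
  refine tendsto_nhds_unique (tendsto_const_nhds.congr' ?_) hlim
  filter_upwards [eventually_ne_atTop 0] with n hn
  exact hseq n hn

/-! ### Power series and their derivatives -/

/-- Coefficients of the derivative of a power series. -/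
def derivCoeff (c : ℕ → ℝ) (k : ℕ) : ℝ := (k + 1) * c (k + 1)

/-- The sum of a power series. -/
noncomputable def powSum (c : ℕ → ℝ) (x : ℝ) : ℝ := ∑' k, c k * x ^ k

/-- The radius of convergence is at least `1`. -/
def ConvOnDisc (c : ℕ → ℝ) : Prop := ∀ r : ℝ, 0 ≤ r → r < 1 → Summable fun k => |c k| * r ^ k

theorem ConvOnDisc.hasSum {c : ℕ → ℝ} (hc : ConvOnDisc c) {x : ℝ} (hx : |x| < 1) :
    HasSum (fun k => c k * x ^ k) (powSum c x) := by
  refine Summable.hasSum (Summable.of_norm ?_)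
  simpa [norm_mul] using hc |x| (abs_nonneg _) hx

theorem ConvOnDisc.derivCoeff {c : ℕ → ℝ} (hc : ConvOnDisc c) : ConvOnDisc (derivCoeff c) := by
  intro r hr hr1
  obtain ⟨ρ, hρ, hρ1⟩ := exists_between hr1
  have hρ0 : 0 < ρ := hr.trans_lt hρ
  have h1 := hc ρ hρ0.le hρ1
  have h2 : Summable fun k : ℕ => |c (k + 1)| * ρ ^ (k + 1) := (summable_nat_add_iff 1).2 h1
  have h3 : Tendsto (fun k : ℕ => ((k : ℝ) + 1) * (r / ρ) ^ k) atTop (𝓝 0) := by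
    have hq : r / ρ < 1 := (div_lt_one hρ0).2 hρ
    have hq0 : 0 ≤ r / ρ := by positivity
    have := (tendsto_self_mul_const_pow_of_lt_one hq0 hq).add
      (tendsto_pow_atTop_nhds_zero_of_lt_one hq0 hq)
    simp only [add_zero] at this
    exact this.congr fun k => by ring
  obtain ⟨M, hM⟩ := h3.bddAbove_range
  refine Summable.of_nonneg_of_le (fun _ => by positivity) (fun k => ?_) (h2.mul_left (M / ρ))
  have hk : ((k : ℝ) + 1) * (r / ρ) ^ k ≤ M := hM ⟨k, rfl⟩
  have e : |HKLL.derivCoeff c k| * r ^ k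
      = ((k : ℝ) + 1) * (r / ρ) ^ k / ρ * (|c (k + 1)| * ρ ^ (k + 1)) := by
    rw [HKLL.derivCoeff, abs_mul, abs_of_pos (by positivity : (0 : ℝ) < (k : ℝ) + 1), div_pow]
    field_simp
    ring
  rw [e]
  gcongr

theorem ConvOnDisc.hasDerivAt {c : ℕ → ℝ} (hc : ConvOnDisc c) {x : ℝ} (hx : |x| < 1) :
    HasDerivAt (powSum c) (powSum (HKLL.derivCoeff c) x) x := by
  obtain ⟨r, hr, hr1⟩ := exists_between hx
  have hr0 : 0 < r := (abs_nonneg _).trans_lt hr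
  have hd := hc.derivCoeff
  have hu : Summable fun k : ℕ => |c k| * (k * r ^ (k - 1)) := by
    rw [← summable_nat_add_iff 1]
    refine (hd r hr0.le hr1).congr fun k => ?_
    rw [HKLL.derivCoeff, abs_mul, abs_of_pos (by positivity : (0 : ℝ) < (k : ℝ) + 1)]
    push_cast
    ring
  have hxm : x ∈ Metric.ball (0 : ℝ) r := by simpa using hr
  have h := hasDerivAt_tsum_of_isPreconnected hu (t := Metric.ball (0 : ℝ) r) Metric.isOpen_ball
    (convex_ball _ _).isPreconnected (g := fun k y => c k * y ^ k)
    (g' := fun k y => c k * (k * y ^ (k - 1)))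
    (fun k y _ => (hasDerivAt_pow k y).const_mul (c k))
    (fun k y hy => by
      rw [norm_mul, Real.norm_eq_abs, norm_mul, norm_pow, Real.norm_natCast]
      have : ‖y‖ ≤ r := (by simpa using hy : |y| < r).le
      gcongr) hxm (hc.hasSum hx).summable hxm
  refine h.congr_deriv ?_
  rw [Summable.tsum_eq_zero_add]
  · simp only [powSum, HKLL.derivCoeff, Nat.cast_zero, zero_mul, mul_zero, zero_add]
    congr 1; funext k
    rw [Nat.add_sub_cancel]; push_cast; ring
  · refine Summable.of_norm_bounded hu fun k => ?_
    rw [norm_mul, Real.norm_eq_abs, norm_mul, norm_pow, Real.norm_natCast]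
    have : ‖x‖ ≤ r := hr.le
    gcongr

/-! ### Abel-type limits at the end point `1` for absolutely summable coefficients. -/

theorem convOnDisc_of_summable {c : ℕ → ℝ} (hc : Summable fun k => |c k|) : ConvOnDisc c := by
  intro r hr hr1
  refine Summable.of_nonneg_of_le (fun _ => by positivity) (fun k => ?_) hc
  exact mul_le_of_le_one_right (abs_nonneg _) (pow_le_one₀ hr hr1.le)

theorem abs_powSum_le {c : ℕ → ℝ} (hc : Summable fun k => |c k|) {x : ℝ} (hx : |x| ≤ 1) :
    |powSum c x| ≤ ∑' k, |c k| := by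
  rw [← Real.norm_eq_abs]
  refine tsum_of_norm_bounded hc.hasSum fun k => ?_
  rw [norm_mul, norm_pow, Real.norm_eq_abs, Real.norm_eq_abs]
  exact mul_le_of_le_one_right (abs_nonneg _) (pow_le_one₀ (abs_nonneg _) hx)

theorem tendsto_powSum_one {c : ℕ → ℝ} (hc : Summable fun k => |c k|) :
    Tendsto (powSum c) (𝓝[<] 1) (𝓝 (∑' k, c k)) := by
  refine tendsto_tsum_of_dominated_convergence hc (fun k => ?_) ?_
  · have : Tendsto (fun x : ℝ => c k * x ^ k) (𝓝 1) (𝓝 (c k * 1 ^ k)) :=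
      (by fun_prop : Continuous fun x : ℝ => c k * x ^ k).tendsto 1
    simpa using this.mono_left nhdsWithin_le_nhds
  · have : ∀ᶠ x : ℝ in 𝓝[<] 1, x ∈ Ioo (0 : ℝ) 1 := Ioo_mem_nhdsLT one_pos
    filter_upwards [this] with x hx k
    rw [norm_mul, norm_pow, Real.norm_eq_abs, Real.norm_eq_abs, abs_of_pos hx.1]
    exact mul_le_of_le_one_right (abs_nonneg _) (pow_le_one₀ hx.1.le hx.2.le)

/-- Each of the `k + 1` terms of the geometric sum is at least `x^k`, and `(1 - x)` times that sum
is `1 - x^{k+1} ≤ 1`. This absorbs the factor `k + 1` created by differentiation, so that `∑ |c_k|`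
alone dominates `(1 - x) F'(x)`. -/
theorem succ_mul_one_sub_mul_pow_le {x : ℝ} (h0 : 0 ≤ x) (h1 : x ≤ 1) (k : ℕ) :
    ((k : ℝ) + 1) * ((1 - x) * x ^ k) ≤ 1 := by
  have h2 : ((k : ℝ) + 1) * x ^ k ≤ ∑ j ∈ Finset.range (k + 1), x ^ j := by
    have : ∑ j ∈ Finset.range (k + 1), x ^ k ≤ ∑ j ∈ Finset.range (k + 1), x ^ j := by
      refine Finset.sum_le_sum fun j hj => pow_le_pow_of_le_one h0 h1 ?_
      have := Finset.mem_range.1 hj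
      omega
    simpa using this
  have h3 := mul_neg_geom_sum x (k + 1)
  have h4 : 0 ≤ x ^ (k + 1) := by positivity
  nlinarith

theorem norm_one_sub_mul_derivCoeff_le (c : ℕ → ℝ) {x : ℝ} (h0 : 0 ≤ x) (h1 : x ≤ 1) (k : ℕ) :
    ‖(1 - x) * (derivCoeff c k * x ^ k)‖ ≤ |c (k + 1)| := by
  have e : (1 - x) * (derivCoeff c k * x ^ k)
      = ((k : ℝ) + 1) * ((1 - x) * x ^ k) * c (k + 1) := by
    rw [derivCoeff]; ring
  rw [e, norm_mul, Real.norm_eq_abs, Real.norm_eq_abs]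
  refine mul_le_of_le_one_left (abs_nonneg _) ?_
  rw [abs_of_nonneg]
  · exact succ_mul_one_sub_mul_pow_le h0 h1 k
  · have := sub_nonneg.2 h1
    positivity

theorem abs_one_sub_mul_powSum_derivCoeff_le {c : ℕ → ℝ} (hc : Summable fun k => |c k|) {x : ℝ}
    (h0 : 0 ≤ x) (h1 : x ≤ 1) :
    |(1 - x) * powSum (derivCoeff c) x| ≤ ∑' k, |c (k + 1)| := by
  rw [powSum, ← tsum_mul_left, ← Real.norm_eq_abs]
  exact tsum_of_norm_bounded ((summable_nat_add_iff 1).2 hc).hasSum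
    fun k => norm_one_sub_mul_derivCoeff_le c h0 h1 k

/-- `F'` may blow up at 1, but each term of `(1 - x) F'(x)` vanishes there and dominated convergence
applies. This removes the derivative of the Riemann function from the flux at the conformal
boundary. -/
theorem tendsto_one_sub_mul_powSum_derivCoeff {c : ℕ → ℝ} (hc : Summable fun k => |c k|) :
    Tendsto (fun x => (1 - x) * powSum (derivCoeff c) x) (𝓝[<] 1) (𝓝 0) := by
  have h : Tendsto (fun x : ℝ => ∑' k, (1 - x) * (derivCoeff c k * x ^ k)) (𝓝[<] 1)
      (𝓝 (∑' k : ℕ, (0 : ℝ))) := by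
    refine tendsto_tsum_of_dominated_convergence ((summable_nat_add_iff 1).2 hc) (fun k => ?_) ?_
    · have : Tendsto (fun x : ℝ => (1 - x) * (derivCoeff c k * x ^ k)) (𝓝 1)
          (𝓝 ((1 - 1) * (derivCoeff c k * 1 ^ k))) :=
        (by fun_prop : Continuous fun x : ℝ => (1 - x) * (derivCoeff c k * x ^ k)).tendsto 1
      simpa using this.mono_left nhdsWithin_le_nhds
    · have : ∀ᶠ x : ℝ in 𝓝[<] 1, x ∈ Ioo (0 : ℝ) 1 := Ioo_mem_nhdsLT one_pos
      filter_upwards [this] with x hx k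
      exact norm_one_sub_mul_derivCoeff_le c hx.1.le hx.2.le k
  simpa [powSum, tsum_mul_left] using h

/-- The hypergeometric differential equation. -/
theorem hypergeometric_ode {A B C : ℝ} (hC : 0 < C) (hc : ConvOnDisc (hypCoeff A B C)) {z : ℝ}
    (hz : |z| < 1) :
    z * (1 - z) * powSum (derivCoeff (derivCoeff (hypCoeff A B C))) z
      + (C - (A + B + 1) * z) * powSum (derivCoeff (hypCoeff A B C)) z
      - A * B * powSum (hypCoeff A B C) z = 0 := by
  set t := hypCoeff A B C with ht
  have s0 := hc.hasSum hz
  have s1 := hc.derivCoeff.hasSum hz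
  have s2 := hc.derivCoeff.derivCoeff.hasSum hz
  have zs1 : HasSum (fun k : ℕ => (k : ℝ) * t k * z ^ k) (z * powSum (derivCoeff t) z) := by
    rw [← hasSum_nat_add_iff' 1]
    simp only [Finset.range_one, Finset.sum_singleton, Nat.cast_zero, zero_mul, sub_zero]
    refine (s1.mul_left z).congr_fun fun k => ?_
    simp only [derivCoeff]; push_cast; ring
  have zs2 : HasSum (fun k : ℕ => (k : ℝ) * derivCoeff t k * z ^ k)
      (z * powSum (derivCoeff (derivCoeff t)) z) := by
    rw [← hasSum_nat_add_iff' 1]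
    simp only [Finset.range_one, Finset.sum_singleton, Nat.cast_zero, zero_mul, sub_zero]
    refine (s2.mul_left z).congr_fun fun k => ?_
    simp only [derivCoeff]; push_cast; ring
  have zzs2 : HasSum (fun k : ℕ => (k : ℝ) * (k - 1) * t k * z ^ k)
      (z * (z * powSum (derivCoeff (derivCoeff t)) z)) := by
    rw [← hasSum_nat_add_iff' 1]
    simp only [Finset.range_one, Finset.sum_singleton, Nat.cast_zero, zero_mul, sub_zero]
    refine (zs2.mul_left z).congr_fun fun k => ?_
    simp only [derivCoeff]; push_cast; ring
  have h := ((zs2.sub zzs2).add ((s1.mul_left C).sub (zs1.mul_left (A + B + 1)))).sub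
    (s0.mul_left (A * B))
  -- After the index shifts the coefficient of `z^k` is the two-term recursion of the series.
  have h0 : (fun k : ℕ => (k : ℝ) * derivCoeff t k * z ^ k - (k : ℝ) * (k - 1) * t k * z ^ k +
      (C * (derivCoeff t k * z ^ k) - (A + B + 1) * ((k : ℝ) * t k * z ^ k)) -
      A * B * (t k * z ^ k)) = fun _ => 0 := by
    funext k
    have := hypCoeff_succ_mul (A := A) (B := B) hC k
    rw [← ht] at this
    simp only [derivCoeff]
    linear_combination z ^ k * this
  rw [h0] at h
  have := h.unique hasSum_zero
  linear_combination this

/-! ### Smooth functions on the strip `ℝ × [0, π/2]` -/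

/-- The strip `ℝ × [0, π/2]` of pairs `(t, ρ)`. -/
def strip : Set (ℝ × ℝ) := univ ×ˢ Icc 0 (π / 2)

theorem mem_strip {t ρ : ℝ} : (t, ρ) ∈ strip ↔ ρ ∈ Icc 0 (π / 2) := by simp [strip]

theorem convex_strip : Convex ℝ strip := convex_univ.prod (convex_Icc _ _)

theorem interior_strip : interior strip = univ ×ˢ Ioo 0 (π / 2) := by
  rw [strip, interior_prod_eq, interior_univ, interior_Icc]

theorem uniqueDiffOn_strip : UniqueDiffOn ℝ strip :=
  uniqueDiffOn_univ.prod (uniqueDiffOn_Icc (by positivity))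

theorem strip_subset_closure_interior : strip ⊆ closure (interior strip) := by
  rw [interior_strip, closure_prod_eq, closure_univ, closure_Ioo (by positivity)]
  exact subset_rfl

/-- Directional derivative within the strip. -/
noncomputable def stripDeriv (v : ℝ × ℝ) (u : ℝ × ℝ → ℂ) (x : ℝ × ℝ) : ℂ :=
  fderivWithin ℝ u strip x v

/-- The time derivative. -/
noncomputable abbrev dt (u : ℝ × ℝ → ℂ) : ℝ × ℝ → ℂ := stripDeriv (1, 0) u

/-- The radial derivative. -/
noncomputable abbrev dr (u : ℝ × ℝ → ℂ) : ℝ × ℝ → ℂ := stripDeriv (0, 1) u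

/-- Smoothness up to the boundary of the strip. -/
abbrev SmoothOnStrip (u : ℝ × ℝ → ℂ) : Prop := ContDiffOn ℝ ∞ u strip

theorem SmoothOnStrip.stripDeriv {u : ℝ × ℝ → ℂ} (hu : SmoothOnStrip u) (v : ℝ × ℝ) :
    SmoothOnStrip (stripDeriv v u) :=
  (hu.fderivWithin uniqueDiffOn_strip (m := ∞) (by simp)).clm_apply contDiffOn_const

theorem SmoothOnStrip.hasFDerivWithinAt {u : ℝ × ℝ → ℂ} (hu : SmoothOnStrip u) {x : ℝ × ℝ}
    (hx : x ∈ strip) : HasFDerivWithinAt u (fderivWithin ℝ u strip x) strip x :=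
  ((hu.differentiableOn (by simp)) x hx).hasFDerivWithinAt

theorem SmoothOnStrip.hasDerivAt_time {u : ℝ × ℝ → ℂ} (hu : SmoothOnStrip u) {t ρ : ℝ}
    (hρ : ρ ∈ Icc 0 (π / 2)) : HasDerivAt (fun τ => u (τ, ρ)) (dt u (t, ρ)) t := by
  have h1 : HasDerivWithinAt (fun τ : ℝ => (τ, ρ)) ((1 : ℝ), (0 : ℝ)) univ t :=
    ((hasDerivAt_id t).prodMk (hasDerivAt_const t ρ)).hasDerivWithinAt
  have h := (hu.hasFDerivWithinAt (mem_strip.2 hρ)).comp_hasDerivWithinAt t h1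
    (fun τ _ => mem_strip.2 hρ)
  exact hasDerivWithinAt_univ.1 h

theorem SmoothOnStrip.hasDerivWithinAt_radius {u : ℝ × ℝ → ℂ} (hu : SmoothOnStrip u) {t ρ : ℝ}
    (hρ : ρ ∈ Icc 0 (π / 2)) :
    HasDerivWithinAt (fun r => u (t, r)) (dr u (t, ρ)) (Icc 0 (π / 2)) ρ := by
  have h1 : HasDerivWithinAt (fun r : ℝ => (t, r)) ((0 : ℝ), (1 : ℝ)) (Icc 0 (π / 2)) ρ :=
    ((hasDerivAt_const ρ t).prodMk (hasDerivAt_id ρ)).hasDerivWithinAt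
  exact (hu.hasFDerivWithinAt (mem_strip.2 hρ)).comp_hasDerivWithinAt ρ h1
    (fun r hr => mem_strip.2 hr)

theorem SmoothOnStrip.hasDerivAt_radius {u : ℝ × ℝ → ℂ} (hu : SmoothOnStrip u) {t ρ : ℝ}
    (hρ : ρ ∈ Ioo 0 (π / 2)) : HasDerivAt (fun r => u (t, r)) (dr u (t, ρ)) ρ :=
  (hu.hasDerivWithinAt_radius (Ioo_subset_Icc_self hρ)).hasDerivAt (Icc_mem_nhds hρ.1 hρ.2)

theorem stripDeriv_congr {u v : ℝ × ℝ → ℂ} (h : EqOn u v strip) (w : ℝ × ℝ) :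
    EqOn (stripDeriv w u) (stripDeriv w v) strip := fun x hx => by
  rw [stripDeriv, stripDeriv, fderivWithin_congr h (h hx)]

theorem SmoothOnStrip.stripDeriv_comm {u : ℝ × ℝ → ℂ} (hu : SmoothOnStrip u) (v w : ℝ × ℝ) :
    EqOn (HKLL.stripDeriv v (HKLL.stripDeriv w u)) (HKLL.stripDeriv w (HKLL.stripDeriv v u))
      strip := by
  intro x hx
  have hd : DifferentiableWithinAt ℝ (fderivWithin ℝ u strip) strip x :=
    (hu.fderivWithin uniqueDiffOn_strip (m := ∞) (by simp)).differentiableOn (by simp) x hx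
  have e : ∀ a b : ℝ × ℝ, HKLL.stripDeriv a (HKLL.stripDeriv b u) x
      = fderivWithin ℝ (fderivWithin ℝ u strip) strip x a b := by
    intro a b
    have h := hd.hasFDerivWithinAt.clm_apply (hasFDerivWithinAt_const b x strip)
    have h2 := h.fderivWithin (uniqueDiffOn_strip x hx)
    change fderivWithin ℝ (fun y => fderivWithin ℝ u strip y b) strip x a = _
    rw [h2]
    simp
  rw [e, e]
  have := (hu x hx).isSymmSndFDerivWithinAt
    (by simpa using WithTop.coe_le_coe.2 (le_top : (2 : ℕ∞) ≤ ⊤)) uniqueDiffOn_strip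
    (strip_subset_closure_interior hx) hx
  exact this v w

theorem hasDerivAt_dt_unique {u : ℝ × ℝ → ℂ} (hu : SmoothOnStrip u) {t ρ : ℝ} {z : ℂ}
    (hρ : ρ ∈ Icc 0 (π / 2)) (h : HasDerivAt (fun τ => u (τ, ρ)) z t) : dt u (t, ρ) = z :=
  (hu.hasDerivAt_time hρ).unique h

theorem hasDerivAt_dr_unique {u : ℝ × ℝ → ℂ} (hu : SmoothOnStrip u) {t ρ : ℝ} {z : ℂ}
    (hρ : ρ ∈ Ioo 0 (π / 2)) (h : HasDerivAt (fun r => u (t, r)) z ρ) : dr u (t, ρ) = z :=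
  (hu.hasDerivAt_radius hρ).unique h

/-! ### The radial wave equation and the dimension-lowering operator -/

/-- The wave equation of spherically symmetric fields, for `u = F / (cos ρ)^Δ`. -/
def RadialWave (p q Δ : ℝ) (u : ℝ × ℝ → ℂ) : Prop :=
  ∀ t : ℝ, ∀ ρ ∈ Ioo (0 : ℝ) (π / 2),
    dt (dt u) (t, ρ) = dr (dr u) (t, ρ)
      + ((p * (Real.cos ρ / Real.sin ρ) - q * Real.tan ρ : ℝ) : ℂ) * dr u (t, ρ)
      - (Δ : ℂ) ^ 2 * u (t, ρ)

/-- `q tan ρ ∂_ρ u` expressed through the wave equation, which is smooth at `ρ = π/2`. -/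
noncomputable def tangentialPart (p Δ : ℝ) (u : ℝ × ℝ → ℂ) (x : ℝ × ℝ) : ℂ :=
  dr (dr u) x + ((p * (Real.cos x.2 / Real.sin x.2) : ℝ) : ℂ) * dr u x - (Δ : ℂ) ^ 2 * u x
    - dt (dt u) x

/-- The operator `tan ρ ∂_ρ + (p - 1)`, which lowers the dimension by two. -/
noncomputable def lower (p q Δ : ℝ) (u : ℝ × ℝ → ℂ) (x : ℝ × ℝ) : ℂ :=
  -- The two formulas agree for `0 < ρ < π/2` by the wave equation. The first is regular at `ρ = 0`,
  -- where `cot ρ` is singular; the second at `ρ = π/2`, where `tan ρ` is. The switching point `π/4`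
  -- is arbitrary.
  if x.2 < π / 4 then (Real.tan x.2 : ℂ) * dr u x + ((p - 1 : ℝ) : ℂ) * u x
  else (q : ℂ)⁻¹ * tangentialPart p Δ u x + ((p - 1 : ℝ) : ℂ) * u x

theorem RadialWave.tangentialPart_eq {p q Δ : ℝ} {u : ℝ × ℝ → ℂ} (h : RadialWave p q Δ u)
    {t ρ : ℝ} (hρ : ρ ∈ Ioo (0 : ℝ) (π / 2)) :
    tangentialPart p Δ u (t, ρ) = q * (Real.tan ρ * dr u (t, ρ)) := by
  rw [tangentialPart, h t ρ hρ]
  push_cast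
  ring

theorem lower_eq_of_lt {p q Δ : ℝ} (hq : q ≠ 0) {u : ℝ × ℝ → ℂ} (h : RadialWave p q Δ u)
    {t ρ : ℝ} (h1 : ρ < π / 2) :
    lower p q Δ u (t, ρ) = (Real.tan ρ : ℂ) * dr u (t, ρ) + ((p - 1 : ℝ) : ℂ) * u (t, ρ) := by
  have hq' : (q : ℂ) ≠ 0 := by exact_mod_cast hq
  by_cases hlt : ρ < π / 4
  · simp [lower, hlt]
  · have : ρ ∈ Ioo (0 : ℝ) (π / 2) := ⟨by have := Real.pi_pos; linarith, h1⟩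
    simp only [lower, hlt, if_false]
    rw [h.tangentialPart_eq this, inv_mul_cancel_left₀ hq']

theorem lower_eq_of_pos {p q Δ : ℝ} (hq : q ≠ 0) {u : ℝ × ℝ → ℂ} (h : RadialWave p q Δ u)
    {t ρ : ℝ} (h0 : 0 < ρ) :
    lower p q Δ u (t, ρ)
      = (q : ℂ)⁻¹ * tangentialPart p Δ u (t, ρ) + ((p - 1 : ℝ) : ℂ) * u (t, ρ) := by
  have hq' : (q : ℂ) ≠ 0 := by exact_mod_cast hq
  by_cases hlt : ρ < π / 4
  · have : ρ ∈ Ioo (0 : ℝ) (π / 2) := ⟨h0, by have := Real.pi_pos; linarith⟩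
    simp only [lower, hlt, if_true]
    rw [h.tangentialPart_eq this, inv_mul_cancel_left₀ hq']
  · simp [lower, hlt]

theorem contDiffAt_ofReal_tan {x : ℝ × ℝ} (hx : Real.cos x.2 ≠ 0) :
    ContDiffAt ℝ ∞ (fun y : ℝ × ℝ => (Real.tan y.2 : ℂ)) x :=
  Complex.ofRealCLM.contDiff.contDiffAt.comp x
    (ContDiffAt.comp x (Real.contDiffAt_tan.2 hx) contDiffAt_snd)

theorem contDiffAt_ofReal_cot (p : ℝ) {x : ℝ × ℝ} (hx : Real.sin x.2 ≠ 0) :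
    ContDiffAt ℝ ∞ (fun y : ℝ × ℝ => ((p * (Real.cos y.2 / Real.sin y.2) : ℝ) : ℂ)) x := by
  refine Complex.ofRealCLM.contDiff.contDiffAt.comp x (contDiffAt_const.mul (ContDiffAt.div ?_ ?_ hx))
  · exact Real.contDiff_cos.contDiffAt.comp x contDiffAt_snd
  · exact Real.contDiff_sin.contDiffAt.comp x contDiffAt_snd

theorem SmoothOnStrip.contDiffWithinAt_tangentialPart {u : ℝ × ℝ → ℂ} (hu : SmoothOnStrip u)
    (p Δ : ℝ) {x : ℝ × ℝ} (hx : x ∈ strip) (h0 : 0 < x.2) :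
    ContDiffWithinAt ℝ ∞ (tangentialPart p Δ u) strip x := by
  have hs : Real.sin x.2 ≠ 0 :=
    (Real.sin_pos_of_pos_of_lt_pi h0 (by have := hx.2.2; have := Real.pi_pos; linarith)).ne'
  have h1 := (hu.stripDeriv (0, 1)) x hx
  have h2 := ((hu.stripDeriv (0, 1)).stripDeriv (0, 1)) x hx
  have h3 := ((hu.stripDeriv (1, 0)).stripDeriv (1, 0)) x hx
  have h4 := hu x hx
  exact ((h2.add ((contDiffAt_ofReal_cot p hs).contDiffWithinAt.mul h1)).sub
    (contDiffWithinAt_const.mul h4)).sub h3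

theorem smoothOnStrip_lower {p q Δ : ℝ} (hq : q ≠ 0) {u : ℝ × ℝ → ℂ} (hu : SmoothOnStrip u)
    (h : RadialWave p q Δ u) : SmoothOnStrip (lower p q Δ u) := by
  intro x hx
  have hx2 : x.2 ∈ Icc 0 (π / 2) := hx.2
  rcases hx2.1.eq_or_lt with h0 | h0
  · have hlt : x.2 < π / 2 := by rw [← h0]; positivity
    have hc : Real.cos x.2 ≠ 0 := by rw [← h0]; simp
    have hev : ∀ᶠ y in 𝓝[strip] x, y.2 < π / 2 :=
      nhdsWithin_le_nhds (continuous_snd.continuousAt.eventually_lt continuousAt_const hlt)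
    refine ContDiffWithinAt.congr_of_eventuallyEq (f := fun y => (Real.tan y.2 : ℂ) * dr u y
      + ((p - 1 : ℝ) : ℂ) * u y) ?_ ?_ (lower_eq_of_lt hq h hlt)
    · exact ((contDiffAt_ofReal_tan hc).contDiffWithinAt.mul ((hu.stripDeriv (0, 1)) x hx)).add
        (contDiffWithinAt_const.mul (hu x hx))
    · filter_upwards [hev] with y hy1
      exact lower_eq_of_lt hq h hy1
  · have hev : ∀ᶠ y in 𝓝[strip] x, 0 < y.2 :=
      nhdsWithin_le_nhds (continuousAt_const.eventually_lt continuous_snd.continuousAt h0)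
    refine ContDiffWithinAt.congr_of_eventuallyEq (f := fun y => (q : ℂ)⁻¹ *
      tangentialPart p Δ u y + ((p - 1 : ℝ) : ℂ) * u y) ?_ ?_ (lower_eq_of_pos hq h h0)
    · exact (contDiffWithinAt_const.mul (hu.contDiffWithinAt_tangentialPart p Δ hx h0)).add
        (contDiffWithinAt_const.mul (hu x hx))
    · filter_upwards [hev] with y hy
      exact lower_eq_of_pos hq h hy

theorem hasDerivAt_ofReal_tan {ρ : ℝ} (hρ : ρ ∈ Ioo (0 : ℝ) (π / 2)) :
    HasDerivAt (fun r : ℝ => (Real.tan r : ℂ)) (1 + (Real.tan ρ : ℂ) ^ 2) ρ := by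
  have hc : Real.cos ρ ≠ 0 :=
    (Real.cos_pos_of_mem_Ioo ⟨by linarith [hρ.1, Real.pi_pos], hρ.2⟩).ne'
  have h := (Real.hasDerivAt_tan hc).ofReal_comp
  refine h.congr_deriv ?_
  have e : 1 / Real.cos ρ ^ 2 = 1 + Real.tan ρ ^ 2 := by
    have := Real.sin_sq_add_cos_sq ρ
    rw [Real.tan_eq_sin_div_cos]
    field_simp
    linarith
  rw [e]
  push_cast
  rfl

theorem tan_pos_of_mem_Ioo {ρ : ℝ} (hρ : ρ ∈ Ioo (0 : ℝ) (π / 2)) : 0 < Real.tan ρ :=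
  Real.tan_pos_of_pos_of_lt_pi_div_two hρ.1 hρ.2

theorem cos_div_sin_eq_inv_tan (ρ : ℝ) : Real.cos ρ / Real.sin ρ = (Real.tan ρ)⁻¹ := by
  rw [Real.tan_eq_sin_div_cos, inv_div]

theorem RadialWave.eq_inv_tan {p q Δ : ℝ} {u : ℝ × ℝ → ℂ} (h : RadialWave p q Δ u) {t ρ : ℝ}
    (hρ : ρ ∈ Ioo (0 : ℝ) (π / 2)) :
    dt (dt u) (t, ρ) = dr (dr u) (t, ρ)
      + (p * (Real.tan ρ : ℂ)⁻¹ - q * (Real.tan ρ : ℂ)) * dr u (t, ρ) - (Δ : ℂ) ^ 2 * u (t, ρ) := by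
  have := h t ρ hρ
  rw [cos_div_sin_eq_inv_tan] at this
  rw [this]
  push_cast
  ring

theorem RadialWave.dt_dt_dr {p q Δ : ℝ} {u : ℝ × ℝ → ℂ} (hu : SmoothOnStrip u)
    (h : RadialWave p q Δ u) {t ρ : ℝ} (hρ : ρ ∈ Ioo (0 : ℝ) (π / 2)) :
    dt (dt (dr u)) (t, ρ) = dr (dr (dr u)) (t, ρ)
      + (p * (Real.tan ρ : ℂ)⁻¹ - q * (Real.tan ρ : ℂ)) * dr (dr u) (t, ρ)
      - (p * ((Real.tan ρ : ℂ)⁻¹ ^ 2 + 1) + q * (1 + (Real.tan ρ : ℂ) ^ 2)) * dr u (t, ρ)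
      - (Δ : ℂ) ^ 2 * dr u (t, ρ) := by
  have hm : (t, ρ) ∈ strip := mem_strip.2 (Ioo_subset_Icc_self hρ)
  have hT : (Real.tan ρ : ℂ) ≠ 0 := by exact_mod_cast (tan_pos_of_mem_Ioo hρ).ne'
  have hu1 := hu.stripDeriv (1, 0)
  have hu2 := hu.stripDeriv (0, 1)
  -- Commuting derivatives reduces the claim to differentiating the wave equation once in `ρ`.
  have e1 : dt (dt (dr u)) (t, ρ) = dr (dt (dt u)) (t, ρ) := by
    exact (stripDeriv_congr (hu.stripDeriv_comm (1, 0) (0, 1)) (1, 0) hm).trans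
      (hu1.stripDeriv_comm (1, 0) (0, 1) hm)
  rw [e1]
  refine hasDerivAt_dr_unique (hu1.stripDeriv _) hρ ?_
  have ht := hasDerivAt_ofReal_tan hρ
  have hd : HasDerivAt (fun r => dr (dr u) (t, r)
      + (p * (Real.tan r : ℂ)⁻¹ - q * (Real.tan r : ℂ)) * dr u (t, r) - (Δ : ℂ) ^ 2 * u (t, r))
      (dr (dr (dr u)) (t, ρ)
        + ((p * (-(1 + (Real.tan ρ : ℂ) ^ 2) / (Real.tan ρ : ℂ) ^ 2)
          - q * (1 + (Real.tan ρ : ℂ) ^ 2)) * dr u (t, ρ)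
          + (p * (Real.tan ρ : ℂ)⁻¹ - q * (Real.tan ρ : ℂ)) * dr (dr u) (t, ρ))
        - (Δ : ℂ) ^ 2 * dr u (t, ρ)) ρ :=
    (((hu2.stripDeriv (0, 1)).hasDerivAt_radius hρ).add
      (((((ht.fun_inv hT).const_mul (p : ℂ)).sub (ht.const_mul (q : ℂ)))).mul
        (hu2.hasDerivAt_radius hρ))).sub ((hu.hasDerivAt_radius hρ).const_mul _)
  have hd' := hd.congr_of_eventuallyEq (f₁ := fun r => dt (dt u) (t, r)) (by
    filter_upwards [Ioo_mem_nhds hρ.1 hρ.2] with r hr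
    exact h.eq_inv_tan hr)
  refine hd'.congr_deriv ?_
  field_simp
  ring

/-- The dimension-lowering operator maps solutions to solutions. -/
theorem RadialWave.lower {p q Δ : ℝ} (hq : q ≠ 0) {u : ℝ × ℝ → ℂ} (hu : SmoothOnStrip u)
    (h : RadialWave p q Δ u) : RadialWave (p - 2) (q + 2) Δ (lower p q Δ u) := by
  have hv := smoothOnStrip_lower hq hu h
  set v := HKLL.lower p q Δ u with hvdef
  have hu1 := hu.stripDeriv (1, 0)
  have hu2 := hu.stripDeriv (0, 1)
  have hu22 := hu2.stripDeriv (0, 1)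
  have hu12 := hu2.stripDeriv (1, 0)
  have ev : ∀ t, ∀ r ∈ Ioo (0 : ℝ) (π / 2),
      v (t, r) = (Real.tan r : ℂ) * dr u (t, r) + ((p - 1 : ℝ) : ℂ) * u (t, r) :=
    fun t r hr => lower_eq_of_lt hq h hr.2
  have e1 : ∀ t, ∀ r ∈ Ioo (0 : ℝ) (π / 2), dr v (t, r)
      = (1 + (Real.tan r : ℂ) ^ 2) * dr u (t, r) + (Real.tan r : ℂ) * dr (dr u) (t, r)
        + ((p - 1 : ℝ) : ℂ) * dr u (t, r) := by
    intro t r hr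
    refine hasDerivAt_dr_unique hv hr ?_
    have hd := ((hasDerivAt_ofReal_tan hr).mul (hu2.hasDerivAt_radius (t := t) hr)).add
      ((hu.hasDerivAt_radius (t := t) hr).const_mul ((p - 1 : ℝ) : ℂ))
    exact hd.congr_of_eventuallyEq (by
      filter_upwards [Ioo_mem_nhds hr.1 hr.2] with y hy
      exact ev t y hy)
  intro t ρ hρ
  have hρ' := Ioo_subset_Icc_self hρ
  have hT : (Real.tan ρ : ℂ) ≠ 0 := by exact_mod_cast (tan_pos_of_mem_Ioo hρ).ne'
  have e2 : dr (dr v) (t, ρ)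
      = 2 * (Real.tan ρ : ℂ) * (1 + (Real.tan ρ : ℂ) ^ 2) * dr u (t, ρ)
        + 2 * (1 + (Real.tan ρ : ℂ) ^ 2) * dr (dr u) (t, ρ)
        + (Real.tan ρ : ℂ) * dr (dr (dr u)) (t, ρ) + ((p - 1 : ℝ) : ℂ) * dr (dr u) (t, ρ) := by
    refine hasDerivAt_dr_unique (hv.stripDeriv _) hρ ?_
    have ht := hasDerivAt_ofReal_tan hρ
    have hd := ((((ht.pow 2).const_add (1 : ℂ)).mul (hu2.hasDerivAt_radius (t := t) hρ)).add
      (ht.mul (hu22.hasDerivAt_radius (t := t) hρ))).add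
      ((hu2.hasDerivAt_radius (t := t) hρ).const_mul ((p - 1 : ℝ) : ℂ))
    have hd' := hd.congr_of_eventuallyEq (f₁ := fun r => dr v (t, r)) (by
      filter_upwards [Ioo_mem_nhds hρ.1 hρ.2] with y hy
      exact e1 t y hy)
    refine hd'.congr_deriv ?_
    simp only [Pi.pow_apply]
    push_cast
    ring
  have e3 : ∀ τ, dt v (τ, ρ) = (Real.tan ρ : ℂ) * dt (dr u) (τ, ρ)
      + ((p - 1 : ℝ) : ℂ) * dt u (τ, ρ) := by
    intro τ
    refine hasDerivAt_dt_unique hv hρ' ?_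
    have hd := ((hu2.hasDerivAt_time (t := τ) hρ').const_mul (Real.tan ρ : ℂ)).add
      ((hu.hasDerivAt_time (t := τ) hρ').const_mul ((p - 1 : ℝ) : ℂ))
    exact hd.congr_of_eventuallyEq (Eventually.of_forall fun y => ev y ρ hρ)
  have e4 : dt (dt v) (t, ρ) = (Real.tan ρ : ℂ) * dt (dt (dr u)) (t, ρ)
      + ((p - 1 : ℝ) : ℂ) * dt (dt u) (t, ρ) := by
    refine hasDerivAt_dt_unique (hv.stripDeriv _) hρ' ?_
    have hd := ((hu12.hasDerivAt_time (t := t) hρ').const_mul (Real.tan ρ : ℂ)).add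
      ((hu1.hasDerivAt_time (t := t) hρ').const_mul ((p - 1 : ℝ) : ℂ))
    exact hd.congr_of_eventuallyEq (Eventually.of_forall fun y => e3 y)
  -- What remains is an identity, rational in `tan ρ` and linear in `u` and its radial derivatives
  -- up to order three. The third derivatives cancel, and the lower ones match exactly for `p - 2`
  -- and `q + 2`.
  rw [e4, e2, e1 t ρ hρ, ev t ρ hρ, h.dt_dt_dr hu hρ, h.eq_inv_tan hρ, cos_div_sin_eq_inv_tan]
  simp only [Complex.ofReal_sub, Complex.ofReal_mul, Complex.ofReal_inv, Complex.ofReal_add,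
    Complex.ofReal_one, Complex.ofReal_ofNat]
  field_simp
  ring

theorem lower_apply_zero {p q Δ : ℝ} {u : ℝ × ℝ → ℂ} (t : ℝ) :
    lower p q Δ u (t, 0) = ((p - 1 : ℝ) : ℂ) * u (t, 0) := by
  have : (0 : ℝ) < π / 4 := by positivity
  simp [lower, this]

/-- In the interior `∂_ρ u = cot ρ · W / q`, where `W` is the tangential part, which is smooth at `ρ
= π/2`. Since `cot` vanishes at `π/2` with slope `-1`, differentiating there gives `∂_ρ² u = -W /
q`. -/
theorem RadialWave.boundary {p q Δ : ℝ} (hq : q ≠ 0) {u : ℝ × ℝ → ℂ}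
    (hu : SmoothOnStrip u) (h : RadialWave p q Δ u) (t : ℝ) :
    tangentialPart p Δ u (t, π / 2) = -(q * dr (dr u) (t, π / 2)) := by
  have hq' : (q : ℂ) ≠ 0 := by exact_mod_cast hq
  have hpi := Real.pi_pos
  have hmem : π / 2 ∈ Icc 0 (π / 2) := ⟨by positivity, le_rfl⟩
  set g : ℝ → ℂ := fun r => ((Real.cos r / Real.sin r : ℝ) : ℂ) *
    ((q : ℂ)⁻¹ * tangentialPart p Δ u (t, r)) with hg
  have hline : ContDiff ℝ ∞ (fun r : ℝ => (t, r)) := contDiff_const.prodMk contDiff_id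
  have hW : ContDiffWithinAt ℝ ∞ (fun r => tangentialPart p Δ u (t, r)) (Icc 0 (π / 2)) (π / 2) :=
    (hu.contDiffWithinAt_tangentialPart p Δ (x := (t, π / 2)) (mem_strip.2 hmem)
      (by simpa using hpi)).comp (π / 2) hline.contDiffAt.contDiffWithinAt
      (fun r hr => mem_strip.2 hr)
  have hWd := (hW.differentiableWithinAt (by simp)).hasDerivWithinAt
  have hcot : HasDerivAt (fun r => Real.cos r / Real.sin r) (-1) (π / 2) := by
    have := (Real.hasDerivAt_cos (π / 2)).fun_div (Real.hasDerivAt_sin (π / 2)) (by simp)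
    exact this.congr_deriv (by simp)
  have hgd := hcot.ofReal_comp.hasDerivWithinAt.mul (hWd.const_mul (q : ℂ)⁻¹)
  have hgeq : ∀ r ∈ Ioo (0 : ℝ) (π / 2), dr u (t, r) = g r := by
    intro r hr
    have hs : (Real.sin r : ℂ) ≠ 0 := by
      exact_mod_cast (Real.sin_pos_of_pos_of_lt_pi hr.1 (by linarith [hr.2])).ne'
    have hc : (Real.cos r : ℂ) ≠ 0 := by
      exact_mod_cast (Real.cos_pos_of_mem_Ioo ⟨by linarith [hr.1], hr.2⟩).ne'
    rw [hg]
    simp only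
    rw [h.tangentialPart_eq hr, Real.tan_eq_sin_div_cos, Complex.ofReal_div, Complex.ofReal_div]
    field_simp
  have hdu : HasDerivWithinAt (fun r => dr u (t, r)) (dr (dr u) (t, π / 2)) (Icc 0 (π / 2)) (π / 2) :=
    (hu.stripDeriv (0, 1)).hasDerivWithinAt_radius hmem
  have hend : dr u (t, π / 2) = g (π / 2) := by
    have c1 : Tendsto (fun r => dr u (t, r)) (𝓝[Ioo 0 (π / 2)] (π / 2)) (𝓝 (dr u (t, π / 2))) :=
      hdu.continuousWithinAt.mono Ioo_subset_Icc_self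
    have c2 : Tendsto g (𝓝[Ioo 0 (π / 2)] (π / 2)) (𝓝 (g (π / 2))) :=
      ContinuousWithinAt.mono hgd.continuousWithinAt Ioo_subset_Icc_self
    have : (𝓝[Ioo 0 (π / 2)] (π / 2)).NeBot := by
      rw [nhdsWithin_Ioo_eq_nhdsLT (by positivity)]; infer_instance
    refine tendsto_nhds_unique c1 (c2.congr' ?_)
    filter_upwards [self_mem_nhdsWithin] with r hr
    exact (hgeq r hr).symm
  have hgd' := hgd.congr_of_eventuallyEq (f₁ := fun r => dr u (t, r)) (by
    have : Ioc 0 (π / 2) ∈ 𝓝[Icc 0 (π / 2)] (π / 2) := by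
      have h1 : Ioi (0 : ℝ) ∈ 𝓝[Icc 0 (π / 2)] (π / 2) :=
        nhdsWithin_le_nhds (Ioi_mem_nhds (by positivity))
      filter_upwards [h1, self_mem_nhdsWithin] with r hr1 hr2
      exact ⟨hr1, hr2.2⟩
    filter_upwards [this] with r hr
    rcases hr.2.eq_or_lt with h' | h'
    · rw [h']; exact hend
    · exact hgeq r ⟨hr.1, h'⟩) hend
  have huniq := (uniqueDiffOn_Icc (by positivity : (0 : ℝ) < π / 2) (π / 2) hmem).eq_deriv _ hdu hgd'
  rw [huniq]
  simp only [Real.cos_pi_div_two, Real.sin_pi_div_two]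
  push_cast
  field_simp
  simp

/-- The boundary value of the lowered field. -/
theorem lower_apply_boundary {p q Δ : ℝ} (hq : 0 < q) {u : ℝ × ℝ → ℂ}
    (hu : SmoothOnStrip u) (h : RadialWave p q Δ u) (t : ℝ) :
    lower p q Δ u (t, π / 2) = -((1 + q : ℝ) : ℂ)⁻¹ * (dt (dt u) (t, π / 2)
      + ((Δ ^ 2 - (p - 1) * (q + 1) : ℝ) : ℂ) * u (t, π / 2)) := by
  have hq' : (q : ℂ) ≠ 0 := by exact_mod_cast hq.ne'
  have hq1 : (1 + q : ℂ) ≠ 0 := by exact_mod_cast (by linarith : 1 + q ≠ 0)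
  rw [lower_eq_of_pos hq.ne' h (by positivity)]
  -- There are two expressions for `W` at `π/2`: `-q ∂_ρ² u`, and `∂_ρ² u - Δ² u - ∂_t² u` because
  -- `cot` vanishes. Eliminating `∂_ρ² u` leaves time derivatives only.
  have h1 := h.boundary hq.ne' hu t
  have h2 : tangentialPart p Δ u (t, π / 2)
      = dr (dr u) (t, π / 2) - (Δ : ℂ) ^ 2 * u (t, π / 2) - dt (dt u) (t, π / 2) := by
    simp [tangentialPart]
  rw [h1]
  rw [h1] at h2
  push_cast
  field_simp
  linear_combination h2

/-! ### Differentiation under the integral sign on convex sets -/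

theorem integrableOn_of_continuousOn {X F : Type*} [TopologicalSpace X] [T2Space X]
    [MeasurableSpace X] [OpensMeasurableSpace X] [NormedAddCommGroup F]
    [SecondCountableTopology X] {μ : Measure X} [IsFiniteMeasureOnCompacts μ]
    {K : Set X} (hK : IsCompact K) {f : X → F} (hf : ContinuousOn f K) : IntegrableOn f K μ :=
  hf.integrableOn_compact' hK hK.measurableSet

/-- Differentiation under the integral sign over a compact set, within a convex set. -/
theorem hasFDerivWithinAt_setIntegral {E F X : Type*} [NormedAddCommGroup E] [NormedSpace ℝ E]
    [NormedAddCommGroup F] [NormedSpace ℝ F] [CompleteSpace F] [TopologicalSpace X] [T2Space X]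
    [SecondCountableTopology X] [MeasurableSpace X] [OpensMeasurableSpace X]
    {μ : Measure X} [IsFiniteMeasureOnCompacts μ] {A : Set E} (hA : Convex ℝ A)
    {K : Set X} (hK : IsCompact K) {G : E → X → F} {G' : E → X → E →L[ℝ] F}
    (hG : ∀ p ∈ A, ContinuousOn (G p) K)
    (hG' : ContinuousOn (Function.uncurry G') (A ×ˢ K))
    (h : ∀ p ∈ A, ∀ x ∈ K, HasFDerivWithinAt (fun q => G q x) (G' p x) A p) {p : E} (hp : p ∈ A) :
    HasFDerivWithinAt (fun q => ∫ x in K, G q x ∂μ) (∫ x in K, G' p x ∂μ) A p := by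
  have hKm := hK.measurableSet
  have hint : ∀ q ∈ A, IntegrableOn (G q) K μ := fun q hq =>
    integrableOn_of_continuousOn hK (hG q hq)
  have hG'p : ∀ q ∈ A, ContinuousOn (G' q) K := fun q hq =>
    hG'.comp (f := fun x => (q, x)) (by fun_prop) fun x hx => ⟨hq, hx⟩
  have hint' : IntegrableOn (G' p) K μ := integrableOn_of_continuousOn hK (hG'p p hp)
  rw [hasFDerivWithinAt_iff_isLittleO, Asymptotics.isLittleO_iff]
  intro ε hε
  set m := μ.real K with hm
  have hm0 : 0 ≤ m := measureReal_nonneg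
  -- Compactness of `K` makes `G'` close to `G' p` uniformly on `K`. The mean value inequality then
  -- bounds the Taylor error pointwise; `m + 1` avoids division by zero when `K` is null.
  obtain ⟨v, hv, hvK⟩ := hK.mem_uniformity_of_prod hG' hp
    (Metric.dist_mem_uniformity (ε := ε / (m + 1)) (by positivity))
  obtain ⟨r, hr, hrv⟩ := Metric.mem_nhdsWithin_iff.1 hv
  have hball : Metric.ball p r ∩ A ∈ 𝓝[A] p :=
    inter_mem (nhdsWithin_le_nhds (Metric.ball_mem_nhds p hr)) self_mem_nhdsWithin
  filter_upwards [hball] with q hq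
  have hpt : ∀ x ∈ K, ‖G q x - G p x - G' p x (q - p)‖ ≤ ε / (m + 1) * ‖q - p‖ := by
    intro x hx
    refine Convex.norm_image_sub_le_of_norm_hasFDerivWithin_le' (𝕜 := ℝ)
      (s := Metric.ball p r ∩ A)
      (f := fun q => G q x) (f' := fun q => G' q x)
      (fun y hy => (h y hy.2 x hx).mono inter_subset_right) (fun y hy => ?_)
      ((convex_ball p r).inter hA) ⟨Metric.mem_ball_self hr, hp⟩ hq
    have := hvK y (hrv hy) x hx
    rw [← dist_eq_norm]
    exact le_of_lt this
  have heq : (∫ x in K, G q x ∂μ) - (∫ x in K, G p x ∂μ) - (∫ x in K, G' p x ∂μ) (q - p)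
      = ∫ x in K, (G q x - G p x - G' p x (q - p)) ∂μ := by
    have e1 := integral_sub (f := fun x => G q x - G p x) (g := fun x => G' p x (q - p))
      ((hint q hq.2).sub (hint p hp)) (hint'.apply_continuousLinearMap _)
    rw [e1, integral_sub (hint q hq.2) (hint p hp), ContinuousLinearMap.integral_apply hint']
  rw [heq]
  refine (norm_setIntegral_le_of_norm_le_const (hK.measure_lt_top) hpt).trans ?_
  rw [← hm]
  have : ε / (m + 1) * m ≤ ε := by
    rw [div_mul_eq_mul_div, div_le_iff₀ (by positivity)]
    nlinarith
  calc ε / (m + 1) * ‖q - p‖ * m = ε / (m + 1) * m * ‖q - p‖ := by ring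
    _ ≤ ε * ‖q - p‖ := by gcongr

/-! ### Partial derivatives on open sets of the plane -/

/-- The partial derivative in the first variable. -/
noncomputable def pt (f : ℝ × ℝ → ℂ) (x : ℝ × ℝ) : ℂ := deriv (fun τ => f (τ, x.2)) x.1

/-- The partial derivative in the second variable. -/
noncomputable def pr (f : ℝ × ℝ → ℂ) (x : ℝ × ℝ) : ℂ := deriv (fun r => f (x.1, r)) x.2

section OpenSet

variable {O : Set (ℝ × ℝ)} {f g : ℝ × ℝ → ℂ}

theorem hasFDerivAt_of_contDiffOn (hO : IsOpen O) (hf : ContDiffOn ℝ ∞ f O) {x : ℝ × ℝ}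
    (hx : x ∈ O) : HasFDerivAt f (fderiv ℝ f x) x :=
  ((hf.contDiffAt (hO.mem_nhds hx)).differentiableAt (by simp)).hasFDerivAt

theorem hasDerivAt_comp_curve (hO : IsOpen O) (hf : ContDiffOn ℝ ∞ f O) {γ : ℝ → ℝ × ℝ}
    {γ' : ℝ × ℝ} {s : ℝ} (hγ : HasDerivAt γ γ' s) (hs : γ s ∈ O) :
    HasDerivAt (fun τ => f (γ τ)) (fderiv ℝ f (γ s) γ') s :=
  (hasFDerivAt_of_contDiffOn hO hf hs).comp_hasDerivAt s hγ

theorem hasDerivAt_pt (hO : IsOpen O) (hf : ContDiffOn ℝ ∞ f O) {x : ℝ × ℝ} (hx : x ∈ O) :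
    HasDerivAt (fun τ => f (τ, x.2)) (pt f x) x.1 := by
  have h := hasDerivAt_comp_curve hO hf (γ := fun τ => (τ, x.2)) (s := x.1)
    ((hasDerivAt_id x.1).prodMk (hasDerivAt_const x.1 x.2)) hx
  exact h.differentiableAt.hasDerivAt

theorem hasDerivAt_pr (hO : IsOpen O) (hf : ContDiffOn ℝ ∞ f O) {x : ℝ × ℝ} (hx : x ∈ O) :
    HasDerivAt (fun r => f (x.1, r)) (pr f x) x.2 := by
  have h := hasDerivAt_comp_curve hO hf (γ := fun r => (x.1, r)) (s := x.2)
    ((hasDerivAt_const x.2 x.1).prodMk (hasDerivAt_id x.2)) hx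
  exact h.differentiableAt.hasDerivAt

theorem pt_eq_fderiv (hO : IsOpen O) (hf : ContDiffOn ℝ ∞ f O) {x : ℝ × ℝ} (hx : x ∈ O) :
    pt f x = fderiv ℝ f x (1, 0) :=
  (hasDerivAt_comp_curve hO hf (γ := fun τ => (τ, x.2)) (s := x.1)
    ((hasDerivAt_id x.1).prodMk (hasDerivAt_const x.1 x.2)) hx).deriv

theorem pr_eq_fderiv (hO : IsOpen O) (hf : ContDiffOn ℝ ∞ f O) {x : ℝ × ℝ} (hx : x ∈ O) :
    pr f x = fderiv ℝ f x (0, 1) :=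
  (hasDerivAt_comp_curve hO hf (γ := fun r => (x.1, r)) (s := x.2)
    ((hasDerivAt_const x.2 x.1).prodMk (hasDerivAt_id x.2)) hx).deriv

theorem fderiv_apply_eq (hO : IsOpen O) (hf : ContDiffOn ℝ ∞ f O) {x : ℝ × ℝ} (hx : x ∈ O)
    (a b : ℝ) : fderiv ℝ f x (a, b) = a * pt f x + b * pr f x := by
  rw [pt_eq_fderiv hO hf hx, pr_eq_fderiv hO hf hx]
  have : ((a, b) : ℝ × ℝ) = a • ((1, 0) : ℝ × ℝ) + b • ((0, 1) : ℝ × ℝ) := by simp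
  rw [this, map_add, map_smul, map_smul]
  simp

theorem contDiffOn_pt (hO : IsOpen O) (hf : ContDiffOn ℝ ∞ f O) : ContDiffOn ℝ ∞ (pt f) O :=
  ((hf.fderiv_of_isOpen hO (m := ∞) (by simp)).clm_apply contDiffOn_const).congr
    fun _ hx => pt_eq_fderiv hO hf hx

theorem contDiffOn_pr (hO : IsOpen O) (hf : ContDiffOn ℝ ∞ f O) : ContDiffOn ℝ ∞ (pr f) O :=
  ((hf.fderiv_of_isOpen hO (m := ∞) (by simp)).clm_apply contDiffOn_const).congr
    fun _ hx => pr_eq_fderiv hO hf hx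

theorem pr_wronskian (hO : IsOpen O) (hf : ContDiffOn ℝ ∞ f O) (hg : ContDiffOn ℝ ∞ g O)
    {x : ℝ × ℝ} (hx : x ∈ O) :
    pr (fun y => g y * pr f y - f y * pr g y) x = g x * pr (pr f) x - f x * pr (pr g) x := by
  have h := ((hasDerivAt_pr hO hg hx).mul (hasDerivAt_pr hO (contDiffOn_pr hO hf) hx)).sub
    ((hasDerivAt_pr hO hf hx).mul (hasDerivAt_pr hO (contDiffOn_pr hO hg) hx))
  refine (HasDerivAt.deriv h).trans ?_
  ring

theorem pt_wronskian (hO : IsOpen O) (hf : ContDiffOn ℝ ∞ f O) (hg : ContDiffOn ℝ ∞ g O)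
    {x : ℝ × ℝ} (hx : x ∈ O) :
    pt (fun y => g y * pt f y - f y * pt g y) x = g x * pt (pt f) x - f x * pt (pt g) x := by
  have h := ((hasDerivAt_pt hO hg hx).mul (hasDerivAt_pt hO (contDiffOn_pt hO hf) hx)).sub
    ((hasDerivAt_pt hO hf hx).mul (hasDerivAt_pt hO (contDiffOn_pt hO hg) hx))
  refine (HasDerivAt.deriv h).trans ?_
  ring

/-- The derivative of the integral over the sections of a wedge of a conserved density. -/
theorem hasDerivAt_wedge_integral (hO : IsOpen O) (hf : ContDiffOn ℝ ∞ f O)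
    (hg : ContDiffOn ℝ ∞ g O) (hfg : ∀ x ∈ O, pr f x = pt g x) {b : ℝ}
    (hseg : ∀ ρ ∈ Ioo 0 b, ∀ s ∈ Icc (-1 : ℝ) 1, (s * ρ, ρ) ∈ O) {ρ : ℝ} (hρ : ρ ∈ Ioo 0 b) :
    HasDerivAt (fun r : ℝ => ∫ s in (-1 : ℝ)..1, (r : ℂ) * f (s * r, r))
      (f (ρ, ρ) + f (-ρ, ρ) + g (ρ, ρ) - g (-ρ, ρ)) ρ := by
  have hle : (-1 : ℝ) ≤ 1 := by norm_num
  have hmap : ContinuousOn (fun y : ℝ × ℝ => (y.2 * y.1, y.1)) (Ioo 0 b ×ˢ Icc (-1 : ℝ) 1) := by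
    fun_prop
  have hmaps : MapsTo (fun y : ℝ × ℝ => (y.2 * y.1, y.1)) (Ioo 0 b ×ˢ Icc (-1 : ℝ) 1) O :=
    fun y hy => hseg y.1 hy.1 y.2 hy.2
  have hder : ∀ r ∈ Ioo 0 b, ∀ s ∈ Icc (-1 : ℝ) 1,
      HasDerivAt (fun r : ℝ => (r : ℂ) * f (s * r, r))
        (f (s * r, r) + r * (s * pt f (s * r, r) + pr f (s * r, r))) r := by
    intro r hr s hs
    have h1 := hasDerivAt_comp_curve hO hf (γ := fun r => (s * r, r)) (γ' := (s, 1)) (s := r)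
      (by simpa using ((hasDerivAt_id r).const_mul s).prodMk (hasDerivAt_id r)) (hseg r hr s hs)
    rw [fderiv_apply_eq hO hf (hseg r hr s hs)] at h1
    refine ((hasDerivAt_id r).ofReal_comp.mul h1).congr_deriv ?_
    simp
  have hcont : ContinuousOn (fun y : ℝ × ℝ => f (y.2 * y.1, y.1) + y.1 *
      (y.2 * pt f (y.2 * y.1, y.1) + pr f (y.2 * y.1, y.1))) (Ioo 0 b ×ˢ Icc (-1 : ℝ) 1) := by
    have c1 := hf.continuousOn.comp hmap hmaps
    have c2 := (contDiffOn_pt hO hf).continuousOn.comp hmap hmaps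
    have c3 := (contDiffOn_pr hO hf).continuousOn.comp hmap hmaps
    have c4 : ContinuousOn (fun y : ℝ × ℝ => (y.1 : ℂ)) (Ioo 0 b ×ˢ Icc (-1 : ℝ) 1) := by fun_prop
    have c5 : ContinuousOn (fun y : ℝ × ℝ => (y.2 : ℂ)) (Ioo 0 b ×ˢ Icc (-1 : ℝ) 1) := by fun_prop
    exact c1.add (c4.mul ((c5.mul c2).add c3))
  have hsec : ∀ r ∈ Ioo 0 b, ContinuousOn (fun s : ℝ => (s * r, r)) (Icc (-1 : ℝ) 1) ∧
      MapsTo (fun s : ℝ => (s * r, r)) (Icc (-1 : ℝ) 1) O := fun r hr =>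
    ⟨by fun_prop, fun s hs => hseg r hr s hs⟩
  have hint := hasFDerivWithinAt_setIntegral (μ := (volume : Measure ℝ)) (convex_Ioo 0 b)
    (isCompact_Icc (a := (-1 : ℝ)) (b := 1))
    (G := fun r s => (r : ℂ) * f (s * r, r))
    (G' := fun r s => ContinuousLinearMap.toSpanSingleton ℝ
      (f (s * r, r) + r * (s * pt f (s * r, r) + pr f (s * r, r))))
    (fun r hr => continuousOn_const.mul (hf.continuousOn.comp (hsec r hr).1 (hsec r hr).2))
    (by
      have := (ContinuousLinearMap.toSpanSingletonCLE (𝕜 := ℝ) (E := ℂ)).continuous.comp_continuousOn hcont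
      exact this)
    (fun r hr s hs => (hder r hr s hs).hasFDerivAt.hasFDerivWithinAt) hρ
  have h2 := (hint.hasFDerivAt (Ioo_mem_nhds hρ.1 hρ.2)).hasDerivAt
  have hci : IntegrableOn (fun s : ℝ => ContinuousLinearMap.toSpanSingleton ℝ
      (f (s * ρ, ρ) + ρ * (s * pt f (s * ρ, ρ) + pr f (s * ρ, ρ)))) (Icc (-1 : ℝ) 1) volume := by
    refine integrableOn_of_continuousOn isCompact_Icc ?_
    have := (ContinuousLinearMap.toSpanSingletonCLE (𝕜 := ℝ) (E := ℂ)).continuous.comp_continuousOn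
      (hcont.comp (f := fun s : ℝ => (ρ, s)) (s := Icc (-1 : ℝ) 1) (by fun_prop)
        fun s hs => ⟨hρ, hs⟩)
    exact this
  rw [ContinuousLinearMap.integral_apply hci] at h2
  have hfun : (fun r : ℝ => ∫ s in (-1 : ℝ)..1, (r : ℂ) * f (s * r, r))
      = fun r : ℝ => ∫ s in Icc (-1 : ℝ) 1, (r : ℂ) * f (s * r, r) := by
    funext r
    rw [intervalIntegral.integral_of_le hle, integral_Icc_eq_integral_Ioc]
  rw [hfun]
  refine h2.congr_deriv ?_
  -- By the conservation law `f_ρ = g_t`, the `r`-derivative of `r f(s r, r)` is also the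
  -- `s`-derivative of `s f + g`, so it integrates to end point values.
  have hftc : ∀ s ∈ uIcc (-1 : ℝ) 1, HasDerivAt (fun s : ℝ => (s : ℂ) * f (s * ρ, ρ) + g (s * ρ, ρ))
      (f (s * ρ, ρ) + ρ * (s * pt f (s * ρ, ρ) + pr f (s * ρ, ρ))) s := by
    intro s hs
    rw [uIcc_of_le hle] at hs
    have hm := hseg ρ hρ s hs
    have hγ : HasDerivAt (fun s : ℝ => (s * ρ, ρ)) (ρ, 0) s := by
      simpa using ((hasDerivAt_id s).mul_const ρ).prodMk (hasDerivAt_const s ρ)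
    have h1 := hasDerivAt_comp_curve hO hf hγ hm
    have h2 := hasDerivAt_comp_curve hO hg hγ hm
    rw [fderiv_apply_eq hO hf hm] at h1
    rw [fderiv_apply_eq hO hg hm] at h2
    refine (((hasDerivAt_id s).ofReal_comp.mul h1).add h2).congr_deriv ?_
    rw [hfg _ hm]
    simp
    ring
  have hii : IntervalIntegrable (fun s : ℝ => f (s * ρ, ρ) + ρ * (s * pt f (s * ρ, ρ)
      + pr f (s * ρ, ρ))) volume (-1) 1 := by
    refine ContinuousOn.intervalIntegrable ?_
    rw [uIcc_of_le hle]
    exact hcont.comp (f := fun s : ℝ => (ρ, s)) (by fun_prop) fun s hs => ⟨hρ, hs⟩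
  have := intervalIntegral.integral_eq_sub_of_hasDerivAt hftc hii
  rw [intervalIntegral.integral_of_le hle, ← integral_Icc_eq_integral_Ioc] at this
  simp only [ContinuousLinearMap.toSpanSingleton_apply, one_smul]
  rw [this]
  push_cast
  simp only [one_mul, neg_mul]
  ring

/-- Green's identity in the wedge `|t| < ρ` with a Riemann function `w`. -/
theorem hasDerivAt_wedge_green (hO : IsOpen O) {w : ℝ × ℝ → ℂ} (hf : ContDiffOn ℝ ∞ f O)
    (hw : ContDiffOn ℝ ∞ w O) (m : ℝ × ℝ → ℂ)
    (hfe : ∀ x ∈ O, pt (pt f) x = pr (pr f) x - m x * f x)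
    (hwe : ∀ x ∈ O, pt (pt w) x = pr (pr w) x - m x * w x) {b : ℝ}
    (hseg : ∀ ρ ∈ Ioo 0 b, ∀ s ∈ Icc (-1 : ℝ) 1, (s * ρ, ρ) ∈ O)
    (hw1 : ∀ ρ ∈ Ioo 0 b, w (ρ, ρ) = 1) (hw2 : ∀ ρ ∈ Ioo 0 b, w (-ρ, ρ) = 1)
    {ρ : ℝ} (hρ : ρ ∈ Ioo 0 b) :
    HasDerivAt (fun r : ℝ => (∫ s in (-1 : ℝ)..1, (r : ℂ) *
      (w (s * r, r) * pr f (s * r, r) - f (s * r, r) * pr w (s * r, r)))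
        - f (r, r) - f (-r, r)) 0 ρ := by
  have m1 : (ρ, ρ) ∈ O := by simpa using hseg ρ hρ 1 (by norm_num)
  have m2 : (-ρ, ρ) ∈ O := by simpa using hseg ρ hρ (-1) (by norm_num)
  have h := hasDerivAt_wedge_integral hO (f := fun y => w y * pr f y - f y * pr w y)
    (g := fun y => w y * pt f y - f y * pt w y)
    ((hw.mul (contDiffOn_pr hO hf)).sub (hf.mul (contDiffOn_pr hO hw)))
    ((hw.mul (contDiffOn_pt hO hf)).sub (hf.mul (contDiffOn_pt hO hw)))
    (fun x hx => by
      rw [pr_wronskian hO hf hw hx, pt_wronskian hO hf hw hx, hfe x hx, hwe x hx]; ring) hseg hρ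
  have hγ1 : HasDerivAt (fun r : ℝ => (r, r)) (1, 1) ρ := (hasDerivAt_id ρ).prodMk (hasDerivAt_id ρ)
  have hγ2 : HasDerivAt (fun r : ℝ => (-r, r)) (-1, 1) ρ :=
    (hasDerivAt_id ρ).neg.prodMk (hasDerivAt_id ρ)
  have f1 := hasDerivAt_comp_curve hO hf hγ1 m1
  have f2 := hasDerivAt_comp_curve hO hf hγ2 m2
  have w1 := hasDerivAt_comp_curve hO hw hγ1 m1
  have w2 := hasDerivAt_comp_curve hO hw hγ2 m2
  have hev : ∀ᶠ r in 𝓝 ρ, r ∈ Ioo 0 b := Ioo_mem_nhds hρ.1 hρ.2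
  -- As `w = 1` along both light rays, its tangential derivative vanishes there. The end point terms
  -- thus reduce to the derivatives of `f` along the rays, which the two subtracted values cancel.
  have w1' := w1.unique ((hasDerivAt_const ρ (1 : ℂ)).congr_of_eventuallyEq
    (hev.mono fun r hr => hw1 r hr))
  have w2' := w2.unique ((hasDerivAt_const ρ (1 : ℂ)).congr_of_eventuallyEq
    (hev.mono fun r hr => hw2 r hr))
  rw [fderiv_apply_eq hO hf m1] at f1
  rw [fderiv_apply_eq hO hf m2] at f2
  rw [fderiv_apply_eq hO hw m1] at w1'
  rw [fderiv_apply_eq hO hw m2] at w2'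
  refine ((h.sub f1).sub f2).congr_deriv ?_
  simp only [hw1 ρ hρ, hw2 ρ hρ]
  push_cast at *
  linear_combination (-f (ρ, ρ)) * w1' - f (-ρ, ρ) * w2'

end OpenSet

/-! ### The Legendre function -/

theorem ConvOnDisc.contDiffOn {c : ℕ → ℝ} (hc : ConvOnDisc c) :
    ContDiffOn ℝ ∞ (powSum c) (Ioo (-1) 1) := by
  rw [contDiffOn_infty]
  intro n
  induction n generalizing c with
  | zero =>
    exact contDiffOn_zero.2 fun x hx =>
      (hc.hasDerivAt (abs_lt.2 hx)).continuousAt.continuousWithinAt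
  | succ n ih =>
    push_cast
    rw [contDiffOn_succ_iff_deriv_of_isOpen isOpen_Ioo]
    refine ⟨fun x hx => (hc.hasDerivAt (abs_lt.2 hx)).differentiableAt.differentiableWithinAt,
      by simp, (ih hc.derivCoeff).congr fun x hx => (hc.hasDerivAt (abs_lt.2 hx)).deriv⟩

/-- The coefficients of the Legendre function of degree `a`. -/
noncomputable def legCoeff (a : ℝ) : ℕ → ℝ := hypCoeff (-a / 2) ((1 - a) / 2) 1

/-- Here `C - A - B = a + 1/2 > 0`, so the series converges absolutely even at `z = 1`, the image of
`σ = ∞`, which is reached at the conformal boundary. -/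
theorem summable_abs_legCoeff {a : ℝ} (ha : 0 < a) : Summable fun k => |legCoeff a k| :=
  summable_abs_hypCoeff one_pos (by linarith)

theorem convOnDisc_legCoeff {a : ℝ} (ha : 0 < a) : ConvOnDisc (legCoeff a) :=
  convOnDisc_of_summable (summable_abs_legCoeff ha)

/-- The argument `1 - σ⁻²`. -/
noncomputable def legArg (σ : ℝ) : ℝ := 1 - (σ ^ 2)⁻¹

/-- The Legendre function of the first kind of degree `a`. -/
noncomputable def legP (a σ : ℝ) : ℝ := σ ^ a * powSum (legCoeff a) (legArg σ)

/-- The first derivative of the Legendre function. -/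
noncomputable def legP' (a σ : ℝ) : ℝ :=
  σ ^ a * (a / σ * powSum (legCoeff a) (legArg σ)
    + 2 / σ ^ 3 * powSum (derivCoeff (legCoeff a)) (legArg σ))

/-- The second derivative of the Legendre function. -/
noncomputable def legP'' (a σ : ℝ) : ℝ :=
  σ ^ a * (a * (a - 1) / σ ^ 2 * powSum (legCoeff a) (legArg σ)
    + (4 * a - 6) / σ ^ 4 * powSum (derivCoeff (legCoeff a)) (legArg σ)
    + 4 / σ ^ 6 * powSum (derivCoeff (derivCoeff (legCoeff a))) (legArg σ))

/-- The wedge needs only `σ ≥ 1`, that is `0 ≤ z < 1`. The weaker condition `1 < 2σ²` uses the whole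
unit disc of convergence and makes the Riemann function smooth across the light cone `σ = 1`. -/
theorem abs_legArg_lt {σ : ℝ} (h0 : 0 < σ) (h : 1 < 2 * σ ^ 2) : |legArg σ| < 1 := by
  have h1 : 0 < (σ ^ 2)⁻¹ := by positivity
  have h2 : (σ ^ 2)⁻¹ < 2 := by
    rw [inv_lt_comm₀ (by positivity) two_pos]
    linarith
  rw [legArg, abs_lt]
  constructor <;> linarith

theorem hasDerivAt_legArg {σ : ℝ} (h0 : 0 < σ) : HasDerivAt legArg (2 / σ ^ 3) σ := by
  have h := (((hasDerivAt_pow 2 σ)).fun_inv (by positivity)).const_sub 1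
  refine h.congr_deriv ?_
  field_simp
  norm_num
  ring

theorem hasDerivAt_rpow_div {a σ : ℝ} (h0 : 0 < σ) :
    HasDerivAt (fun s : ℝ => s ^ a) (σ ^ a * (a / σ)) σ := by
  refine (Real.hasDerivAt_rpow_const (Or.inl h0.ne')).congr_deriv ?_
  rw [Real.rpow_sub_one h0.ne']
  ring

theorem hasDerivAt_legP {a σ : ℝ} (ha : 0 < a) (h0 : 0 < σ) (h : 1 < 2 * σ ^ 2) :
    HasDerivAt (legP a) (legP' a σ) σ := by
  have hz := abs_legArg_lt h0 h
  have h1 := ((convOnDisc_legCoeff ha).hasDerivAt hz).comp σ (hasDerivAt_legArg h0)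
  refine ((hasDerivAt_rpow_div (a := a) h0).mul h1).congr_deriv ?_
  rw [legP']
  simp only [Function.comp]
  ring

theorem hasDerivAt_legP' {a σ : ℝ} (ha : 0 < a) (h0 : 0 < σ) (h : 1 < 2 * σ ^ 2) :
    HasDerivAt (legP' a) (legP'' a σ) σ := by
  have hz := abs_legArg_lt h0 h
  have h1 := ((convOnDisc_legCoeff ha).hasDerivAt hz).comp σ (hasDerivAt_legArg h0)
  have h2 := ((convOnDisc_legCoeff ha).derivCoeff.hasDerivAt hz).comp σ (hasDerivAt_legArg h0)
  have h3 : HasDerivAt (fun s : ℝ => a / s) (-a / σ ^ 2) σ := by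
    refine ((hasDerivAt_const σ a).fun_div (hasDerivAt_id σ) h0.ne').congr_deriv ?_
    simp
  have h4 : HasDerivAt (fun s : ℝ => 2 / s ^ 3) (-6 / σ ^ 4) σ := by
    refine ((hasDerivAt_const σ (2 : ℝ)).fun_div (hasDerivAt_pow 3 σ) (by positivity)).congr_deriv ?_
    field_simp
    norm_num
    ring
  refine ((hasDerivAt_rpow_div (a := a) h0).mul ((h3.mul h1).add (h4.mul h2))).congr_deriv ?_
  rw [legP'']
  simp only [Function.comp, Pi.add_apply, Pi.mul_apply]
  field_simp
  ring

/-- The Legendre differential equation. -/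
theorem legendre_ode {a σ : ℝ} (ha : 0 < a) (h0 : 0 < σ) (h : 1 < 2 * σ ^ 2) :
    (σ ^ 2 - 1) * legP'' a σ + 2 * σ * legP' a σ = a * (a + 1) * legP a σ := by
  have hz := abs_legArg_lt h0 h
  have hode := hypergeometric_ode one_pos (convOnDisc_legCoeff ha) hz
  rw [legP, legP', legP'']
  have hs : legArg σ = 1 - (σ ^ 2)⁻¹ := rfl
  change _ * powSum (derivCoeff (derivCoeff (legCoeff a))) _ + _ * powSum (derivCoeff (legCoeff a)) _
    - _ * powSum (legCoeff a) _ = 0 at hode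
  generalize powSum (derivCoeff (derivCoeff (legCoeff a))) (legArg σ) = q2 at *
  generalize powSum (derivCoeff (legCoeff a)) (legArg σ) = q1 at *
  generalize powSum (legCoeff a) (legArg σ) = q0 at *
  rw [hs] at hode
  have hσ := h0.ne'
  field_simp at hode
  field_simp
  linear_combination hode

theorem legP_one (a : ℝ) : legP a 1 = 1 := by
  have : powSum (legCoeff a) 0 = 1 := by
    rw [powSum, tsum_eq_single 0]
    · simp [legCoeff, hypCoeff]
    · intro k hk
      simp [hk]
  simp [legP, legArg, this]

theorem contDiffOn_legP {a : ℝ} (ha : 0 < a) :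
    ContDiffOn ℝ ∞ (legP a) {σ | 0 < σ ∧ 1 < 2 * σ ^ 2} := by
  refine ContDiffOn.mul ?_ ?_
  · exact fun σ hσ => (Real.contDiffAt_rpow_const_of_ne hσ.1.ne').contDiffWithinAt
  · refine (convOnDisc_legCoeff ha).contDiffOn.comp ?_ fun σ hσ => abs_lt.1 (abs_legArg_lt hσ.1 hσ.2)
    intro σ hσ
    have : σ ^ 2 ≠ 0 := by have := hσ.1; positivity
    exact (contDiffAt_const.sub ((contDiff_id.pow 2).contDiffAt.inv this)).contDiffWithinAt

/-! ### The wedge spacelike separated from the origin -/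

/-- An open neighbourhood of the part `0 < ρ < π/2` of the wedge `|t| ≤ ρ`. -/
def wedge : Set (ℝ × ℝ) :=
  {x | x.2 ∈ Ioo 0 (π / 2) ∧ 0 < Real.cos x.1 ∧ Real.cos x.2 ^ 2 < 2 * Real.cos x.1 ^ 2}

theorem isOpen_wedge : IsOpen wedge := by
  refine (isOpen_Ioo.preimage continuous_snd).inter (IsOpen.inter ?_ ?_)
  · exact isOpen_lt continuous_const (Real.continuous_cos.comp continuous_fst)
  · exact isOpen_lt ((Real.continuous_cos.comp continuous_snd).pow 2)
      (continuous_const.mul ((Real.continuous_cos.comp continuous_fst).pow 2))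

theorem wedge_subset_strip : wedge ⊆ interior strip := by
  rw [interior_strip]
  exact fun x hx => ⟨mem_univ _, hx.1⟩

theorem cos_pos_of_mem {ρ : ℝ} (hρ : ρ ∈ Ioo (0 : ℝ) (π / 2)) : 0 < Real.cos ρ :=
  Real.cos_pos_of_mem_Ioo ⟨by linarith [hρ.1, Real.pi_pos], hρ.2⟩

theorem cos_mul_ge {ρ s : ℝ} (hρ : ρ ∈ Ioo (0 : ℝ) (π / 2)) (hs : s ∈ Icc (-1 : ℝ) 1) :
    Real.cos ρ ≤ Real.cos (s * ρ) := by
  rw [← Real.cos_abs (s * ρ)]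
  refine Real.cos_le_cos_of_nonneg_of_le_pi (abs_nonneg _) (by linarith [hρ.2, Real.pi_pos]) ?_
  rw [abs_mul, abs_of_pos hρ.1]
  exact mul_le_of_le_one_left hρ.1.le (abs_le.2 hs)

theorem segment_mem_wedge {ρ s : ℝ} (hρ : ρ ∈ Ioo (0 : ℝ) (π / 2)) (hs : s ∈ Icc (-1 : ℝ) 1) :
    (s * ρ, ρ) ∈ wedge := by
  have h1 := cos_pos_of_mem hρ
  have h2 := cos_mul_ge hρ hs
  refine ⟨hρ, h1.trans_le h2, ?_⟩
  simp only
  nlinarith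

/-- The Riemann function. -/
noncomputable def riemannFun (a : ℝ) (x : ℝ × ℝ) : ℂ :=
  (legP a (Real.cos x.1 / Real.cos x.2) : ℂ)

theorem wedge_ratio {x : ℝ × ℝ} (hx : x ∈ wedge) :
    0 < Real.cos x.1 / Real.cos x.2 ∧ 1 < 2 * (Real.cos x.1 / Real.cos x.2) ^ 2 := by
  have h := cos_pos_of_mem hx.1
  refine ⟨div_pos hx.2.1 h, ?_⟩
  rw [div_pow, mul_div_assoc', lt_div_iff₀ (by positivity), one_mul]
  exact hx.2.2

theorem contDiffOn_riemannFun {a : ℝ} (ha : 0 < a) : ContDiffOn ℝ ∞ (riemannFun a) wedge := by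
  refine Complex.ofRealCLM.contDiff.comp_contDiffOn ((contDiffOn_legP ha).comp ?_
    fun x hx => wedge_ratio hx)
  exact (Real.contDiff_cos.comp contDiff_fst).contDiffOn.div
    (Real.contDiff_cos.comp contDiff_snd).contDiffOn fun x hx => (cos_pos_of_mem hx.1).ne'

theorem hasDerivAt_ratio_radius {t ρ : ℝ} (hρ : ρ ∈ Ioo (0 : ℝ) (π / 2)) :
    HasDerivAt (fun r => Real.cos t / Real.cos r)
      (Real.cos t / Real.cos ρ * Real.tan ρ) ρ := by
  have h := cos_pos_of_mem hρ
  refine ((hasDerivAt_const ρ (Real.cos t)).fun_div (Real.hasDerivAt_cos ρ) h.ne').congr_deriv ?_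
  rw [Real.tan_eq_sin_div_cos]
  field_simp
  ring

theorem pr_riemannFun {a : ℝ} (ha : 0 < a) {x : ℝ × ℝ} (hx : x ∈ wedge) :
    pr (riemannFun a) x = ((legP' a (Real.cos x.1 / Real.cos x.2)
      * (Real.cos x.1 / Real.cos x.2 * Real.tan x.2) : ℝ) : ℂ) := by
  have h := wedge_ratio hx
  exact (((hasDerivAt_legP ha h.1 h.2).comp x.2
    (hasDerivAt_ratio_radius (t := x.1) hx.1)).ofReal_comp).deriv

/-- For `σ = cos t / cos ρ` one has `σ_ρ² - σ_t² = (σ² - 1)/cos² ρ` and `σ_ρρ - σ_tt = 2σ/cos² ρ`.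
The wave equation for a function of `σ` is therefore the Legendre equation divided by `cos² ρ`. -/
theorem riemannFun_wave {a : ℝ} (ha : 0 < a) {x : ℝ × ℝ} (hx : x ∈ wedge) :
    pt (pt (riemannFun a)) x = pr (pr (riemannFun a)) x
      - ((a * (a + 1) * (1 + Real.tan x.2 ^ 2) : ℝ) : ℂ) * riemannFun a x := by
  obtain ⟨t, ρ⟩ := x
  have h := wedge_ratio hx
  have hρ := hx.1
  simp only at h hρ
  have hc := cos_pos_of_mem hρ
  set σ := Real.cos t / Real.cos ρ with hσ
  have ept : ∀ y ∈ wedge, pt (riemannFun a) y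
      = ((legP' a (Real.cos y.1 / Real.cos y.2) * (-Real.sin y.1 / Real.cos y.2) : ℝ) : ℂ) := by
    intro y hy
    have h := wedge_ratio hy
    exact (((hasDerivAt_legP ha h.1 h.2).comp y.1
      ((Real.hasDerivAt_cos y.1).div_const (Real.cos y.2))).ofReal_comp).deriv
  have hev1 : ∀ᶠ τ in 𝓝 t, (τ, ρ) ∈ wedge :=
    (by fun_prop : Continuous fun τ : ℝ => (τ, ρ)).continuousAt.eventually
      (isOpen_wedge.mem_nhds hx)
  have hev2 : ∀ᶠ r in 𝓝 ρ, (t, r) ∈ wedge :=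
    (by fun_prop : Continuous fun r : ℝ => (t, r)).continuousAt.eventually
      (isOpen_wedge.mem_nhds hx)
  have e1 : pt (pt (riemannFun a)) (t, ρ) = ((legP'' a σ * (-Real.sin t / Real.cos ρ)
      * (-Real.sin t / Real.cos ρ) + legP' a σ * (-Real.cos t / Real.cos ρ) : ℝ) : ℂ) := by
    have h1 : HasDerivAt (fun τ => legP' a (Real.cos τ / Real.cos ρ))
        (legP'' a σ * (-Real.sin t / Real.cos ρ)) t :=
      HasDerivAt.comp (h₂ := legP' a) t (hasDerivAt_legP' ha h.1 h.2)
        ((Real.hasDerivAt_cos t).div_const (Real.cos ρ))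
    have h2 : HasDerivAt (fun τ => -Real.sin τ / Real.cos ρ) (-Real.cos t / Real.cos ρ) t :=
      (Real.hasDerivAt_sin t).fun_neg.div_const (Real.cos ρ)
    have hd := (h1.fun_mul h2).ofReal_comp
    have hd' := hd.congr_of_eventuallyEq (f₁ := fun τ => pt (riemannFun a) (τ, ρ))
      (hev1.mono fun τ hτ => ept (τ, ρ) hτ)
    exact hd'.deriv
  have e2 : pr (pr (riemannFun a)) (t, ρ) = ((legP'' a σ * (σ * Real.tan ρ) * (σ * Real.tan ρ)
      + legP' a σ * (σ * Real.tan ρ * Real.tan ρ + σ * (1 / Real.cos ρ ^ 2)) : ℝ) : ℂ) := by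
    have h0 := hasDerivAt_ratio_radius (t := t) hρ
    have h1 : HasDerivAt (fun r => legP' a (Real.cos t / Real.cos r))
        (legP'' a σ * (σ * Real.tan ρ)) ρ :=
      HasDerivAt.comp (h₂ := legP' a) ρ (hasDerivAt_legP' ha h.1 h.2) h0
    have h2 : HasDerivAt (fun r => Real.cos t / Real.cos r * Real.tan r)
        (σ * Real.tan ρ * Real.tan ρ + σ * (1 / Real.cos ρ ^ 2)) ρ :=
      h0.fun_mul (Real.hasDerivAt_tan hc.ne')
    have hd := (h1.fun_mul h2).ofReal_comp
    have hd' := hd.congr_of_eventuallyEq (f₁ := fun r => pr (riemannFun a) (t, r))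
      (hev2.mono fun r hr => pr_riemannFun ha (x := (t, r)) hr)
    exact hd'.deriv
  have hode := legendre_ode ha h.1 h.2
  have hs := Real.sin_sq_add_cos_sq t
  have hs' := Real.sin_sq_add_cos_sq ρ
  have e3 : riemannFun a (t, ρ) = (legP a σ : ℂ) := rfl
  rw [e1, e2, e3, ← Complex.ofReal_mul, ← Complex.ofReal_sub]
  congr 1
  simp only
  have ht : 1 + Real.tan ρ ^ 2 = 1 / Real.cos ρ ^ 2 := by
    rw [Real.tan_eq_sin_div_cos]; field_simp; linarith
  have ht2 : Real.tan ρ ^ 2 = 1 / Real.cos ρ ^ 2 - 1 := by linarith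
  have hct : Real.cos t = σ * Real.cos ρ := by rw [hσ]; field_simp
  have hst : Real.sin t ^ 2 = 1 - σ ^ 2 * Real.cos ρ ^ 2 := by rw [← hs, hct]; ring
  rw [ht]
  have l1 : -Real.sin t / Real.cos ρ * (-Real.sin t / Real.cos ρ)
      = 1 / Real.cos ρ ^ 2 - σ ^ 2 := by
    have : -Real.sin t / Real.cos ρ * (-Real.sin t / Real.cos ρ)
      = Real.sin t ^ 2 / Real.cos ρ ^ 2 := by ring
    rw [this, hst]; field_simp
  have l2 : -Real.cos t / Real.cos ρ = -σ := by rw [hct]; field_simp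
  have l3 : legP'' a σ * (σ * Real.tan ρ) * (σ * Real.tan ρ)
      = legP'' a σ * σ ^ 2 * (1 / Real.cos ρ ^ 2 - 1) := by rw [← ht2]; ring
  have l4 : σ * Real.tan ρ * Real.tan ρ = σ * (1 / Real.cos ρ ^ 2 - 1) := by rw [← ht2]; ring
  rw [mul_assoc, l1, l2, l3, l4]
  linear_combination (1 / Real.cos ρ ^ 2) * (-hode)

/-! ### Reconstruction at the origin from the boundary value, without angular term -/

/-- The field `(cos ρ)^Δ u`. -/
noncomputable def waveField (Δ : ℝ) (u : ℝ × ℝ → ℂ) (x : ℝ × ℝ) : ℂ :=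
  ((Real.cos x.2 ^ Δ : ℝ) : ℂ) * u x

theorem hasDerivAt_cos_rpow (Δ : ℝ) {ρ : ℝ} (hρ : 0 < Real.cos ρ) :
    HasDerivAt (fun r => Real.cos r ^ Δ) (-(Δ * Real.tan ρ * Real.cos ρ ^ Δ)) ρ := by
  refine ((Real.hasDerivAt_cos ρ).rpow_const (Or.inl hρ.ne')).congr_deriv ?_
  rw [Real.rpow_sub_one hρ.ne', Real.tan_eq_sin_div_cos]
  ring

theorem contDiffOn_of_smoothOnStrip {u : ℝ × ℝ → ℂ} (hu : SmoothOnStrip u) :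
    ContDiffOn ℝ ∞ u wedge := hu.mono (wedge_subset_strip.trans interior_subset)

theorem contDiffOn_waveField (Δ : ℝ) {u : ℝ × ℝ → ℂ} (hu : SmoothOnStrip u) :
    ContDiffOn ℝ ∞ (waveField Δ u) wedge := by
  refine ContDiffOn.mul ?_ (contDiffOn_of_smoothOnStrip hu)
  refine Complex.ofRealCLM.contDiff.comp_contDiffOn fun x hx => ?_
  exact ((Real.contDiffAt_rpow_const_of_ne (cos_pos_of_mem hx.1).ne').comp x
    (Real.contDiff_cos.contDiffAt.comp x contDiffAt_snd)).contDiffWithinAt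

theorem pr_waveField (Δ : ℝ) {u : ℝ × ℝ → ℂ} (hu : SmoothOnStrip u) {x : ℝ × ℝ} (hx : x ∈ wedge) :
    pr (waveField Δ u) x = ((Real.cos x.2 ^ Δ : ℝ) : ℂ)
      * (dr u x - (Δ : ℂ) * (Real.tan x.2 : ℂ) * u x) := by
  have h := (hasDerivAt_cos_rpow Δ (cos_pos_of_mem hx.1)).ofReal_comp.fun_mul
    (hu.hasDerivAt_radius (t := x.1) hx.1)
  refine (HasDerivAt.deriv h).trans ?_
  push_cast
  ring

/-- When `p = 0` and `q = 2Δ`, the factor `(cos ρ)^Δ` removes the first-order term and leaves the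
potential `Δ(Δ - 1)(1 + tan² ρ)`. It is written in the form of the Riemann function of degree `a = Δ
- 1`. -/
theorem waveField_wave {Δ : ℝ} {u : ℝ × ℝ → ℂ} (hu : SmoothOnStrip u)
    (h : RadialWave 0 (2 * Δ) Δ u) {x : ℝ × ℝ} (hx : x ∈ wedge) :
    pt (pt (waveField Δ u)) x = pr (pr (waveField Δ u)) x
      - (((Δ - 1) * (Δ - 1 + 1) * (1 + Real.tan x.2 ^ 2) : ℝ) : ℂ) * waveField Δ u x := by
  obtain ⟨t, ρ⟩ := x
  have hρ : ρ ∈ Ioo 0 (π / 2) := hx.1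
  have hρ' := Ioo_subset_Icc_self hρ
  have hev2 : ∀ᶠ r in 𝓝 ρ, (t, r) ∈ wedge :=
    (by fun_prop : Continuous fun r : ℝ => (t, r)).continuousAt.eventually
      (isOpen_wedge.mem_nhds hx)
  have e1 : ∀ τ, pt (waveField Δ u) (τ, ρ) = ((Real.cos ρ ^ Δ : ℝ) : ℂ) * dt u (τ, ρ) := fun τ =>
    ((hu.hasDerivAt_time (t := τ) hρ').const_mul ((Real.cos ρ ^ Δ : ℝ) : ℂ)).deriv
  have e2 : pt (pt (waveField Δ u)) (t, ρ) = ((Real.cos ρ ^ Δ : ℝ) : ℂ) * dt (dt u) (t, ρ) := by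
    have hd := ((hu.stripDeriv (1, 0)).hasDerivAt_time (t := t) hρ').const_mul
      ((Real.cos ρ ^ Δ : ℝ) : ℂ)
    have hd' := hd.congr_of_eventuallyEq (f₁ := fun τ => pt (waveField Δ u) (τ, ρ))
      (Eventually.of_forall fun τ => e1 τ)
    exact hd'.deriv
  have e3 : pr (pr (waveField Δ u)) (t, ρ) = ((Real.cos ρ ^ Δ : ℝ) : ℂ) *
      (-((Δ : ℂ) * (Real.tan ρ : ℂ)) * (dr u (t, ρ) - (Δ : ℂ) * (Real.tan ρ : ℂ) * u (t, ρ))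
      + (dr (dr u) (t, ρ) - ((Δ : ℂ) * (1 + (Real.tan ρ : ℂ) ^ 2) * u (t, ρ)
        + (Δ : ℂ) * (Real.tan ρ : ℂ) * dr u (t, ρ)))) := by
    have hd := ((hasDerivAt_cos_rpow Δ (cos_pos_of_mem hρ)).ofReal_comp).fun_mul
      (((hu.stripDeriv (0, 1)).hasDerivAt_radius (t := t) hρ).fun_sub
        (((hasDerivAt_ofReal_tan hρ).const_mul (Δ : ℂ)).fun_mul
          (hu.hasDerivAt_radius (t := t) hρ)))
    have hd' := hd.congr_of_eventuallyEq (f₁ := fun r => pr (waveField Δ u) (t, r))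
      (hev2.mono fun r hr => pr_waveField Δ hu (x := (t, r)) hr)
    refine hd'.deriv.trans ?_
    rw [Complex.ofReal_neg, Complex.ofReal_mul, Complex.ofReal_mul]
    ring
  have e4 : waveField Δ u (t, ρ) = ((Real.cos ρ ^ Δ : ℝ) : ℂ) * u (t, ρ) := rfl
  have hw := h t ρ hρ
  rw [e2, e3, e4, hw]
  generalize Real.cos ρ ^ Δ = C
  generalize Real.tan ρ = T
  simp only [zero_mul, zero_sub]
  push_cast
  ring

/-- The argument of the Riemann function along the wedge, in terms of `s = t/ρ`. -/
theorem legArg_wedge (ρ s : ℝ) :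
    legArg (Real.cos (s * ρ) / Real.cos ρ) = 1 - Real.cos ρ ^ 2 / Real.cos (s * ρ) ^ 2 := by
  rw [legArg, div_pow, inv_div]

theorem legArg_wedge_mem {ρ s : ℝ} (hρ : ρ ∈ Ioo (0 : ℝ) (π / 2)) (hs : s ∈ Icc (-1 : ℝ) 1) :
    legArg (Real.cos (s * ρ) / Real.cos ρ) ∈ Ico (0 : ℝ) 1 := by
  have h1 := cos_pos_of_mem hρ
  have h2 := cos_mul_ge hρ hs
  have h3 : 0 < Real.cos (s * ρ) := h1.trans_le h2
  rw [legArg_wedge]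
  have h4 : Real.cos ρ ^ 2 / Real.cos (s * ρ) ^ 2 ≤ 1 := by
    rw [div_le_one (by positivity)]
    gcongr
  have h5 : 0 < Real.cos ρ ^ 2 / Real.cos (s * ρ) ^ 2 := by positivity
  constructor <;> linarith

/-- The flux density in the wedge, in which the powers of `cos ρ` have cancelled. -/
noncomputable def fluxDensity (a : ℝ) (u : ℝ × ℝ → ℂ) (ρ s : ℝ) : ℂ :=
  ((Real.cos (s * ρ) ^ a : ℝ) : ℂ) *
    ((powSum (legCoeff a) (legArg (Real.cos (s * ρ) / Real.cos ρ)) : ℂ)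
        * ((Real.cos ρ : ℂ) * dr u (s * ρ, ρ) - (2 * a + 1) * (Real.sin ρ : ℂ) * u (s * ρ, ρ))
      - 2 * (Real.sin ρ : ℂ) * (((1 - legArg (Real.cos (s * ρ) / Real.cos ρ))
        * powSum (derivCoeff (legCoeff a)) (legArg (Real.cos (s * ρ) / Real.cos ρ)) : ℝ) : ℂ)
          * u (s * ρ, ρ))

theorem flux_eq {a : ℝ} (ha : 0 < a) {u : ℝ × ℝ → ℂ} (hu : SmoothOnStrip u) {ρ s : ℝ}
    (hρ : ρ ∈ Ioo (0 : ℝ) (π / 2)) (hs : s ∈ Icc (-1 : ℝ) 1) :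
    riemannFun a (s * ρ, ρ) * pr (waveField (a + 1) u) (s * ρ, ρ)
      - waveField (a + 1) u (s * ρ, ρ) * pr (riemannFun a) (s * ρ, ρ) = fluxDensity a u ρ s := by
  have hm := segment_mem_wedge hρ hs
  have h1 := cos_pos_of_mem hρ
  have h3 : 0 < Real.cos (s * ρ) := h1.trans_le (cos_mul_ge hρ hs)
  have hσ := (wedge_ratio hm).1
  simp only at hσ
  rw [pr_waveField _ hu hm, pr_riemannFun ha hm, riemannFun, waveField, fluxDensity, legP, legP']
  simp only
  set σ := Real.cos (s * ρ) / Real.cos ρ with hσdef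
  have e1 : (1 - legArg σ) = (σ ^ 2)⁻¹ := by rw [legArg]; ring
  have e2 : Real.cos (s * ρ) ^ a = σ ^ a * Real.cos ρ ^ a := by
    rw [← Real.mul_rpow hσ.le h1.le, hσdef, div_mul_cancel₀ _ h1.ne']
  have e3 : Real.cos ρ ^ (a + 1) = Real.cos ρ ^ a * Real.cos ρ := Real.rpow_add_one h1.ne' a
  have e4 : Real.sin ρ = Real.tan ρ * Real.cos ρ := (Real.tan_mul_cos h1.ne').symm
  rw [e1, e2, e3, e4]
  generalize powSum (legCoeff a) (legArg σ) = q0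
  generalize powSum (derivCoeff (legCoeff a)) (legArg σ) = q1
  generalize σ ^ a = sa
  generalize Real.cos ρ ^ a = ca
  generalize Real.tan ρ = T
  have hσ' : (σ : ℂ) ≠ 0 := by exact_mod_cast hσ.ne'
  clear_value σ
  simp only [Complex.ofReal_mul, Complex.ofReal_add, Complex.ofReal_div, Complex.ofReal_inv,
    Complex.ofReal_pow, Complex.ofReal_one, Complex.ofReal_ofNat]
  field_simp
  ring

theorem continuousOn_flux {a : ℝ} (ha : 0 < a) {u : ℝ × ℝ → ℂ} (hu : SmoothOnStrip u) {ρ : ℝ}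
    (hρ : ρ ∈ Ioo (0 : ℝ) (π / 2)) : ContinuousOn (fluxDensity a u ρ) (Icc (-1 : ℝ) 1) := by
  have hw := contDiffOn_riemannFun ha
  have hf := contDiffOn_waveField (a + 1) hu
  have h := ((hw.mul (contDiffOn_pr isOpen_wedge hf)).sub
    (hf.mul (contDiffOn_pr isOpen_wedge hw))).continuousOn
  refine (h.comp (f := fun s : ℝ => (s * ρ, ρ)) (by fun_prop)
    (fun s hs => segment_mem_wedge hρ hs)).congr fun s hs => ?_
  exact (flux_eq ha hu hρ hs).symm

/-! ### Uniform bound and boundary limit of the flux. -/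

theorem SmoothOnStrip.exists_bound {u : ℝ × ℝ → ℂ} (hu : SmoothOnStrip u) :
    ∃ B : ℝ, 0 ≤ B ∧ ∀ t ∈ Icc (-(π / 2)) (π / 2), ∀ ρ ∈ Icc 0 (π / 2), ‖u (t, ρ)‖ ≤ B := by
  obtain ⟨B, hB⟩ := (isCompact_Icc.prod isCompact_Icc :
    IsCompact (Icc (-(π / 2)) (π / 2) ×ˢ Icc 0 (π / 2))).exists_bound_of_continuousOn
    (hu.continuousOn.mono fun x hx => ⟨mem_univ _, hx.2⟩)
  refine ⟨max B 0, le_max_right _ _, fun t ht ρ hρ => (hB (t, ρ) ⟨ht, hρ⟩).trans (le_max_left _ _)⟩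

theorem mul_mem_of_mem {ρ s : ℝ} (hρ : ρ ∈ Icc (0 : ℝ) (π / 2)) (hs : s ∈ Icc (-1 : ℝ) 1) :
    s * ρ ∈ Icc (-(π / 2)) (π / 2) := by
  rw [mem_Icc, ← abs_le, abs_mul, abs_of_nonneg hρ.1]
  exact (mul_le_of_le_one_left hρ.1 (abs_le.2 hs)).trans hρ.2

/-- In this form the density involves the hypergeometric series only through `F(z)` and `(1 - z)
F'(z)`, both bounded on `[0, 1)`. The bound makes the flux vanish as `ρ → 0` and justifies dominated
convergence as `ρ → π/2`. -/
theorem exists_bound_flux {a : ℝ} (ha : 0 < a) {u : ℝ × ℝ → ℂ} (hu : SmoothOnStrip u) :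
    ∃ B : ℝ, 0 ≤ B ∧ ∀ ρ ∈ Ioo (0 : ℝ) (π / 2), ∀ s ∈ Icc (-1 : ℝ) 1, ‖fluxDensity a u ρ s‖ ≤ B := by
  obtain ⟨U0, hU0, h0⟩ := hu.exists_bound
  obtain ⟨U1, hU1, h1⟩ := (hu.stripDeriv (0, 1)).exists_bound
  set B0 := ∑' k, |legCoeff a k|
  set B1 := ∑' k, |legCoeff a (k + 1)|
  have hB0 : 0 ≤ B0 := tsum_nonneg fun _ => abs_nonneg _
  have hB1 : 0 ≤ B1 := tsum_nonneg fun _ => abs_nonneg _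
  refine ⟨1 * (B0 * (1 * U1 + (2 * a + 1) * 1 * U0) + 2 * 1 * B1 * U0), by positivity,
    fun ρ hρ s hs => ?_⟩
  have hρ' := Ioo_subset_Icc_self hρ
  have hc := cos_pos_of_mem hρ
  have hcs : 0 < Real.cos (s * ρ) := hc.trans_le (cos_mul_ge hρ hs)
  have hz := legArg_wedge_mem hρ hs
  have hu0 := h0 _ (mul_mem_of_mem hρ' hs) ρ hρ'
  have hu1 := h1 _ (mul_mem_of_mem hρ' hs) ρ hρ'
  have q0 : |powSum (legCoeff a) (legArg (Real.cos (s * ρ) / Real.cos ρ))| ≤ B0 :=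
    abs_powSum_le (summable_abs_legCoeff ha) (abs_le.2 ⟨by linarith [hz.1], hz.2.le⟩)
  have q1 := abs_one_sub_mul_powSum_derivCoeff_le (summable_abs_legCoeff ha) hz.1 hz.2.le
  have hpow : Real.cos (s * ρ) ^ a ≤ 1 := Real.rpow_le_one hcs.le (Real.cos_le_one _) ha.le
  have hpow0 : 0 ≤ Real.cos (s * ρ) ^ a := by positivity
  rw [fluxDensity]
  have n1 : ‖((Real.cos (s * ρ) ^ a : ℝ) : ℂ)‖ ≤ 1 := by
    rw [Complex.norm_real, Real.norm_eq_abs, abs_of_nonneg hpow0]; exact hpow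
  have n2 : ‖(Real.cos ρ : ℂ)‖ ≤ 1 := by
    rw [Complex.norm_real, Real.norm_eq_abs]; exact Real.abs_cos_le_one _
  have n3 : ‖(Real.sin ρ : ℂ)‖ ≤ 1 := by
    rw [Complex.norm_real, Real.norm_eq_abs]; exact Real.abs_sin_le_one _
  have n4 : ‖(2 * a + 1 : ℂ)‖ = 2 * a + 1 := by
    rw [show (2 * a + 1 : ℂ) = ((2 * a + 1 : ℝ) : ℂ) by push_cast; ring, Complex.norm_real,
      Real.norm_eq_abs, abs_of_pos (by linarith)]
  rw [norm_mul]
  refine mul_le_mul n1 ((norm_sub_le _ _).trans (add_le_add ?_ ?_)) (norm_nonneg _) zero_le_one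
  · rw [norm_mul]
    refine mul_le_mul (by rwa [Complex.norm_real]) ((norm_sub_le _ _).trans (add_le_add ?_ ?_))
      (norm_nonneg _) hB0
    · rw [norm_mul]
      exact mul_le_mul n2 hu1 (norm_nonneg _) zero_le_one
    · rw [norm_mul, norm_mul, n4]
      gcongr
  · rw [norm_mul, norm_mul, norm_mul, Complex.norm_real ((1 - _) * _), Complex.norm_ofNat]
    gcongr
    exact q1

/-- For `|s| < 1`, `cos(sρ)` stays positive while `cos ρ → 0`, so `z → 1`, `F(z)` tends to the Gauss
sum and `(1 - z) F'(z) → 0`. At `s = ±1` the argument `z` is identically 0, so the end points are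
excluded; they have measure zero. -/
theorem tendsto_flux {a : ℝ} (ha : 0 < a) {u : ℝ × ℝ → ℂ} (hu : SmoothOnStrip u) {s : ℝ}
    (hs : s ∈ Ioo (-1 : ℝ) 1) :
    Tendsto (fun ρ => fluxDensity a u ρ s) (𝓝[<] (π / 2))
      (𝓝 (-((2 * a + 1 : ℝ) * (∑' k, legCoeff a k : ℝ) : ℂ)
        * ((Real.cos (s * (π / 2)) ^ a : ℝ) * u (s * (π / 2), π / 2)))) := by
  have hpi := Real.pi_pos
  have hs' := Ioo_subset_Icc_self hs
  have hcs : 0 < Real.cos (s * (π / 2)) := by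
    refine Real.cos_pos_of_mem_Ioo ⟨?_, ?_⟩ <;> nlinarith [hs.1, hs.2]
  have hin : ∀ᶠ ρ in 𝓝[<] (π / 2), ρ ∈ Ioo (0 : ℝ) (π / 2) := Ioo_mem_nhdsLT (by positivity)
  have hz : Tendsto (fun ρ => legArg (Real.cos (s * ρ) / Real.cos ρ)) (𝓝[<] (π / 2)) (𝓝[<] 1) := by
    refine tendsto_nhdsWithin_iff.2 ⟨?_, hin.mono fun ρ hρ => (legArg_wedge_mem hρ hs').2⟩
    have : Tendsto (fun ρ => 1 - Real.cos ρ ^ 2 / Real.cos (s * ρ) ^ 2) (𝓝 (π / 2))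
        (𝓝 (1 - Real.cos (π / 2) ^ 2 / Real.cos (s * (π / 2)) ^ 2)) := by
      have hne : Real.cos (s * (π / 2)) ^ 2 ≠ 0 := by positivity
      have : ContinuousAt (fun ρ => 1 - Real.cos ρ ^ 2 / Real.cos (s * ρ) ^ 2) (π / 2) :=
        continuousAt_const.sub (ContinuousAt.div (by fun_prop) (by fun_prop) hne)
      exact this
    simp only [Real.cos_pi_div_two] at this
    norm_num at this
    refine (this.mono_left nhdsWithin_le_nhds).congr' (hin.mono fun ρ hρ => ?_)
    exact (legArg_wedge ρ s).symm
  have t0 := (Complex.continuous_ofReal.tendsto _).comp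
    ((tendsto_powSum_one (summable_abs_legCoeff ha)).comp hz)
  have t1 := (Complex.continuous_ofReal.tendsto _).comp
    ((tendsto_one_sub_mul_powSum_derivCoeff (summable_abs_legCoeff ha)).comp hz)
  have hline : ∀ v : ℝ × ℝ → ℂ, SmoothOnStrip v →
      Tendsto (fun ρ => v (s * ρ, ρ)) (𝓝[<] (π / 2)) (𝓝 (v (s * (π / 2), π / 2))) := by
    intro v hv
    have hc : ContinuousWithinAt v strip (s * (π / 2), π / 2) :=
      hv.continuousOn _ (mem_strip.2 ⟨by positivity, le_rfl⟩)
    refine Tendsto.comp (f := fun ρ => (s * ρ, ρ)) (g := v) hc (tendsto_nhdsWithin_iff.2 ⟨?_, ?_⟩)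
    · exact ((by fun_prop : Continuous fun ρ : ℝ => (s * ρ, ρ)).tendsto _).mono_left
        nhdsWithin_le_nhds
    · exact hin.mono fun ρ hρ => mem_strip.2 (Ioo_subset_Icc_self hρ)
  have tu := hline u hu
  have tdu := hline _ (hu.stripDeriv (0, 1))
  have tc : Tendsto (fun ρ : ℝ => (Real.cos ρ : ℂ)) (𝓝[<] (π / 2)) (𝓝 ((0 : ℝ) : ℂ)) := by
    rw [← Real.cos_pi_div_two]
    exact ((by fun_prop : Continuous fun ρ : ℝ => (Real.cos ρ : ℂ)).tendsto _).mono_left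
      nhdsWithin_le_nhds
  have ts : Tendsto (fun ρ : ℝ => (Real.sin ρ : ℂ)) (𝓝[<] (π / 2)) (𝓝 ((1 : ℝ) : ℂ)) := by
    rw [← Real.sin_pi_div_two]
    exact ((by fun_prop : Continuous fun ρ : ℝ => (Real.sin ρ : ℂ)).tendsto _).mono_left
      nhdsWithin_le_nhds
  have tp : Tendsto (fun ρ : ℝ => ((Real.cos (s * ρ) ^ a : ℝ) : ℂ)) (𝓝[<] (π / 2))
      (𝓝 ((Real.cos (s * (π / 2)) ^ a : ℝ) : ℂ)) := by
    have : ContinuousAt (fun ρ : ℝ => Real.cos (s * ρ) ^ a) (π / 2) :=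
      ContinuousAt.rpow_const (by fun_prop) (Or.inl hcs.ne')
    exact (Complex.continuous_ofReal.tendsto _).comp (this.tendsto.mono_left nhdsWithin_le_nhds)
  have := tp.mul ((t0.mul ((tc.mul tdu).sub ((ts.const_mul (2 * a + 1 : ℂ)).mul tu))).sub
    (((ts.const_mul (2 : ℂ)).mul t1).mul tu))
  have e : (-((2 * a + 1 : ℝ) * (∑' k, legCoeff a k : ℝ) : ℂ)
        * ((Real.cos (s * (π / 2)) ^ a : ℝ) * u (s * (π / 2), π / 2)))
      = ((Real.cos (s * (π / 2)) ^ a : ℝ) : ℂ) * (((∑' k, legCoeff a k : ℝ) : ℂ)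
        * (((0 : ℝ) : ℂ) * dr u (s * (π / 2), π / 2)
          - (2 * a + 1) * ((1 : ℝ) : ℂ) * u (s * (π / 2), π / 2))
        - 2 * ((1 : ℝ) : ℂ) * ((0 : ℝ) : ℂ) * u (s * (π / 2), π / 2)) := by
    generalize Real.cos (s * (π / 2)) ^ a = C
    generalize ∑' k, legCoeff a k = S
    push_cast
    ring
  rw [e]
  exact this

/-- Reconstruction of the value at the origin when the angular dimension is zero. -/
theorem RadialWave.reconstruct_base {a : ℝ} (ha : 0 < a) {u : ℝ × ℝ → ℂ} (hu : SmoothOnStrip u)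
    (h : RadialWave 0 (2 * (a + 1)) (a + 1) u) :
    u (0, 0) = (((2 * a + 1) / 2 * ∑' k, legCoeff a k : ℝ) : ℂ)
      * ∫ t in (-(π / 2))..(π / 2), ((Real.cos t ^ a : ℝ) : ℂ) * u (t, π / 2) := by
  have hpi := Real.pi_pos
  have hle : (-1 : ℝ) ≤ 1 := by norm_num
  set f := waveField (a + 1) u with hf
  -- The conserved quantity of Green's identity: the flux through the section `|t| < r` minus the
  -- two values on the light cone.
  set E : ℝ → ℂ := fun r => (∫ s in (-1 : ℝ)..1, (r : ℂ) *
      (riemannFun a (s * r, r) * pr f (s * r, r) - f (s * r, r) * pr (riemannFun a) (s * r, r)))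
        - f (r, r) - f (-r, r) with hE
  have hEd : ∀ ρ ∈ Ioo (0 : ℝ) (π / 2), HasDerivAt E 0 ρ := by
    intro ρ hρ
    refine hasDerivAt_wedge_green isOpen_wedge (contDiffOn_waveField _ hu)
      (contDiffOn_riemannFun ha) (fun x => ((a * (a + 1) * (1 + Real.tan x.2 ^ 2) : ℝ) : ℂ))
      (fun x hx => ?_) (fun x hx => riemannFun_wave ha hx)
      (fun ρ hρ s hs => segment_mem_wedge hρ hs) (fun ρ hρ => ?_) (fun ρ hρ => ?_) hρ
    · have := waveField_wave hu h hx
      rwa [add_sub_cancel_right] at this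
    · simp [riemannFun, div_self (cos_pos_of_mem hρ).ne', legP_one]
    · simp [riemannFun, div_self (cos_pos_of_mem hρ).ne', legP_one]
  have hconst : ∀ ρ ∈ Ioo (0 : ℝ) (π / 2), E ρ = E (π / 4) := by
    intro ρ hρ
    refine isOpen_Ioo.is_const_of_deriv_eq_zero (convex_Ioo _ _).isPreconnected
      (fun r hr => (hEd r hr).differentiableAt.differentiableWithinAt)
      (fun r hr => (hEd r hr).deriv) hρ ⟨by positivity, by linarith⟩
  have hEeq : ∀ ρ ∈ Ioo (0 : ℝ) (π / 2), E ρ = (ρ : ℂ) * (∫ s in (-1 : ℝ)..1, fluxDensity a u ρ s)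
      - f (ρ, ρ) - f (-ρ, ρ) := by
    intro ρ hρ
    rw [hE]
    simp only
    rw [intervalIntegral.integral_const_mul]
    congr 3
    refine intervalIntegral.integral_congr fun s hs => ?_
    rw [uIcc_of_le hle] at hs
    exact flux_eq ha hu hρ hs
  obtain ⟨B, hB0, hB⟩ := exists_bound_flux ha hu
  have hbd : ∀ ρ ∈ Ioo (0 : ℝ) (π / 2), ‖∫ s in (-1 : ℝ)..1, fluxDensity a u ρ s‖ ≤ B * 2 := by
    intro ρ hρ
    have := intervalIntegral.norm_integral_le_of_norm_le_const (a := (-1 : ℝ)) (b := 1)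
      (f := fluxDensity a u ρ) (C := B) fun s hs => by
        rw [uIoc_of_le hle] at hs
        exact hB ρ hρ s (Ioc_subset_Icc_self hs)
    norm_num at this
    exact this
  have hin0 : ∀ᶠ ρ in 𝓝[>] (0 : ℝ), ρ ∈ Ioo (0 : ℝ) (π / 2) := Ioo_mem_nhdsGT (by positivity)
  have hin1 : ∀ᶠ ρ in 𝓝[<] (π / 2), ρ ∈ Ioo (0 : ℝ) (π / 2) := Ioo_mem_nhdsLT (by positivity)
  have hfd : ∀ (c : ℝ) (l : Filter ℝ) (ρ₀ : ℝ), ρ₀ ∈ Icc 0 (π / 2) → l ≤ 𝓝 ρ₀ →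
      (∀ᶠ ρ in l, ρ ∈ Ioo (0 : ℝ) (π / 2)) →
      Tendsto (fun ρ => f (c * ρ, ρ)) l (𝓝 (f (c * ρ₀, ρ₀))) := by
    intro c l ρ₀ hρ₀ hl hin
    refine Tendsto.mul ?_ ?_
    · have : Continuous fun ρ : ℝ => ((Real.cos ρ ^ (a + 1) : ℝ) : ℂ) :=
        Complex.continuous_ofReal.comp
          (Real.continuous_cos.rpow_const fun _ => Or.inr (by linarith))
      exact (this.tendsto ρ₀).mono_left hl
    · refine Tendsto.comp (f := fun ρ => (c * ρ, ρ)) (g := u)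
        (hu.continuousOn (c * ρ₀, ρ₀) (mem_strip.2 hρ₀)) (tendsto_nhdsWithin_iff.2 ⟨?_, ?_⟩)
      · exact ((by fun_prop : Continuous fun ρ : ℝ => (c * ρ, ρ)).tendsto _).mono_left hl
      · exact hin.mono fun ρ hρ => mem_strip.2 (Ioo_subset_Icc_self hρ)
  -- The section shrinks to a point, so the flux disappears and only the two light-cone values
  -- remain.
  have lim0 : Tendsto E (𝓝[>] 0) (𝓝 (-2 * u (0, 0))) := by
    have h1 := hfd 1 _ 0 ⟨le_rfl, by positivity⟩ nhdsWithin_le_nhds hin0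
    have h2 := hfd (-1) _ 0 ⟨le_rfl, by positivity⟩ nhdsWithin_le_nhds hin0
    have h3 : Tendsto (fun ρ : ℝ => (ρ : ℂ) * ∫ s in (-1 : ℝ)..1, fluxDensity a u ρ s) (𝓝[>] 0)
        (𝓝 0) := by
      have h4 : Tendsto (fun ρ : ℝ => ρ * (B * 2)) (𝓝[>] 0) (𝓝 0) := by
        have : Continuous fun ρ : ℝ => ρ * (B * 2) := by fun_prop
        simpa using (this.tendsto 0).mono_left (nhdsWithin_le_nhds (s := Ioi 0))
      refine squeeze_zero_norm' (hin0.mono fun ρ hρ => ?_) h4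
      rw [norm_mul, Complex.norm_real, Real.norm_eq_abs, abs_of_pos hρ.1]
      exact mul_le_mul_of_nonneg_left (hbd ρ hρ) hρ.1.le
    have h5 := (h3.sub h1).sub h2
    simp only [one_mul, neg_mul, mul_zero] at h5
    have e : f (0, 0) = u (0, 0) := by simp [hf, waveField]
    rw [e] at h5
    have e' : (0 : ℂ) - u (0, 0) - u (0, 0) = -2 * u (0, 0) := by ring
    rw [e'] at h5
    exact h5.congr' (hin0.mono fun ρ hρ => (hEeq ρ hρ).symm)
  -- Here the light-cone values vanish, since `(cos ρ)^{a+1} → 0`, and only the limiting flux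
  -- survives.
  have lim1 : Tendsto E (𝓝[<] (π / 2)) (𝓝 (((π / 2 : ℝ) : ℂ) * ∫ s in (-1 : ℝ)..1,
      (-((2 * a + 1 : ℝ) * (∑' k, legCoeff a k : ℝ) : ℂ)
        * ((Real.cos (s * (π / 2)) ^ a : ℝ) * u (s * (π / 2), π / 2))))) := by
    have h1 := hfd 1 _ (π / 2) ⟨by positivity, le_rfl⟩ nhdsWithin_le_nhds hin1
    have h2 := hfd (-1) _ (π / 2) ⟨by positivity, le_rfl⟩ nhdsWithin_le_nhds hin1
    have h3 : Tendsto (fun ρ : ℝ => ∫ s in (-1 : ℝ)..1, fluxDensity a u ρ s) (𝓝[<] (π / 2))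
        (𝓝 (∫ s in (-1 : ℝ)..1, (-((2 * a + 1 : ℝ) * (∑' k, legCoeff a k : ℝ) : ℂ)
        * ((Real.cos (s * (π / 2)) ^ a : ℝ) * u (s * (π / 2), π / 2))))) := by
      refine intervalIntegral.tendsto_integral_filter_of_dominated_convergence (fun _ => B)
        (hin1.mono fun ρ hρ => ?_) (hin1.mono fun ρ hρ => ?_) intervalIntegrable_const ?_
      · rw [uIoc_of_le hle]
        exact ((continuousOn_flux ha hu hρ).mono Ioc_subset_Icc_self).aestronglyMeasurable
          measurableSet_Ioc
      · refine Eventually.of_forall fun s hs => ?_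
        rw [uIoc_of_le hle] at hs
        exact hB ρ hρ s (Ioc_subset_Icc_self hs)
      · have : ∀ᵐ s : ℝ, s ≠ 1 := by simp [ae_iff, measure_singleton]
        filter_upwards [this] with s hs1 hs
        rw [uIoc_of_le hle] at hs
        exact tendsto_flux ha hu ⟨hs.1, lt_of_le_of_ne hs.2 hs1⟩
    have h4 : Tendsto (fun ρ : ℝ => (ρ : ℂ)) (𝓝[<] (π / 2)) (𝓝 ((π / 2 : ℝ) : ℂ)) :=
      (Complex.continuous_ofReal.tendsto _).mono_left nhdsWithin_le_nhds
    have h5 := ((h4.mul h3).sub h1).sub h2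
    have e : ∀ t, f (t, π / 2) = 0 := fun t => by
      simp [hf, waveField, Real.zero_rpow (by linarith : a + 1 ≠ 0)]
    rw [e, e, sub_zero, sub_zero] at h5
    simp only [one_mul, neg_mul (1 : ℝ)] at h5
    exact h5.congr' (hin1.mono fun ρ hρ => (hEeq ρ hρ).symm)
  have k0 := tendsto_nhds_unique lim0
    ((tendsto_const_nhds (x := E (π / 4))).congr' (hin0.mono fun ρ hρ => (hconst ρ hρ).symm))
  have k1 := tendsto_nhds_unique lim1
    ((tendsto_const_nhds (x := E (π / 4))).congr' (hin1.mono fun ρ hρ => (hconst ρ hρ).symm))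
  rw [← k0, intervalIntegral.integral_const_mul] at k1
  have hsub := intervalIntegral.smul_integral_comp_mul_right (a := (-1 : ℝ)) (b := 1)
    (fun t => ((Real.cos t ^ a : ℝ) : ℂ) * u (t, π / 2)) (π / 2)
  rw [one_mul, neg_one_mul, Complex.real_smul] at hsub
  rw [← hsub]
  generalize (∑' k, legCoeff a k) = S at *
  push_cast at *
  linear_combination (1 / 2 : ℂ) * k1

/-! ### The finite part functional and reconstruction in all odd dimensions -/

/-- The finite part of `∫ (cos t)^b f(t) dt`, reduced to exponent `b + 2m` by integration by
parts. -/
noncomputable def finitePart : ℕ → ℝ → (ℝ → ℂ) → ℂ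
  | 0, b, f => ∫ t in (-(π / 2))..(π / 2), ((Real.cos t ^ b : ℝ) : ℂ) * f t
  -- Comes from `(cos^{b+2})'' = (b+2)(b+1) cos^b - (b+2)² cos^{b+2}`, with both derivatives moved
  -- onto `f` and the boundary terms dropped. If `(b+2)(b+1) = 0` the inverse is 0 and the value is
  -- meaningless.
  | m + 1, b, f => (((b + 2) * (b + 1) : ℝ) : ℂ)⁻¹
      * finitePart m (b + 2) (fun t => deriv (deriv f) t + (((b + 2) ^ 2 : ℝ) : ℂ) * f t)

theorem finitePart_const_mul (m : ℕ) (b : ℝ) (c : ℂ) (f : ℝ → ℂ) :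
    finitePart m b (fun t => c * f t) = c * finitePart m b f := by
  induction m generalizing b f with
  | zero =>
    simp only [finitePart]
    rw [← intervalIntegral.integral_const_mul]
    congr 1; funext t; ring
  | succ m ih =>
    simp only [finitePart]
    rw [mul_left_comm, ← ih]
    congr 2; funext t
    have h1 : deriv (fun t => c * f t) = fun t => c * deriv f t := by
      funext t; exact deriv_const_mul_field c
    have h2 : deriv (deriv fun t => c * f t) t = c * deriv (deriv f) t := by
      rw [h1]; exact deriv_const_mul_field c
    rw [h2]; ring

/-- The normalisation constant of the reconstruction formula. -/
noncomputable def reconstructConst (Δ : ℝ) : ℕ → ℝ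
  | 0 => (2 * (Δ - 1) + 1) / 2 * ∑' k, legCoeff (Δ - 1) k
  -- The numerator cancels the prefactor in `finitePart`. In the denominator, `2m + 1` is `p - 1`
  -- from the origin and `2Δ - 2m - 1` is `1 + q` from the boundary.
  | m + 1 => -(reconstructConst Δ m * ((Δ - 2 * m - 1) * (Δ - 2 * m - 2)
      / ((2 * m + 1) * (2 * Δ - 2 * m - 1))))

theorem SmoothOnStrip.deriv_deriv_boundary {u : ℝ × ℝ → ℂ} (hu : SmoothOnStrip u) (t : ℝ) :
    deriv (deriv fun τ => u (τ, π / 2)) t = dt (dt u) (t, π / 2) := by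
  have hm : π / 2 ∈ Icc 0 (π / 2) := ⟨by positivity, le_rfl⟩
  have h1 : (deriv fun τ => u (τ, π / 2)) = fun τ => dt u (τ, π / 2) := by
    funext τ; exact (hu.hasDerivAt_time hm).deriv
  rw [h1]
  exact ((hu.stripDeriv (1, 0)).hasDerivAt_time hm).deriv

/-- Reconstruction of the value at the origin from the boundary value. -/
theorem RadialWave.reconstruct {Δ : ℝ} (hΔ : 1 < Δ) (m : ℕ) (hm : (m : ℝ) < Δ)
    (hne : ∀ j : ℕ, Δ - 2 * m + j ≠ 0) {u : ℝ × ℝ → ℂ} (hu : SmoothOnStrip u)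
    (h : RadialWave (2 * m) (2 * Δ - 2 * m) Δ u) :
    u (0, 0) = (reconstructConst Δ m : ℂ)
      * finitePart m (Δ - 2 * m - 1) (fun t => u (t, π / 2)) := by
  induction m generalizing u with
  | zero =>
    have h' : RadialWave 0 (2 * (Δ - 1 + 1)) (Δ - 1 + 1) u := by
      simpa using h
    have := h'.reconstruct_base (by linarith) hu
    simpa [reconstructConst, finitePart] using this
  | succ m ih =>
    push_cast at hm h hne
    set q : ℝ := 2 * Δ - 2 * (m + 1) with hq
    have hq0 : 0 < q := by rw [hq]; linarith
    have hv := smoothOnStrip_lower hq0.ne' hu h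
    have hw := h.lower hq0.ne' hu
    -- The induction hypothesis is applied to the lowered field, whose values at the origin and on
    -- the boundary are known in terms of `u`.
    have hw' : RadialWave (2 * m) (2 * Δ - 2 * m) Δ (HKLL.lower (2 * (m + 1)) q Δ u) := by
      convert hw using 1
      · ring
      · rw [hq]; ring
    have hne1 : ∀ j : ℕ, Δ - 2 * m + j ≠ 0 := fun j => by
      have := hne (j + 2)
      push_cast at this
      convert this using 1
      ring
    have key := ih (by linarith) hne1 hv hw'
    have hb : Δ - 2 * ((m : ℝ) + 1) - 1 + 2 = Δ - 2 * m - 1 := by ring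
    -- `Δ² - (p - 1)(q + 1)` is the perfect square `(Δ - 2m - 1)²`, which is the constant `(b + 2)²`
    -- in `finitePart` for `b = Δ - 2(m + 1) - 1`.
    have hbv : (fun t => HKLL.lower (2 * (m + 1)) q Δ u (t, π / 2)) = fun t =>
        (-((1 + q : ℝ) : ℂ)⁻¹) * (deriv (deriv fun τ => u (τ, π / 2)) t
          + (((Δ - 2 * m - 1) ^ 2 : ℝ) : ℂ) * u (t, π / 2)) := by
      funext t
      rw [lower_apply_boundary hq0 hu h t, hu.deriv_deriv_boundary]
      congr 4
      rw [hq]; ring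
    rw [lower_apply_zero, hbv, finitePart_const_mul] at key
    simp only [finitePart, Nat.cast_add, Nat.cast_one]
    rw [hb]
    generalize finitePart m (Δ - 2 * m - 1) _ = X at key ⊢
    have n1 : (Δ - 2 * m - 1 : ℂ) ≠ 0 := by
      have h2 : Δ - 2 * m - 1 ≠ 0 := by
        convert hne 1 using 1; push_cast; ring
      exact_mod_cast h2
    have n2 : (Δ - 2 * m - 2 : ℂ) ≠ 0 := by
      have h2 : Δ - 2 * m - 2 ≠ 0 := by
        convert hne 0 using 1; push_cast; ring
      exact_mod_cast h2
    have n3 : (2 * m + 1 : ℂ) ≠ 0 := by exact_mod_cast (by positivity : (2 * m + 1 : ℝ) ≠ 0)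
    have n4 : (2 * Δ - 2 * m - 1 : ℂ) ≠ 0 := by
      have : 2 * Δ - 2 * m - 1 ≠ 0 := by
        have : 0 < 2 * Δ - 2 * m - 1 := by rw [hq] at hq0; linarith
        exact this.ne'
      exact_mod_cast this
    have e0 : (1 + q : ℂ) = 2 * Δ - 2 * m - 1 := by
      rw [hq]; push_cast; ring
    have e1 : (Δ - 2 * (m + 1) - 1 + 2 : ℂ) = Δ - 2 * m - 1 := by ring
    have e2 : (Δ - 2 * (m + 1) - 1 + 1 : ℂ) = Δ - 2 * m - 2 := by ring
    have e3 : (2 * (m + 1) - 1 : ℂ) = 2 * m + 1 := by ring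
    push_cast at key
    rw [e0, e3] at key
    push_cast [reconstructConst]
    rw [e2]
    have key' : u (0, 0) = (2 * m + 1 : ℂ)⁻¹
        * ((reconstructConst Δ m : ℂ) * (-(2 * Δ - 2 * m - 1 : ℂ)⁻¹ * X)) := by
      rw [← key, inv_mul_cancel_left₀ n3]
    rw [key']
    have c1 : (Δ - 2 * m - 1 : ℂ) * (Δ - 2 * m - 2)
        * ((Δ - 2 * m - 1 : ℂ) * (Δ - 2 * m - 2))⁻¹ = 1 :=
      mul_inv_cancel₀ (mul_ne_zero n1 n2)
    rw [div_eq_mul_inv, mul_inv (2 * m + 1 : ℂ)]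
    linear_combination (-(reconstructConst Δ m : ℂ) * (-(2 * Δ - 2 * m - 1 : ℂ)⁻¹ * X)
      * (2 * m + 1 : ℂ)⁻¹) * c1

/-! ### Closed form of the normalisation constant. -/

/-- Gauss's theorem gives the sum as `Γ(Δ - 1/2) / (Γ((Δ + 1)/2) Γ(Δ/2))`, and Legendre's
duplication formula collapses the denominator. -/
theorem reconstructConst_zero {Δ : ℝ} (hΔ : 1 < Δ) :
    reconstructConst Δ 0 = 2 ^ (Δ - 1) * Real.Gamma (Δ + 1 / 2)
      / (Real.Gamma (1 / 2) * Real.Gamma Δ) := by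
  have hsum : ∑' k, legCoeff (Δ - 1) k
      = Real.Gamma (Δ - 1 / 2) / (Real.Gamma ((Δ + 1) / 2) * Real.Gamma (Δ / 2)) := by
    have := tsum_hypCoeff (A := -(Δ - 1) / 2) (B := (1 - (Δ - 1)) / 2) (C := 1) one_pos
      (by linarith) (by linarith) (by linarith)
    rw [legCoeff, this, Real.Gamma_one, one_mul]
    ring_nf
  have hdup := Real.Gamma_mul_Gamma_add_half (Δ / 2)
  have hG : Real.Gamma (Δ + 1 / 2) = (Δ - 1 / 2) * Real.Gamma (Δ - 1 / 2) := by
    rw [← Real.Gamma_add_one (by linarith)]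
    congr 1; ring
  have e1 : 2 * (Δ / 2) = Δ := by ring
  have e2 : Δ / 2 + 1 / 2 = (Δ + 1) / 2 := by ring
  rw [e1, e2] at hdup
  have g1 : Real.Gamma ((Δ + 1) / 2) * Real.Gamma (Δ / 2)
      = Real.Gamma Δ * 2 ^ (1 - Δ) * √π := by rw [mul_comm]; exact hdup
  rw [reconstructConst, hsum, g1, hG, Real.Gamma_one_half_eq]
  have e3 : (2 : ℝ) ^ (1 - Δ) = (2 ^ (Δ - 1))⁻¹ := by
    rw [← Real.rpow_neg zero_le_two]; congr 1; ring
  rw [e3]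
  have p1 : (2 : ℝ) ^ (Δ - 1) ≠ 0 := (Real.rpow_pos_of_pos two_pos _).ne'
  have p2 : Real.Gamma Δ ≠ 0 := (Real.Gamma_pos_of_pos (by linarith)).ne'
  have p3 : √π ≠ 0 := by have := Real.pi_pos; positivity
  field_simp
  ring

/-- Both sides obey the same recursion by `Γ(x + 1) = x Γ(x)`. The nonvanishing hypothesis keeps `Δ
- 2m` off the poles of `Γ`. -/
theorem reconstructConst_eq {Δ : ℝ} (hΔ : 1 < Δ) (m : ℕ) (hm : (m : ℝ) < Δ)
    (hne : ∀ j : ℕ, Δ - 2 * m + j ≠ 0) :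
    reconstructConst Δ m = (-1) ^ m * 2 ^ (Δ - 2 * m - 1) * Real.Gamma (Δ - m + 1 / 2)
      / (Real.Gamma (m + 1 / 2) * Real.Gamma (Δ - 2 * m)) := by
  induction m with
  | zero => simpa using reconstructConst_zero hΔ
  | succ m ih =>
    push_cast at hm hne ⊢
    have hne1 : ∀ j : ℕ, Δ - 2 * m + j ≠ 0 := fun j => by
      have := hne (j + 2)
      push_cast at this
      convert this using 1
      ring
    have n1 : Δ - 2 * m - 1 ≠ 0 := by
      have := hne 1
      convert this using 1; push_cast; ring
    have n2 : Δ - 2 * m - 2 ≠ 0 := by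
      have := hne 0
      convert this using 1; push_cast; ring
    have m0 : (0 : ℝ) ≤ m := by positivity
    have g1 : Real.Gamma (Δ - m + 1 / 2) = (Δ - m - 1 / 2) * Real.Gamma (Δ - m - 1 / 2) := by
      rw [← Real.Gamma_add_one (by linarith)]; congr 1; ring
    have g2 : Real.Gamma ((m : ℝ) + 1 + 1 / 2) = (m + 1 / 2) * Real.Gamma (m + 1 / 2) := by
      rw [← Real.Gamma_add_one (by positivity)]; congr 1; ring
    have g3 : Real.Gamma (Δ - 2 * m)
        = (Δ - 2 * m - 1) * ((Δ - 2 * m - 2) * Real.Gamma (Δ - 2 * m - 2)) := by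
      rw [← Real.Gamma_add_one n2, show Δ - 2 * (m : ℝ) - 2 + 1 = Δ - 2 * m - 1 by ring,
        ← Real.Gamma_add_one n1]
      congr 1; ring
    have g4 : Real.Gamma (Δ - 2 * m - 2) ≠ 0 := by
      refine Real.Gamma_ne_zero fun j hj => hne j ?_
      linarith
    have g5 : Real.Gamma ((m : ℝ) + 1 / 2) ≠ 0 := (Real.Gamma_pos_of_pos (by positivity)).ne'
    have e1 : (2 : ℝ) ^ (Δ - 2 * m - 1) = 4 * 2 ^ (Δ - 2 * (m + 1) - 1) := by
      have : (4 : ℝ) = 2 ^ (2 : ℝ) := by norm_num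
      rw [this, ← Real.rpow_add two_pos]; congr 1; ring
    have e2 : Δ - ((m : ℝ) + 1) + 1 / 2 = Δ - m - 1 / 2 := by ring
    have e3 : Δ - 2 * ((m : ℝ) + 1) = Δ - 2 * m - 2 := by ring
    have n3 : (2 * (m : ℝ) + 1) ≠ 0 := by positivity
    have n4 : 2 * Δ - 2 * m - 1 ≠ 0 := by
      have : 0 < 2 * Δ - 2 * m - 1 := by linarith
      exact this.ne'
    have n5 : (m : ℝ) + 1 / 2 ≠ 0 := by positivity
    have n6 : 2 * (Δ - m) - 1 ≠ 0 := by convert n4 using 1; ring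
    rw [reconstructConst, ih (by linarith) hne1, g1, g2, g3, e1, e2, e3, pow_succ]
    field_simp
    ring

/-! ### The spherical Laplacian integrates to zero -/

section Homogeneous

variable {E : Type*} [NormedAddCommGroup E]

theorem continuous_smul_of_continuousOn_compl_zero {F : Type*} [NormedAddCommGroup F]
    [NormedSpace ℝ F] {χ : E → ℝ} (hχ : Continuous χ) (h0 : (0 : E) ∉ tsupport χ) {f : E → F}
    (hf : ContinuousOn f {0}ᶜ) : Continuous fun x => χ x • f x := by
  refine continuous_of_tsupport fun x hx => ?_
  have hx' : x ∈ tsupport χ := closure_mono (Function.support_smul_subset_left χ f) hx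
  have hne : x ≠ 0 := fun h => h0 (h ▸ hx')
  exact hχ.continuousAt.smul (hf.continuousAt (isOpen_compl_singleton.mem_nhds hne))

variable [InnerProductSpace ℝ E]

theorem fderiv_smul_eq_of_homogeneous {H : E → ℂ} (hH : ∀ c : ℝ, 0 < c → ∀ x, H (c • x) = H x)
    {c : ℝ} (hc : 0 < c) (x : E) : fderiv ℝ H (c • x) = c⁻¹ • fderiv ℝ H x := by
  have h := fderiv_comp_smul (f := H) (x := x) c
  have e : (fun y => H (c • y)) = H := funext (hH c hc)
  rw [e] at h
  rw [h, smul_smul, inv_mul_cancel₀ hc.ne', one_smul]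

theorem fderiv_self_eq_zero_of_homogeneous {H : E → ℂ}
    (hH : ∀ c : ℝ, 0 < c → ∀ x, H (c • x) = H x) {x : E} (hx : DifferentiableAt ℝ H x) :
    fderiv ℝ H x x = 0 := by
  have h1 : HasDerivAt (fun c : ℝ => c • x) x 1 := by
    simpa using (hasDerivAt_id (1 : ℝ)).smul_const x
  have h2 : HasFDerivAt H (fderiv ℝ H x) ((1 : ℝ) • x) := by
    rw [one_smul]; exact hx.hasFDerivAt
  have h3 := h2.comp_hasDerivAt (1 : ℝ) h1
  have h4 : H ∘ (fun c : ℝ => c • x) =ᶠ[𝓝 1] fun _ => H x := by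
    filter_upwards [lt_mem_nhds one_pos] with c hc using hH c hc x
  exact (h3.congr_of_eventuallyEq h4.symm).unique (hasDerivAt_const _ _)

variable [FiniteDimensional ℝ E]

theorem laplacian_eq_sum_fderiv {H : E → ℂ} (x : E) :
    Laplacian.laplacian H x = ∑ i, fderiv ℝ (fderiv ℝ H) x (stdOrthonormalBasis ℝ E i)
      (stdOrthonormalBasis ℝ E i) := by
  rw [InnerProductSpace.laplacian_eq_iteratedFDeriv_stdOrthonormalBasis]
  simp [iteratedFDeriv_two_apply]

theorem laplacian_smul_of_homogeneous {H : E → ℂ}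
    (hH : ∀ c : ℝ, 0 < c → ∀ x, H (c • x) = H x) {c : ℝ} (hc : 0 < c) (x : E) :
    Laplacian.laplacian H (c • x) = ((c ^ 2)⁻¹ : ℝ) • Laplacian.laplacian H x := by
  have h1 : (fun y => fderiv ℝ H (c • y)) = c⁻¹ • fderiv ℝ H :=
    funext fun y => fderiv_smul_eq_of_homogeneous hH hc y
  have h2 : fderiv ℝ (fderiv ℝ H) (c • x) = (c ^ 2)⁻¹ • fderiv ℝ (fderiv ℝ H) x := by
    have h : fderiv ℝ (fun y => fderiv ℝ H (c • y)) x = c • fderiv ℝ (fderiv ℝ H) (c • x) :=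
      fderiv_comp_smul (f := fderiv ℝ H) (x := x) c
    have h3 : fderiv ℝ (c⁻¹ • fderiv ℝ H) x = c⁻¹ • fderiv ℝ (fderiv ℝ H) x :=
      congrFun (fderiv_const_smul_field (𝕜 := ℝ) (f := fderiv ℝ H) c⁻¹) x
    rw [h1, h3] at h
    rw [pow_two, mul_inv, mul_smul, h, smul_smul, inv_mul_cancel₀ hc.ne', one_smul]
  rw [laplacian_eq_sum_fderiv, laplacian_eq_sum_fderiv, h2, Finset.smul_sum]
  rfl

variable [MeasurableSpace E] [BorelSpace E]

/-- The Laplacian of a function homogeneous of degree zero is orthogonal to radial functions. -/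
theorem integral_radial_smul_laplacian {H : E → ℂ} (hs : ContDiffOn ℝ ∞ H {0}ᶜ)
    (hH : ∀ c : ℝ, 0 < c → ∀ x, H (c • x) = H x) {β : ℝ → ℝ} (hβ : ContDiff ℝ ∞ β)
    (hcpt : HasCompactSupport fun x : E => β (‖x‖ ^ 2))
    (h0 : (0 : E) ∉ tsupport fun x : E => β (‖x‖ ^ 2)) :
    ∫ x : E, β (‖x‖ ^ 2) • Laplacian.laplacian H x = 0 := by
  set χ : E → ℝ := fun x => β (‖x‖ ^ 2) with hχ
  have hopen : IsOpen ({0}ᶜ : Set E) := isOpen_compl_singleton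
  have hχs : ContDiff ℝ ∞ χ := hβ.comp (contDiff_norm_sq ℝ)
  have hs1 : ContDiffOn ℝ ∞ (fderiv ℝ H) {0}ᶜ := hs.fderiv_of_isOpen hopen (by simp)
  have hs2 : ContDiffOn ℝ ∞ (fderiv ℝ (fderiv ℝ H)) {0}ᶜ := hs1.fderiv_of_isOpen hopen (by simp)
  have hne : ∀ x ∈ tsupport χ, x ∈ ({0}ᶜ : Set E) := fun x hx h => h0 (by
    have h' : x = 0 := h
    exact h' ▸ hx)
  set b := stdOrthonormalBasis ℝ E
  have hint : ∀ {ξ : E → ℝ}, Continuous ξ → tsupport ξ ⊆ tsupport χ → ∀ {f : E → ℂ},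
      ContinuousOn f {0}ᶜ → Integrable fun x => ξ x • f x := fun {ξ} hξ hsub {f} hf =>
    (continuous_smul_of_continuousOn_compl_zero hξ (fun h => h0 (hsub h))
      hf).integrable_of_hasCompactSupport
      (HasCompactSupport.smul_right (f := ξ)
        (hcpt.of_isClosed_subset (isClosed_tsupport ξ) hsub))
  have hD : ∀ v x, fderiv ℝ χ x v = deriv β (‖x‖ ^ 2) * (2 * inner ℝ x v) := by
    intro v x
    have h1 : HasFDerivAt (fun x : E => ‖x‖ ^ 2) _ x :=
      (hasStrictFDerivAt_norm_sq x).hasFDerivAt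
    have h2 : HasDerivAt β (deriv β (‖x‖ ^ 2)) (‖x‖ ^ 2) :=
      (hβ.differentiable (by simp) _).hasDerivAt
    have h3 : HasFDerivAt χ _ x := h2.comp_hasFDerivAt x h1
    rw [h3.fderiv]
    simp
  have hg : ∀ v, ∀ x ∈ ({0}ᶜ : Set E),
      HasFDerivAt (fun y => fderiv ℝ H y v) ((fderiv ℝ (fderiv ℝ H) x).flip v) x := by
    intro v x hx
    have h := ((hs1.contDiffAt (hopen.mem_nhds hx)).differentiableAt (by simp)).hasFDerivAt
    exact (h.clm_apply (hasFDerivAt_const v x)).congr_fderiv (by ext; simp)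
  have hc1 : ∀ v, ContinuousOn (fun y => fderiv ℝ H y v) {0}ᶜ := fun v =>
    hs1.continuousOn.clm_apply continuousOn_const
  have hc2 : ∀ v, ContinuousOn (fun y => fderiv ℝ (fderiv ℝ H) y v v) {0}ᶜ := fun v =>
    (hs2.continuousOn.clm_apply continuousOn_const).clm_apply continuousOn_const
  have hχ0 : χ 0 = 0 := image_eq_zero_of_notMem_tsupport h0
  have hparts : ∀ v, ∫ x, χ x • fderiv ℝ (fderiv ℝ H) x v v
      = -∫ x, fderiv ℝ χ x v • fderiv ℝ H x v := by
    intro v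
    have hc3 : Continuous fun x => fderiv ℝ χ x v :=
      (hχs.continuous_fderiv (by simp)).clm_apply continuous_const
    have hχc := hχs.continuous
    exact integral_bilinear_hasLineDerivAt_right_eq_neg_left_of_integrable
      (B := ContinuousLinearMap.lsmul ℝ ℝ) (f := χ) (f' := fun x => fderiv ℝ χ x v)
      (g := fun x => fderiv ℝ H x v) (g' := fun x => fderiv ℝ (fderiv ℝ H) x v v) (v := v)
      (hint hc3 (tsupport_fderiv_apply_subset ℝ v) (hc1 v)) (hint hχc subset_rfl (hc2 v))
      (hint hχc subset_rfl (hc1 v))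
      (fun x _ => ((hχs.differentiable (by simp) x).hasFDerivAt).hasLineDerivAt v)
      (fun x hx => by simpa using (hg v x (hne x hx)).hasLineDerivAt v)
  -- The gradient of a radial function is radial, and by Euler's relation the radial derivative of
  -- `H` is zero. The integrand left by integration by parts vanishes identically.
  have hsum : ∀ x, ∑ i, fderiv ℝ χ x (b i) • fderiv ℝ H x (b i) = 0 := by
    intro x
    rcases eq_or_ne x 0 with rfl | hx
    · simp [hD]
    · have h1 : ∑ i, fderiv ℝ χ x (b i) • fderiv ℝ H x (b i)
          = (deriv β (‖x‖ ^ 2) * 2) • fderiv ℝ H x (∑ i, inner ℝ (b i) x • b i) := by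
        rw [map_sum, Finset.smul_sum]
        refine Finset.sum_congr rfl fun i _ => ?_
        rw [hD, map_smul, smul_smul, real_inner_comm, mul_assoc]
      rw [h1, b.sum_repr', fderiv_self_eq_zero_of_homogeneous hH
        ((hs.contDiffAt (hopen.mem_nhds hx)).differentiableAt (by simp)), smul_zero]
  have hc3 : ∀ v, Continuous fun x => fderiv ℝ χ x v := fun v =>
      (hχs.continuous_fderiv (by simp)).clm_apply continuous_const
  simp only [laplacian_eq_sum_fderiv, Finset.smul_sum]
  rw [integral_finsetSum _ fun i _ => hint hχs.continuous subset_rfl (hc2 (b i))]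
  simp only [hparts, b]
  rw [Finset.sum_neg_distrib, ← integral_finsetSum _ fun i _ =>
    hint (hc3 (b i)) (tsupport_fderiv_apply_subset ℝ (b i)) (hc1 (b i))]
  simp only [hsum, integral_zero, neg_zero]

/-- Integration in polar coordinates of a product. -/
theorem integral_polar_mul [Nontrivial E] (a : ℝ → ℂ) (L : Metric.sphere (0 : E) 1 → ℂ)
    {f : E → ℂ} (hf : ∀ (Ω : Metric.sphere (0 : E) 1) (r : ℝ), 0 < r →
      f (r • (Ω : E)) = L Ω * a r) :
    ∫ x, f x = (∫ Ω, L Ω ∂(volume : Measure E).toSphere)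
      * ∫ r : Ioi (0 : ℝ), a r ∂(Measure.volumeIoiPow (Module.finrank ℝ E - 1)) := by
  calc ∫ x, f x = ∫ x : ({(0)}ᶜ : Set E), f x.1 ∂((volume : Measure E).comap (↑)) := by
        rw [integral_subtype_comap (measurableSet_singleton _).compl fun x => f x,
          restrict_compl_singleton]
    _ = ∫ z : Metric.sphere (0 : E) 1 × Ioi (0 : ℝ), L z.1 * a z.2
          ∂(volume : Measure E).toSphere.prod
            (Measure.volumeIoiPow (Module.finrank ℝ E - 1)) := by
        rw [← (volume : Measure E).measurePreserving_homeomorphUnitSphereProd.integral_comp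
          (Homeomorph.measurableEmbedding _)]
        refine integral_congr_ae (Filter.Eventually.of_forall fun x => ?_)
        have hx : 0 < ‖(x : E)‖ := norm_pos_iff.2 x.2
        have := hf (homeomorphUnitSphereProd E x).1 ‖(x : E)‖ hx
        simp only [homeomorphUnitSphereProd_apply_fst_coe] at this
        rw [smul_smul, mul_inv_cancel₀ hx.ne', one_smul] at this
        simpa using this
    _ = _ := integral_prod_mul (L := ℂ) L fun r : Ioi (0 : ℝ) => a r

/-- Integration by parts is done in the ambient space: against a radial bump supported near the
sphere the Laplacian integrates to zero. In polar coordinates that integral is the sphere integral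
times a nonzero radial factor. -/
theorem integral_sphere_laplacian_eq_zero [Nontrivial E] {H : E → ℂ}
    (hs : ContDiffOn ℝ ∞ H {0}ᶜ) (hH : ∀ c : ℝ, 0 < c → ∀ x, H (c • x) = H x) :
    ∫ Ω : Metric.sphere (0 : E) 1, Laplacian.laplacian H (Ω : E)
      ∂(volume : Measure E).toSphere = 0 := by
  let B : ContDiffBump (1 : ℝ) := ⟨1 / 4, 1 / 2, by norm_num, by norm_num⟩
  have hsub : tsupport (fun x : E => B (‖x‖ ^ 2)) ⊆ {x | |‖x‖ ^ 2 - 1| ≤ 1 / 2} := by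
    refine closure_minimal (fun x hx => ?_) (isClosed_le (by fun_prop) continuous_const)
    have : ‖x‖ ^ 2 ∈ Function.support B := hx
    rw [B.support_eq, Metric.mem_ball, Real.dist_eq] at this
    exact this.le
  have hcpt : HasCompactSupport fun x : E => B (‖x‖ ^ 2) := by
    refine (isCompact_closedBall (0 : E) 2).of_isClosed_subset (isClosed_tsupport _)
      (hsub.trans fun x hx => ?_)
    rw [mem_closedBall_zero_iff]
    have := (abs_le.1 (mem_ofPred_eq ▸ hx)).2
    nlinarith [norm_nonneg x]
  have h0 : (0 : E) ∉ tsupport fun x : E => B (‖x‖ ^ 2) := fun h => by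
    have := hsub h
    norm_num at this
  have key := integral_radial_smul_laplacian hs hH B.contDiff hcpt h0
  have hn : ∀ (Ω : Metric.sphere (0 : E) 1) (r : ℝ), 0 < r → ‖r • (Ω : E)‖ = r := by
    intro Ω r hr
    rw [norm_smul, Real.norm_of_nonneg hr.le, norm_eq_of_mem_sphere, mul_one]
  rw [integral_polar_mul (fun r => ((B (r ^ 2) * (r ^ 2)⁻¹ : ℝ) : ℂ))
    (fun Ω => Laplacian.laplacian H (Ω : E))] at key
  swap
  · intro Ω r hr
    rw [hn Ω r hr, laplacian_smul_of_homogeneous hH hr, Complex.real_smul, Complex.real_smul]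
    push_cast
    ring
  -- Shows the radial factor nonzero without evaluating it: the function with the same radial
  -- profile and constant angular part has positive integral, and the same polar formula has this
  -- factor on its right side.
  have hpos : 0 < ∫ x : E, B (‖x‖ ^ 2) • (‖x‖ ^ 2)⁻¹ := by
    have hc : Continuous fun x : E => B (‖x‖ ^ 2) • (‖x‖ ^ 2)⁻¹ :=
      continuous_smul_of_continuousOn_compl_zero (χ := fun x : E => B (‖x‖ ^ 2))
        (B.continuous.comp (by fun_prop)) h0
        ((continuous_norm.pow 2).continuousOn.inv₀ fun x hx => by
          have : 0 < ‖x‖ := norm_pos_iff.2 hx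
          exact pow_ne_zero 2 this.ne')
    obtain ⟨x, hx⟩ := exists_norm_eq E zero_le_one
    refine hc.integral_pos_of_hasCompactSupport_nonneg_nonzero
      (HasCompactSupport.smul_right (f := fun x : E => B (‖x‖ ^ 2)) hcpt)
      (fun x => smul_nonneg B.nonneg (by positivity)) (x := x) ?_
    rw [hx, one_pow, B.one_of_mem_closedBall (Metric.mem_closedBall_self (by norm_num [B]))]
    norm_num
  have hpos' : (∫ x : E, ((B (‖x‖ ^ 2) • (‖x‖ ^ 2)⁻¹ : ℝ) : ℂ)) ≠ 0 := by
    rw [integral_complex_ofReal]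
    exact_mod_cast hpos.ne'
  rw [integral_polar_mul (fun r => ((B (r ^ 2) * (r ^ 2)⁻¹ : ℝ) : ℂ)) (fun _ => 1)] at hpos'
  swap
  · intro Ω r hr
    rw [hn Ω r hr, one_mul, smul_eq_mul]
  exact (mul_eq_zero.1 key).resolve_right (right_ne_zero_of_mul hpos')

end Homogeneous

/-! ### Families of functions on the strip and their averages over the sphere -/

/-- The parameter set of families of functions on the strip. -/
def familyDomain (d : ℕ) : Set ((ℝ × ℝ) × Space d) := strip ×ˢ Metric.closedBall 0 1

/-- The angular parameter ranges over the closed ball, not the sphere, because a set with interior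
has unique derivatives and ordinary calculus within a set applies. -/
theorem uniqueDiffOn_familyDomain (d : ℕ) : UniqueDiffOn ℝ (familyDomain d) :=
  uniqueDiffOn_strip.prod (uniqueDiffOn_convex (convex_closedBall _ _)
    ⟨0, interior_mono Metric.ball_subset_closedBall
      (by rw [Metric.isOpen_ball.interior_eq]; exact Metric.mem_ball_self one_pos)⟩)

theorem mem_familyDomain {d : ℕ} {p : ℝ × ℝ} (hp : p ∈ strip) (Ω : Sph d) :
    (p, (Ω : Space d)) ∈ familyDomain d :=
  ⟨hp, Metric.sphere_subset_closedBall Ω.2⟩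

/-- Derivative of a family in a direction of the strip. -/
noncomputable def familyDeriv {d : ℕ} (v : ℝ × ℝ) (G : (ℝ × ℝ) × Space d → ℂ)
    (x : (ℝ × ℝ) × Space d) : ℂ :=
  fderivWithin ℝ G (familyDomain d) x (v, 0)

section Average

variable {d : ℕ} {F : Type} [NormedAddCommGroup F] {G : (ℝ × ℝ) × Space d → F}

theorem continuous_family_section (hG : ContinuousOn G (familyDomain d)) {p : ℝ × ℝ}
    (hp : p ∈ strip) : Continuous fun Ω : Sph d => G (p, (Ω : Space d)) :=
  hG.comp_continuous (by fun_prop) fun Ω => mem_familyDomain hp Ω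

theorem integrable_family_section (hG : ContinuousOn G (familyDomain d)) {p : ℝ × ℝ}
    (hp : p ∈ strip) : Integrable (fun Ω : Sph d => G (p, (Ω : Space d))) (sphereMeasure d) :=
  (continuous_family_section hG hp).integrable_of_hasCompactSupport
    (HasCompactSupport.of_compactSpace _)

variable [NormedSpace ℝ F]

theorem hasFDerivWithinAt_family (hG : ContDiffOn ℝ ∞ G (familyDomain d)) {p : ℝ × ℝ}
    (hp : p ∈ strip) (Ω : Sph d) :
    HasFDerivWithinAt (fun q => G (q, (Ω : Space d)))
      ((fderivWithin ℝ G (familyDomain d) (p, (Ω : Space d))).comp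
        (ContinuousLinearMap.inl ℝ (ℝ × ℝ) (Space d))) strip p := by
  have h1 := ((hG.differentiableOn (by simp)) _ (mem_familyDomain hp Ω)).hasFDerivWithinAt
  have h2 : HasFDerivWithinAt (fun q : ℝ × ℝ => (q, (Ω : Space d)))
      (ContinuousLinearMap.inl ℝ (ℝ × ℝ) (Space d)) strip p :=
    ((hasFDerivAt_prodMk_left p (Ω : Space d))).hasFDerivWithinAt
  exact h1.comp p h2 fun q hq => mem_familyDomain hq Ω

theorem contDiffOn_familyFDeriv (hG : ContDiffOn ℝ ∞ G (familyDomain d)) :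
    ContDiffOn ℝ ∞ (fun x => (fderivWithin ℝ G (familyDomain d) x).comp
        (ContinuousLinearMap.inl ℝ (ℝ × ℝ) (Space d))) (familyDomain d) :=
  (hG.fderivWithin (uniqueDiffOn_familyDomain d) (m := ∞) (by simp)).clm_comp contDiffOn_const

variable [CompleteSpace F]

theorem hasFDerivWithinAt_average (hG : ContDiffOn ℝ ∞ G (familyDomain d)) {p : ℝ × ℝ}
    (hp : p ∈ strip) :
    HasFDerivWithinAt (fun q => ∫ Ω : Sph d, G (q, (Ω : Space d)) ∂sphereMeasure d)
      (∫ Ω : Sph d, (fderivWithin ℝ G (familyDomain d) (p, (Ω : Space d))).comp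
        (ContinuousLinearMap.inl ℝ (ℝ × ℝ) (Space d)) ∂sphereMeasure d) strip p := by
  have h := hasFDerivWithinAt_setIntegral (μ := sphereMeasure d) convex_strip
    (isCompact_univ (X := Sph d)) (G := fun q Ω => G (q, (Ω : Space d)))
    (G' := fun q Ω => (fderivWithin ℝ G (familyDomain d) (q, (Ω : Space d))).comp
        (ContinuousLinearMap.inl ℝ (ℝ × ℝ) (Space d)))
    (fun q hq => (continuous_family_section hG.continuousOn hq).continuousOn)
    ((contDiffOn_familyFDeriv hG).continuousOn.comp
      (f := fun x : (ℝ × ℝ) × Sph d => (x.1, (x.2 : Space d))) (by fun_prop)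
      fun x hx => mem_familyDomain hx.1 x.2)
    (fun q hq Ω _ => hasFDerivWithinAt_family hG hq Ω) hp
  simpa using h

end Average

/-- Induction by differentiating under the integral. The target space is generalised because the
derivative family takes values in a space of linear maps. -/
theorem contDiffOn_average_nat {d : ℕ} (n : ℕ) {F : Type} [NormedAddCommGroup F]
    [NormedSpace ℝ F] [CompleteSpace F] {G : (ℝ × ℝ) × Space d → F}
    (hG : ContDiffOn ℝ ∞ G (familyDomain d)) :
    ContDiffOn ℝ n (fun q => ∫ Ω : Sph d, G (q, (Ω : Space d)) ∂sphereMeasure d) strip := by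
  induction n generalizing F with
  | zero =>
    exact contDiffOn_zero.2 fun p hp => (hasFDerivWithinAt_average hG hp).continuousWithinAt
  | succ n ih =>
    rw [Nat.cast_succ, contDiffOn_succ_iff_hasFDerivWithinAt_of_uniqueDiffOn uniqueDiffOn_strip]
    exact ⟨by simp, _, ih (contDiffOn_familyFDeriv hG),
      fun p hp => hasFDerivWithinAt_average hG hp⟩

section Complex

variable {d : ℕ} {G : (ℝ × ℝ) × Space d → ℂ}

/-- The average of a family over the sphere. -/
noncomputable def average (G : (ℝ × ℝ) × Space d → ℂ) (p : ℝ × ℝ) : ℂ :=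
  ∫ Ω : Sph d, G (p, (Ω : Space d)) ∂sphereMeasure d

theorem smoothOnStrip_average (hG : ContDiffOn ℝ ∞ G (familyDomain d)) :
    SmoothOnStrip (average G) :=
  contDiffOn_infty.2 fun n => contDiffOn_average_nat n hG

theorem smoothOnStrip_section (hG : ContDiffOn ℝ ∞ G (familyDomain d)) (Ω : Sph d) :
    SmoothOnStrip fun p => G (p, (Ω : Space d)) :=
  hG.comp (by fun_prop) fun _ hp => mem_familyDomain hp Ω

theorem contDiffOn_familyDeriv (hG : ContDiffOn ℝ ∞ G (familyDomain d)) (v : ℝ × ℝ) :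
    ContDiffOn ℝ ∞ (familyDeriv v G) (familyDomain d) :=
  (hG.fderivWithin (uniqueDiffOn_familyDomain d) (m := ∞) (by simp)).clm_apply contDiffOn_const

theorem stripDeriv_section (hG : ContDiffOn ℝ ∞ G (familyDomain d)) (v : ℝ × ℝ) {p : ℝ × ℝ}
    (hp : p ∈ strip) (Ω : Sph d) :
    stripDeriv v (fun q => G (q, (Ω : Space d))) p = familyDeriv v G (p, (Ω : Space d)) := by
  rw [stripDeriv, (hasFDerivWithinAt_family hG hp Ω).fderivWithin (uniqueDiffOn_strip p hp)]
  rfl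

theorem stripDeriv_average (hG : ContDiffOn ℝ ∞ G (familyDomain d)) (v : ℝ × ℝ) {p : ℝ × ℝ}
    (hp : p ∈ strip) : stripDeriv v (average G) p = average (familyDeriv v G) p := by
  have h := (hasFDerivWithinAt_average hG hp).fderivWithin (uniqueDiffOn_strip p hp)
  change fderivWithin ℝ (fun q => ∫ Ω : Sph d, G (q, (Ω : Space d)) ∂sphereMeasure d) strip p v = _
  rw [h, ContinuousLinearMap.integral_apply
    (integrable_family_section (contDiffOn_familyFDeriv hG).continuousOn hp)]
  rfl

theorem stripDeriv_stripDeriv_section (hG : ContDiffOn ℝ ∞ G (familyDomain d)) (v : ℝ × ℝ)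
    {p : ℝ × ℝ} (hp : p ∈ strip) (Ω : Sph d) :
    stripDeriv v (stripDeriv v fun q => G (q, (Ω : Space d))) p
      = familyDeriv v (familyDeriv v G) (p, (Ω : Space d)) := by
  rw [← stripDeriv_section (contDiffOn_familyDeriv hG v) v hp]
  exact stripDeriv_congr (fun q hq => stripDeriv_section hG v hq Ω) v hp

theorem stripDeriv_stripDeriv_average (hG : ContDiffOn ℝ ∞ G (familyDomain d)) (v : ℝ × ℝ)
    {p : ℝ × ℝ} (hp : p ∈ strip) :
    stripDeriv v (stripDeriv v (average G)) p
      = average (familyDeriv v (familyDeriv v G)) p := by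
  rw [← stripDeriv_average (contDiffOn_familyDeriv hG v) v hp]
  exact stripDeriv_congr (fun q hq => stripDeriv_average hG v hq) v hp

/-! ### The Klein-Gordon equation in terms of the rescaled field -/

theorem hasDerivAt_cos_rpow_mul {Δ : ℝ} {w w' : ℝ → ℂ} {r : ℝ} (hr : r ∈ Ioo 0 (π / 2))
    (h : HasDerivAt w (w' r) r) :
    HasDerivAt (fun s => ((Real.cos s ^ Δ : ℝ) : ℂ) * w s)
      (((Real.cos r ^ Δ : ℝ) : ℂ) * (w' r - (Δ : ℂ) * (Real.tan r : ℝ) * w r)) r := by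
  have hc : 0 < Real.cos r := cos_pos_of_mem ⟨by linarith [hr.1, Real.pi_pos], hr.2⟩
  have h1 := ((Real.hasDerivAt_cos r).rpow_const (p := Δ) (Or.inl hc.ne')).ofReal_comp
  refine (h1.fun_mul h).congr_deriv ?_
  have e : Real.cos r ^ (Δ - 1) = Real.cos r ^ Δ / Real.cos r := by
    rw [Real.rpow_sub_one hc.ne']
  have e2 : -Real.sin r * Δ * Real.cos r ^ (Δ - 1)
      = -(Real.cos r ^ Δ * (Δ * Real.tan r)) := by
    rw [e, Real.tan_eq_sin_div_cos]; ring
  rw [e2]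
  simp only [Complex.ofReal_mul, Complex.ofReal_neg]
  ring

/-- Substitution of `F = (cos ρ)^Δ w`. The mass `Δ(Δ - d)` is chosen so that all `1/cos² ρ` terms in
`w` combine with `Δ² tan² ρ` to give `-Δ²`. The angular term is carried along as an arbitrary `L`,
to be averaged away. -/
theorem radial_equation_of_section {d : ℕ} {Δ : ℝ} {Fr : ℝ → ℝ → ℂ} {w : ℝ × ℝ → ℂ} {L : ℂ}
    (hw : SmoothOnStrip w) {t ρ : ℝ} (hρ : ρ ∈ Ioo 0 (π / 2))
    (hF : ∀ τ, ∀ r ∈ Ioo 0 (π / 2), Fr τ r = ((Real.cos r ^ Δ : ℝ) : ℂ) * w (τ, r))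
    (hKG : ((Real.cos ρ ^ 2 : ℝ) : ℂ) *
      (-(iteratedDeriv 2 (fun τ : ℝ => Fr τ ρ) t) + iteratedDeriv 2 (fun r : ℝ => Fr t r) ρ
        + ((((d : ℝ) - 1) / (Real.sin ρ * Real.cos ρ) : ℝ) : ℂ) * deriv (fun r : ℝ => Fr t r) ρ
        + ((1 / Real.sin ρ ^ 2 : ℝ) : ℂ) * L)
      = ((Δ * (Δ - d) : ℝ) : ℂ) * Fr t ρ) :
    dt (dt w) (t, ρ) = dr (dr w) (t, ρ)
      + ((((d : ℝ) - 1) * (Real.cos ρ / Real.sin ρ) - (2 * Δ - d + 1) * Real.tan ρ : ℝ) : ℂ)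
        * dr w (t, ρ)
      - (Δ : ℂ) ^ 2 * w (t, ρ)
      + ((1 / Real.sin ρ ^ 2 * (Real.cos ρ ^ Δ)⁻¹ : ℝ) : ℂ) * L := by
  have hc : 0 < Real.cos ρ := cos_pos_of_mem ⟨by linarith [hρ.1, Real.pi_pos], hρ.2⟩
  have hs : 0 < Real.sin ρ := Real.sin_pos_of_pos_of_lt_pi hρ.1 (by linarith [hρ.2, Real.pi_pos])
  have hρ' := Ioo_subset_Icc_self hρ
  have hX : 0 < Real.cos ρ ^ Δ := Real.rpow_pos_of_pos hc _
  have htime : iteratedDeriv 2 (fun τ : ℝ => Fr τ ρ) t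
      = ((Real.cos ρ ^ Δ : ℝ) : ℂ) * dt (dt w) (t, ρ) := by
    have e1 : (fun τ : ℝ => Fr τ ρ) = fun τ => ((Real.cos ρ ^ Δ : ℝ) : ℂ) * w (τ, ρ) :=
      funext fun τ => hF τ ρ hρ
    have e2 : deriv (fun τ : ℝ => Fr τ ρ)
        = fun τ => ((Real.cos ρ ^ Δ : ℝ) : ℂ) * dt w (τ, ρ) := by
      rw [e1]; funext τ
      exact ((hw.hasDerivAt_time hρ').const_mul _).deriv
    rw [iteratedDeriv_succ, iteratedDeriv_one, e2]
    exact (((hw.stripDeriv (1, 0)).hasDerivAt_time hρ').const_mul _).deriv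
  have hnear : ∀ᶠ r in 𝓝 ρ, r ∈ Ioo 0 (π / 2) := Ioo_mem_nhds hρ.1 hρ.2
  have hd1 : ∀ r ∈ Ioo 0 (π / 2), HasDerivAt (fun r : ℝ => Fr t r)
      (((Real.cos r ^ Δ : ℝ) : ℂ) * (dr w (t, r) - (Δ : ℂ) * (Real.tan r : ℝ) * w (t, r))) r := by
    intro r hr
    have h := hasDerivAt_cos_rpow_mul (Δ := Δ) (w := fun r => w (t, r))
      (w' := fun r => dr w (t, r)) hr (hw.hasDerivAt_radius hr)
    refine h.congr_of_eventuallyEq ?_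
    filter_upwards [Ioo_mem_nhds hr.1 hr.2] with s hs using hF t s hs
  have hd2 : HasDerivAt (fun r => dr w (t, r) - (Δ : ℂ) * (Real.tan r : ℝ) * w (t, r))
      (dr (dr w) (t, ρ) - (Δ : ℂ) * (((1 / Real.cos ρ ^ 2 : ℝ) : ℂ) * w (t, ρ)
        + (Real.tan ρ : ℝ) * dr w (t, ρ))) ρ := by
    have h1 := (hw.stripDeriv (0, 1)).hasDerivAt_radius (t := t) hρ
    have h2 := ((Real.hasDerivAt_tan hc.ne').ofReal_comp).fun_mul
      (hw.hasDerivAt_radius (t := t) hρ)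
    have h3 := h1.fun_sub (h2.const_mul (Δ : ℂ))
    refine h3.congr_of_eventuallyEq (Filter.Eventually.of_forall fun r => ?_)
    ring
  have hrad : iteratedDeriv 2 (fun r : ℝ => Fr t r) ρ = ((Real.cos ρ ^ Δ : ℝ) : ℂ) *
      (dr (dr w) (t, ρ) - (Δ : ℂ) * (((1 / Real.cos ρ ^ 2 : ℝ) : ℂ) * w (t, ρ)
        + (Real.tan ρ : ℝ) * dr w (t, ρ)) - (Δ : ℂ) * (Real.tan ρ : ℝ)
          * (dr w (t, ρ) - (Δ : ℂ) * (Real.tan ρ : ℝ) * w (t, ρ))) := by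
    rw [iteratedDeriv_succ, iteratedDeriv_one]
    have e1 : deriv (fun r : ℝ => Fr t r) =ᶠ[𝓝 ρ] fun r => ((Real.cos r ^ Δ : ℝ) : ℂ)
        * (dr w (t, r) - (Δ : ℂ) * (Real.tan r : ℝ) * w (t, r)) := by
      filter_upwards [hnear] with r hr using (hd1 r hr).deriv
    rw [e1.deriv_eq]
    exact (hasDerivAt_cos_rpow_mul (Δ := Δ)
      (w := fun r => dr w (t, r) - (Δ : ℂ) * (Real.tan r : ℝ) * w (t, r))
      (w' := fun _ => dr (dr w) (t, ρ) - (Δ : ℂ) * (((1 / Real.cos ρ ^ 2 : ℝ) : ℂ) * w (t, ρ)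
        + (Real.tan ρ : ℝ) * dr w (t, ρ))) hρ hd2).deriv
  rw [htime, hrad, (hd1 ρ hρ).deriv, hF t ρ hρ] at hKG
  rw [Real.tan_eq_sin_div_cos] at hKG ⊢
  have hcs : Real.cos ρ ^ 2 = 1 - Real.sin ρ ^ 2 := by
    have := Real.sin_sq_add_cos_sq ρ; linarith
  generalize dt (dt w) (t, ρ) = A at *
  generalize dr (dr w) (t, ρ) = B at *
  generalize dr w (t, ρ) = C at *
  generalize w (t, ρ) = D at *
  generalize Real.cos ρ ^ Δ = X at *
  generalize Real.cos ρ = c at *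
  generalize Real.sin ρ = s at *
  have hX' : (X : ℂ) ≠ 0 := by exact_mod_cast hX.ne'
  have hc' : (c : ℂ) ≠ 0 := by exact_mod_cast hc.ne'
  have hs' : (s : ℂ) ≠ 0 := by exact_mod_cast hs.ne'
  have hcs' : (c : ℂ) ^ 2 = 1 - (s : ℂ) ^ 2 := by exact_mod_cast hcs
  push_cast at hKG ⊢
  linear_combination (norm := skip) (-(1 / ((c : ℂ) ^ 2 * X))) * hKG
    - (C * ((d : ℂ) - 1) / (s * c) - D * (Δ : ℂ) ^ 2 / (c : ℂ) ^ 2) * hcs'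
  field_simp
  ring

/-- A Dirichlet field divided by `(cos ρ)^Δ₊`, as a smooth family of functions on the strip. -/
theorem IsDirichletField.exists_family {ν : ℝ} {F : ℝ → Space d → ℂ} (hd : 2 ≤ d)
    (h : IsDirichletField d ν F) :
    ∃ G : (ℝ × ℝ) × Space d → ℂ, ContDiffOn ℝ ∞ G (familyDomain d) ∧
      (∀ t, ∀ ρ ∈ Ico 0 (π / 2), ∀ Ω : Sph d, F t (ρ • (Ω : Space d))
        = ((Real.cos ρ ^ deltaPlus d ν : ℝ) : ℂ) * G ((t, ρ), (Ω : Space d))) ∧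
      RadialWave ((d : ℝ) - 1) (2 * deltaPlus d ν - d + 1) (deltaPlus d ν) (average G) := by
  obtain ⟨U, hU, hFU⟩ := h.dirichlet
  have hpi := Real.pi_pos
  set Δ := deltaPlus d ν with hΔ
  -- Polar coordinates: `G((t, ρ), x) = U(t, ρ x)` is smooth up to `ρ = 0` and up to `ρ = π/2`.
  have hG : ContDiffOn ℝ ∞ (fun x : (ℝ × ℝ) × Space d => U (x.1.1, x.1.2 • x.2))
      (familyDomain d) := by
    refine hU.comp (f := fun x : (ℝ × ℝ) × Space d => (x.1.1, x.1.2 • x.2))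
      (ContDiff.contDiffOn (by fun_prop)) fun x hx => ⟨mem_univ _, ?_⟩
    obtain ⟨⟨-, h1⟩, h2⟩ := hx
    rw [mem_closedBall_zero_iff] at h2 ⊢
    rw [norm_smul, Real.norm_of_nonneg h1.1]
    calc x.1.2 * ‖x.2‖ ≤ π / 2 * 1 := by gcongr; exact h1.2
      _ = π / 2 := mul_one _
  have hn : ∀ (Ω : Sph d) (r : ℝ), 0 ≤ r → ‖r • (Ω : Space d)‖ = r := by
    intro Ω r hr
    rw [norm_smul, Real.norm_of_nonneg hr, norm_eq_of_mem_sphere, mul_one]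
  have hval : ∀ t, ∀ ρ ∈ Ico 0 (π / 2), ∀ Ω : Sph d, F t (ρ • (Ω : Space d))
      = ((Real.cos ρ ^ Δ : ℝ) : ℂ) * U (t, ρ • (Ω : Space d)) := by
    intro t ρ hρ Ω
    rw [hFU t _ (by rw [hn Ω ρ hρ.1]; exact hρ.2), hn Ω ρ hρ.1]
  refine ⟨_, hG, hval, fun t ρ hρ => ?_⟩
  set G : (ℝ × ℝ) × Space d → ℂ := fun x => U (x.1.1, x.1.2 • x.2) with hGdef
  have hp : (t, ρ) ∈ strip := mem_strip.2 (Ioo_subset_Icc_self hρ)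
  set H : Space d → ℂ := fun x => F t (ρ • (‖x‖⁻¹ • x)) with hH
  have hsec : ∀ Ω : Sph d, familyDeriv (1, 0) (familyDeriv (1, 0) G) ((t, ρ), (Ω : Space d))
      = familyDeriv (0, 1) (familyDeriv (0, 1) G) ((t, ρ), (Ω : Space d))
      + ((((d : ℝ) - 1) * (Real.cos ρ / Real.sin ρ) - (2 * Δ - d + 1) * Real.tan ρ : ℝ) : ℂ)
        * familyDeriv (0, 1) G ((t, ρ), (Ω : Space d))
      - (Δ : ℂ) ^ 2 * G ((t, ρ), (Ω : Space d))
      + ((1 / Real.sin ρ ^ 2 * (Real.cos ρ ^ Δ)⁻¹ : ℝ) : ℂ)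
        * Laplacian.laplacian H (Ω : Space d) := by
    intro Ω
    have h1 := radial_equation_of_section (Fr := fun τ r => F τ (r • (Ω : Space d)))
      (smoothOnStrip_section hG Ω) hρ
      (fun τ r hr => hval τ r (Ioo_subset_Ico_self hr) Ω) (h.kleinGordon t ρ hρ Ω)
    unfold dt dr at h1
    rw [stripDeriv_stripDeriv_section hG (1, 0) hp, stripDeriv_stripDeriv_section hG (0, 1) hp,
      stripDeriv_section hG (0, 1) hp] at h1
    exact h1
  have hHs : ContDiffOn ℝ ∞ H {0}ᶜ := by
    have h1 : ContDiffOn ℝ ∞ (fun x : Space d => (t, ρ • (‖x‖⁻¹ • x))) {0}ᶜ := by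
      have h0 : ContDiffOn ℝ ∞ (fun x : Space d => ‖x‖⁻¹) {0}ᶜ := fun x hx =>
        ((contDiffAt_norm ℝ hx).inv (norm_ne_zero_iff.2 hx)).contDiffWithinAt
      exact contDiffOn_const.prodMk ((ContDiffOn.fun_smul h0 contDiffOn_fun_id).const_smul ρ)
    have hunit : ∀ x : Space d, x ≠ 0 → ‖ρ • (‖x‖⁻¹ • x)‖ = ρ := fun x hx => by
      rw [norm_smul, norm_smul, norm_inv, norm_norm, inv_mul_cancel₀ (norm_ne_zero_iff.2 hx),
        mul_one, Real.norm_of_nonneg hρ.1.le]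
    have h2 := (contDiffOn_const (c := ((Real.cos ρ ^ Δ : ℝ) : ℂ))).mul (hU.comp h1 fun x hx =>
      ⟨mem_univ _, by rw [mem_closedBall_zero_iff, hunit x hx]; exact hρ.2.le⟩)
    refine h2.congr fun x hx => ?_
    rw [hH]
    simp only
    rw [hFU t _ (by rw [hunit x hx]; exact hρ.2), hunit x hx]
    rfl
  have hHh : ∀ c : ℝ, 0 < c → ∀ x, H (c • x) = H x := by
    intro c hc x
    simp only [hH]
    have e : (c⁻¹ * ‖x‖⁻¹) • c • x = ‖x‖⁻¹ • x := by
      rw [smul_smul, mul_right_comm, inv_mul_cancel₀ hc.ne', one_mul]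
    rw [norm_smul, Real.norm_of_nonneg hc.le, mul_inv, e]
  have : Nontrivial (Fin d) := Fin.nontrivial_iff_two_le.2 hd
  have hzero := integral_sphere_laplacian_eq_zero hHs hHh
  have hcs : Real.cos ρ ^ Δ ≠ 0 := (Real.rpow_pos_of_pos
    (cos_pos_of_mem ⟨by linarith [hρ.1], hρ.2⟩) _).ne'
  have hsn : Real.sin ρ ≠ 0 :=
    (Real.sin_pos_of_pos_of_lt_pi hρ.1 (by linarith [hρ.2])).ne'
  unfold dt dr
  rw [stripDeriv_stripDeriv_average hG (1, 0) hp, stripDeriv_stripDeriv_average hG (0, 1) hp,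
    stripDeriv_average hG (0, 1) hp]
  have i1 := integrable_family_section
    (contDiffOn_familyDeriv (contDiffOn_familyDeriv hG (1, 0)) (1, 0)).continuousOn hp
  have i2 := integrable_family_section
    (contDiffOn_familyDeriv (contDiffOn_familyDeriv hG (0, 1)) (0, 1)).continuousOn hp
  have i3 := integrable_family_section (contDiffOn_familyDeriv hG (0, 1)).continuousOn hp
  have i4 := integrable_family_section hG.continuousOn hp
  set κ : ℂ := ((1 / Real.sin ρ ^ 2 * (Real.cos ρ ^ Δ)⁻¹ : ℝ) : ℂ) with hκ
  set η : ℂ := ((((d : ℝ) - 1) * (Real.cos ρ / Real.sin ρ) - (2 * Δ - d + 1) * Real.tan ρ : ℝ) : ℂ)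
  -- Integrability of the Laplacian term is read off from the equation, in which every other term is
  -- continuous on the sphere.
  have i5 : Integrable (fun Ω : Sph d => κ * Laplacian.laplacian H (Ω : Space d))
      (sphereMeasure d) := by
    refine (((i1.sub i2).sub (i3.const_mul η)).add (i4.const_mul ((Δ : ℂ) ^ 2))).congr
      (Filter.Eventually.of_forall fun Ω => ?_)
    simp only [Pi.add_apply, Pi.sub_apply]
    rw [hsec Ω]
    ring
  have i7 : Integrable (fun Ω : Sph d => familyDeriv (0, 1) (familyDeriv (0, 1) G) ((t, ρ), ↑Ω)
      + η * familyDeriv (0, 1) G ((t, ρ), ↑Ω)) (sphereMeasure d) := i2.add (i3.const_mul η)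
  simp only [average]
  rw [← integral_const_mul, ← integral_const_mul, ← integral_add i2 (i3.const_mul η),
    ← integral_sub i7 (i4.const_mul _)]
  have i6 := integral_add (i7.sub (i4.const_mul ((Δ : ℂ) ^ 2))) i5
  have hz : ∫ Ω : Sph d, κ * Laplacian.laplacian H (Ω : Space d) ∂sphereMeasure d = 0 := by
    rw [integral_const_mul, hzero, mul_zero]
  rw [hz, add_zero] at i6
  refine Eq.trans (integral_congr_ae (Filter.Eventually.of_forall fun Ω => ?_)) i6
  exact hsec Ω

theorem IsBoundaryValue.eq_family {ν : ℝ} {F : ℝ → Space d → ℂ} {φ : ℝ → Sph d → ℂ}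
    (hφ : IsBoundaryValue d ν F φ) (hG : ContDiffOn ℝ ∞ G (familyDomain d))
    (hval : ∀ t, ∀ ρ ∈ Ico 0 (π / 2), ∀ Ω : Sph d, F t (ρ • (Ω : Space d))
        = ((Real.cos ρ ^ deltaPlus d ν : ℝ) : ℂ) * G ((t, ρ), (Ω : Space d)))
    (t : ℝ) (Ω : Sph d) : φ t Ω = G ((t, π / 2), (Ω : Space d)) := by
  have hpi := Real.pi_pos
  refine tendsto_nhds_unique (hφ t Ω) ?_
  have hc : ContinuousWithinAt (fun r => G ((t, r), (Ω : Space d))) (Icc 0 (π / 2)) (π / 2) :=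
    ((smoothOnStrip_section hG Ω).hasDerivWithinAt_radius (t := t)
      ⟨by positivity, le_rfl⟩).continuousWithinAt
  have hc2 : Tendsto (fun r => G ((t, r), (Ω : Space d))) (𝓝[<] (π / 2))
      (𝓝 (G ((t, π / 2), (Ω : Space d)))) := by
    rw [← nhdsWithin_Ioo_eq_nhdsLT (show (0 : ℝ) < π / 2 by positivity)]
    exact hc.mono Ioo_subset_Icc_self
  refine hc2.congr' ?_
  rw [EventuallyEq, ← nhdsWithin_Ioo_eq_nhdsLT (show (0 : ℝ) < π / 2 by positivity)]
  filter_upwards [self_mem_nhdsWithin] with r hr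
  have hcs : ((Real.cos r ^ deltaPlus d ν : ℝ) : ℂ) ≠ 0 := by
    exact_mod_cast (Real.rpow_pos_of_pos (cos_pos_of_mem ⟨by linarith [hr.1], hr.2⟩) _).ne'
  rw [hval t r (Ioo_subset_Ico_self hr) Ω, mul_div_cancel_left₀ _ hcs]

/-! ### Averaging the finite part -/

theorem continuous_and_integral_intervalIntegral {X : Type*} [TopologicalSpace X]
    [CompactSpace X] [T2Space X] [SecondCountableTopology X] [MeasurableSpace X] [BorelSpace X]
    {μ : Measure X} [IsFiniteMeasure μ] (a b : ℝ) {f : ℝ × X → ℂ} (hf : Continuous f) :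
    (Continuous fun x => ∫ t in a..b, f (t, x)) ∧
      ∫ x, (∫ t in a..b, f (t, x)) ∂μ = ∫ t in a..b, (∫ x, f (t, x) ∂μ) := by
  have h1 : Continuous (Function.uncurry fun (x : X) (t : ℝ) => f (t, x)) :=
    hf.comp continuous_swap
  have hcp : IsCompact (uIcc a b ×ˢ (univ : Set X)) := isCompact_uIcc.prod isCompact_univ
  have hi : Integrable (Function.uncurry fun (t : ℝ) (x : X) => f (t, x))
      ((volume.restrict (uIoc a b)).prod μ) := by
    rw [← Measure.restrict_univ (μ := μ), Measure.prod_restrict]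
    exact (integrableOn_of_continuousOn hcp hf.continuousOn).mono_set
      (prod_mono uIoc_subset_uIcc subset_rfl)
  exact ⟨intervalIntegral.continuous_parametric_intervalIntegral_of_continuous' h1 a b,
    (intervalIntegral_integral_swap hi).symm⟩

/-- Averaging commutes with time derivatives and, by Fubini, with the last integral. The condition
`b + 2m ≥ 0` makes the weight reached after `m` steps continuous; in the application `b + 2m = Δ -
1`. -/
theorem integral_finitePart_family (hG : ContDiffOn ℝ ∞ G (familyDomain d)) (m : ℕ) {b : ℝ}
    (hb : 0 ≤ b + 2 * m) :
    (Continuous fun Ω : Sph d => finitePart m b fun t => G ((t, π / 2), (Ω : Space d))) ∧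
    ∫ Ω : Sph d, finitePart m b (fun t => G ((t, π / 2), (Ω : Space d))) ∂sphereMeasure d
      = finitePart m b fun t => average G (t, π / 2) := by
  have hmem : ∀ t : ℝ, (t, π / 2) ∈ strip := fun t => mem_strip.2 ⟨by positivity, le_rfl⟩
  induction m generalizing b G with
  | zero =>
    have hb' : 0 ≤ b := by simpa using hb
    have hc : Continuous fun x : ℝ × Sph d =>
        ((Real.cos x.1 ^ b : ℝ) : ℂ) * G ((x.1, π / 2), (x.2 : Space d)) := by
      have h1 : Continuous fun x : ℝ × Sph d => G ((x.1, π / 2), (x.2 : Space d)) :=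
        hG.continuousOn.comp_continuous (by fun_prop) fun x => mem_familyDomain (hmem x.1) x.2
      have h2 : Continuous fun x : ℝ × Sph d => Real.cos x.1 ^ b :=
        (Real.continuous_rpow_const hb').comp (Real.continuous_cos.comp continuous_fst)
      exact (Complex.continuous_ofReal.comp h2).mul h1
    obtain ⟨h1, h2⟩ := continuous_and_integral_intervalIntegral (μ := sphereMeasure d)
      (-(π / 2)) (π / 2) hc
    refine ⟨h1, h2.trans ?_⟩
    simp only [average, integral_const_mul, finitePart]
  | succ m ih =>
    set c : ℂ := (((b + 2) ^ 2 : ℝ) : ℂ) with hc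
    have hG2 := contDiffOn_familyDeriv (contDiffOn_familyDeriv hG (1, 0)) (1, 0)
    have hG3 : ContDiffOn ℝ ∞ (fun x => familyDeriv (1, 0) (familyDeriv (1, 0) G) x + c * G x)
        (familyDomain d) := hG2.add (contDiffOn_const.mul hG)
    obtain ⟨ih1, ih2⟩ := ih hG3 (b := b + 2) (by push_cast at hb; linarith)
    have e1 : ∀ Ω : Sph d, (fun t => deriv (deriv fun t => G ((t, π / 2), (Ω : Space d))) t
        + c * G ((t, π / 2), (Ω : Space d))) = fun t =>
          familyDeriv (1, 0) (familyDeriv (1, 0) G) ((t, π / 2), (Ω : Space d))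
            + c * G ((t, π / 2), (Ω : Space d)) := by
      intro Ω
      funext t
      rw [(smoothOnStrip_section hG Ω).deriv_deriv_boundary t, dt,
        stripDeriv_stripDeriv_section hG (1, 0) (hmem t)]
    have e2 : (fun t => deriv (deriv fun t => average G (t, π / 2)) t
        + c * average G (t, π / 2)) = fun t =>
          average (fun x => familyDeriv (1, 0) (familyDeriv (1, 0) G) x + c * G x)
            (t, π / 2) := by
      funext t
      rw [(smoothOnStrip_average hG).deriv_deriv_boundary t, dt,
        stripDeriv_stripDeriv_average hG (1, 0) (hmem t)]
      simp only [average]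
      rw [integral_add (integrable_family_section hG2.continuousOn (hmem t))
        ((integrable_family_section hG.continuousOn (hmem t)).const_mul c), integral_const_mul]
    have f1 : (fun Ω : Sph d => finitePart (m + 1) b fun t => G ((t, π / 2), (Ω : Space d)))
        = fun Ω : Sph d => (((b + 2) * (b + 1) : ℝ) : ℂ)⁻¹ * finitePart m (b + 2) fun t =>
          familyDeriv (1, 0) (familyDeriv (1, 0) G) ((t, π / 2), (Ω : Space d))
            + c * G ((t, π / 2), (Ω : Space d)) := by
      funext Ω
      rw [← e1 Ω]
      rfl
    have f2 : finitePart (m + 1) b (fun t => average G (t, π / 2))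
        = (((b + 2) * (b + 1) : ℝ) : ℂ)⁻¹ * finitePart m (b + 2) fun t =>
          average (fun x => familyDeriv (1, 0) (familyDeriv (1, 0) G) x + c * G x)
            (t, π / 2) := by
      rw [← e2]
      rfl
    rw [f1, f2]
    exact ⟨continuous_const.mul ih1, by rw [integral_const_mul, ih2]⟩

end Complex

/-! ### Finite parts at `ε → 0⁺` -/

/-- `L` is the finite part of `g(ε)` modulo the terms `ε^{b + 1 + j}`. -/
def HasFinitePart (b : ℝ) (g : ℝ → ℂ) (L : ℂ) : Prop :=
  ∃ P : Polynomial ℂ, Tendsto (fun ε : ℝ => g ε - ((ε ^ (b + 1) : ℝ) : ℂ) * P.eval (ε : ℂ))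
    (𝓝[>] 0) (𝓝 L)

theorem tendsto_polynomial_eval (P : Polynomial ℂ) :
    Tendsto (fun ε : ℝ => P.eval (ε : ℂ)) (𝓝[>] 0) (𝓝 (P.eval 0)) := by
  have h : Continuous fun ε : ℝ => P.eval (ε : ℂ) := P.continuous.comp Complex.continuous_ofReal
  have := h.tendsto 0
  rw [Complex.ofReal_zero] at this
  exact this.mono_left nhdsWithin_le_nhds

theorem tendsto_rpow_zero {e : ℝ} (he : 0 < e) :
    Tendsto (fun ε : ℝ => ε ^ e) (𝓝[>] 0) (𝓝 0) := by
  have h := (Real.continuousAt_rpow_const 0 e (Or.inr he.le)).tendsto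
  rw [Real.zero_rpow he.ne'] at h
  exact h.mono_left nhdsWithin_le_nhds

theorem tendsto_ofReal_rpow_zero {e : ℝ} (he : 0 < e) :
    Tendsto (fun ε : ℝ => ((ε ^ e : ℝ) : ℂ)) (𝓝[>] 0) (𝓝 0) := by
  have := (Complex.continuous_ofReal.tendsto 0).comp (tendsto_rpow_zero he)
  rwa [Complex.ofReal_zero] at this

/-- Pulling out the lowest power of the polynomial leaves `ε^{e+k} Q(ε)` with `Q(0) ≠ 0`. As `e + k
≠ 0` this either blows up or tends to 0. A vanishing exponent would let a constant hide among the
counterterms. -/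
theorem eq_zero_of_tendsto_rpow_mul_polynomial {e : ℝ} (he : ∀ j : ℕ, e + j ≠ 0)
    {P : Polynomial ℂ} {c : ℂ}
    (h : Tendsto (fun ε : ℝ => ((ε ^ e : ℝ) : ℂ) * P.eval (ε : ℂ)) (𝓝[>] 0) (𝓝 c)) : c = 0 := by
  rcases eq_or_ne P 0 with rfl | hP
  · simp only [Polynomial.eval_zero, mul_zero] at h
    exact (tendsto_nhds_unique h tendsto_const_nhds)
  obtain ⟨Q, hQ, hdvd⟩ := Polynomial.exists_eq_pow_rootMultiplicity_mul_and_not_dvd P hP 0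
  set k := P.rootMultiplicity 0
  have hQ0 : Q.eval 0 ≠ 0 := fun h0 => hdvd (Polynomial.dvd_iff_isRoot.2 h0)
  have h1 : Tendsto (fun ε : ℝ => ((ε ^ (e + k) : ℝ) : ℂ) * Q.eval (ε : ℂ)) (𝓝[>] 0) (𝓝 c) := by
    refine h.congr' ?_
    filter_upwards [self_mem_nhdsWithin] with ε hε
    have hε' : 0 < ε := hε
    rw [hQ, Real.rpow_add hε', Real.rpow_natCast]
    simp
    ring
  have h2 := h1.div (tendsto_polynomial_eval Q) hQ0
  have h3 : Tendsto (fun ε : ℝ => ((ε ^ (e + k) : ℝ) : ℂ)) (𝓝[>] 0) (𝓝 (c / Q.eval 0)) := by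
    refine h2.congr' ?_
    filter_upwards [(tendsto_polynomial_eval Q).eventually_ne hQ0] with ε hε
    simp [hε]
  rcases lt_or_gt_of_ne (he k) with hlt | hgt
  · have h4 := h3.norm
    have h5 : Tendsto (fun ε : ℝ => ‖((ε ^ (e + k) : ℝ) : ℂ)‖) (𝓝[>] 0) atTop := by
      have h6 := tendsto_rpow_neg_nhdsGT_zero hlt
      refine h6.congr' ?_
      filter_upwards [self_mem_nhdsWithin] with ε hε
      rw [Complex.norm_real, Real.norm_of_nonneg (Real.rpow_nonneg (le_of_lt hε) _)]
    exact absurd h4 (not_tendsto_nhds_of_tendsto_atTop h5 _)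
  · have h4 := tendsto_nhds_unique h3 (tendsto_ofReal_rpow_zero hgt)
    exact (div_eq_zero_iff.1 h4).resolve_right hQ0

theorem HasFinitePart.unique {b : ℝ} (hb : ∀ j : ℕ, b + 1 + j ≠ 0) {g : ℝ → ℂ} {L L' : ℂ}
    (h : HasFinitePart b g L) (h' : HasFinitePart b g L') : L = L' := by
  obtain ⟨P, hP⟩ := h
  obtain ⟨Q, hQ⟩ := h'
  have := eq_zero_of_tendsto_rpow_mul_polynomial hb (P := Q - P) (c := L - L')
    ((hP.sub hQ).congr fun ε => by rw [Polynomial.eval_sub]; ring)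
  exact sub_eq_zero.1 this

theorem HasFinitePart.add {b : ℝ} {g g' : ℝ → ℂ} {L L' : ℂ}
    (h : HasFinitePart b g L) (h' : HasFinitePart b g' L') :
    HasFinitePart b (fun ε => g ε + g' ε) (L + L') := by
  obtain ⟨P, hP⟩ := h
  obtain ⟨Q, hQ⟩ := h'
  exact ⟨P + Q, (hP.add hQ).congr fun ε => by rw [Polynomial.eval_add]; ring⟩

theorem HasFinitePart.const_mul {b : ℝ} {g : ℝ → ℂ} {L : ℂ} (c : ℂ)
    (h : HasFinitePart b g L) : HasFinitePart b (fun ε => c * g ε) (c * L) := by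
  obtain ⟨P, hP⟩ := h
  exact ⟨Polynomial.C c * P, (hP.const_mul c).congr fun ε => by
    rw [Polynomial.eval_mul, Polynomial.eval_C]; ring⟩

theorem HasFinitePart.congr {b : ℝ} {g g' : ℝ → ℂ} {L : ℂ}
    (h : HasFinitePart b g L) (hg : g =ᶠ[𝓝[>] 0] g') : HasFinitePart b g' L := by
  obtain ⟨P, hP⟩ := h
  exact ⟨P, hP.congr' (by filter_upwards [hg] with ε hε; rw [hε])⟩

theorem HasFinitePart.of_tendsto {b : ℝ} {g : ℝ → ℂ} {L : ℂ}
    (h : Tendsto g (𝓝[>] 0) (𝓝 L)) : HasFinitePart b g L :=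
  ⟨0, by simpa using h⟩

theorem HasFinitePart.of_add_two {b : ℝ} {g : ℝ → ℂ} {L : ℂ}
    (h : HasFinitePart (b + 2) g L) : HasFinitePart b g L := by
  obtain ⟨P, hP⟩ := h
  refine ⟨Polynomial.X ^ 2 * P, hP.congr' ?_⟩
  filter_upwards [self_mem_nhdsWithin] with ε hε
  have hε' : 0 < ε := hε
  rw [show b + 2 + 1 = b + 1 + (2 : ℕ) by push_cast; ring, Real.rpow_add hε', Real.rpow_natCast]
  simp
  ring

/-! ### Taylor expansion -/

/-- The Taylor polynomial with `n` terms at the origin. -/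
noncomputable def taylorPoly (h : ℝ → ℂ) (n : ℕ) : Polynomial ℂ :=
  ∑ j ∈ Finset.range n, Polynomial.C (iteratedDeriv j h 0 / (j.factorial : ℂ)) * Polynomial.X ^ j

theorem taylorPoly_eval (h : ℝ → ℂ) (n : ℕ) (x : ℂ) : (taylorPoly h n).eval x
    = ∑ j ∈ Finset.range n, iteratedDeriv j h 0 / (j.factorial : ℂ) * x ^ j := by
  simp [taylorPoly, Polynomial.eval_finsetSum]

theorem exists_taylorPoly_bound {h : ℝ → ℂ} {A : ℝ} (hA : 0 < A)
    (hh : ∀ s ∈ Icc 0 A, ContDiffAt ℝ ∞ h s) (n : ℕ) :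
    ∃ C, ∀ s ∈ Icc 0 A, ‖h s - (taylorPoly h n).eval (s : ℂ)‖ ≤ C * s ^ n := by
  cases n with
  | zero =>
    obtain ⟨C, hC⟩ := isCompact_Icc.exists_bound_of_continuousOn
      (fun s hs => (hh s hs).continuousAt.continuousWithinAt)
    exact ⟨C, fun s hs => by simpa [taylorPoly] using hC s hs⟩
  | succ n =>
    have hc : ContDiffOn ℝ (n + 1) h (Icc 0 A) := fun s hs =>
      ((hh s hs).contDiffWithinAt).of_le (by exact_mod_cast le_top)
    obtain ⟨C, hC⟩ := exists_taylor_mean_remainder_bound hA.le hc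
    refine ⟨C, fun s hs => ?_⟩
    have := hC s hs
    rw [taylor_within_apply, sub_zero] at this
    rw [taylorPoly_eval]
    refine le_of_eq_of_le ?_ this
    congr 2
    refine Finset.sum_congr rfl fun j _ => ?_
    rw [iteratedDerivWithin_eq_iteratedDeriv (uniqueDiffOn_Icc hA)
      ((hh 0 (left_mem_Icc.2 hA.le)).of_le (by exact_mod_cast le_top)) (left_mem_Icc.2 hA.le),
      Complex.real_smul]
    push_cast
    ring

/-- A Taylor polynomial with `n > -(b + 1)` terms leaves a remainder of order `ε^{b+1+n} → 0`.
Boundary terms of integrations by parts therefore do not contribute to finite parts. -/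
theorem hasFinitePart_rpow_mul {b : ℝ} {k : ℝ → ℂ} {A : ℝ} (hA : 0 < A)
    (hk : ∀ s ∈ Icc 0 A, ContDiffAt ℝ ∞ k s) :
    HasFinitePart b (fun ε => ((ε ^ (b + 1) : ℝ) : ℂ) * k ε) 0 := by
  obtain ⟨n, hn⟩ := exists_nat_gt (-(b + 1))
  obtain ⟨C, hC⟩ := exists_taylorPoly_bound hA hk n
  refine ⟨taylorPoly k n, ?_⟩
  refine squeeze_zero_norm' (a := fun ε : ℝ => C * ε ^ (b + 1 + n)) ?_ ?_
  · filter_upwards [Ioo_mem_nhdsGT hA] with ε hε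
    rw [← mul_sub, norm_mul, Complex.norm_real,
      Real.norm_of_nonneg (Real.rpow_nonneg hε.1.le _), Real.rpow_add hε.1 (b + 1),
      Real.rpow_natCast]
    calc ε ^ (b + 1) * ‖k ε - (taylorPoly k n).eval (ε : ℂ)‖ ≤ ε ^ (b + 1) * (C * ε ^ n) := by
          gcongr
          · exact Real.rpow_nonneg hε.1.le _
          · exact hC ε ⟨hε.1.le, hε.2.le⟩
      _ = _ := by ring
  · simpa using (tendsto_rpow_zero (e := b + 1 + n) (by linarith)).const_mul C

theorem tendsto_integral_lower {R : ℝ → ℂ} {A : ℝ} (hA : 0 < A)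
    (hR : IntervalIntegrable R volume 0 A) :
    Tendsto (fun ε => ∫ s in ε..A, R s) (𝓝[>] 0) (𝓝 (∫ s in (0 : ℝ)..A, R s)) := by
  have h1 : IntegrableOn R (uIcc 0 A) := by
    rw [uIcc_of_le hA.le, integrableOn_Icc_iff_integrableOn_Ioc]
    exact (intervalIntegrable_iff_integrableOn_Ioc_of_le hA.le).1 hR
  have h2 := intervalIntegral.continuousOn_primitive_interval_left h1 0 left_mem_uIcc
  rw [uIcc_of_le hA.le] at h2
  have h3 : Tendsto (fun ε => ∫ s in ε..A, R s) (𝓝[Ioo 0 A] 0) (𝓝 (∫ s in (0 : ℝ)..A, R s)) :=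
    h2.mono Ioo_subset_Icc_self
  rwa [nhdsWithin_Ioo_eq_nhdsGT hA] at h3

/-- Existence of the limit of the regularised integral at one end point. -/
theorem exists_tendsto_regularized {h : ℝ → ℂ} {A b : ℝ} (hA : 0 < A)
    (hh : ∀ s ∈ Icc 0 A, ContDiffAt ℝ ∞ h s) {n : ℕ} (hn : 0 < b + 1 + n)
    (hb : ∀ j < n, b + 1 + (j : ℝ) ≠ 0) :
    ∃ L : ℂ, Tendsto (fun ε : ℝ => (∑ j ∈ Finset.range n,
      iteratedDeriv j h 0 / (j.factorial : ℂ) * ((ε ^ (b + 1 + j) / (b + 1 + j) : ℝ) : ℂ))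
      + ∫ s in ε..A, h s * ((s ^ b : ℝ) : ℂ)) (𝓝[>] 0) (𝓝 L) := by
  obtain ⟨C, hC⟩ := exists_taylorPoly_bound hA hh n
  -- After removing `n` Taylor terms the integrand is `O(s^{b+n})`, integrable at 0 because `b + n >
  -- -1`.
  set R : ℝ → ℂ := fun s => (h s - (taylorPoly h n).eval (s : ℂ)) * ((s ^ b : ℝ) : ℂ) with hRdef
  have hcont : ContinuousOn h (Icc 0 A) := fun s hs => (hh s hs).continuousAt.continuousWithinAt
  have hpow : ContinuousOn (fun s : ℝ => ((s ^ b : ℝ) : ℂ)) (Ioi 0) := fun s hs =>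
    (Complex.continuous_ofReal.continuousAt.comp
      (Real.continuousAt_rpow_const s b (Or.inl (ne_of_gt hs)))).continuousWithinAt
  have hpoly : Continuous fun s : ℝ => (taylorPoly h n).eval (s : ℂ) :=
    (taylorPoly h n).continuous.comp Complex.continuous_ofReal
  have hRint : IntervalIntegrable R volume 0 A := by
    have h1 : IntervalIntegrable (fun s : ℝ => C * s ^ (b + n)) volume 0 A :=
      (intervalIntegral.intervalIntegrable_rpow' (by linarith)).const_mul C
    rw [intervalIntegrable_iff_integrableOn_Ioc_of_le hA.le] at h1 ⊢
    refine h1.mono' ?_ ?_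
    · refine ContinuousOn.aestronglyMeasurable ?_ measurableSet_Ioc
      exact ((hcont.mono Ioc_subset_Icc_self).sub hpoly.continuousOn).mul
        (hpow.mono fun s hs => hs.1)
    · refine (ae_restrict_iff' measurableSet_Ioc).2 (Filter.Eventually.of_forall fun s hs => ?_)
      rw [hRdef, norm_mul, Complex.norm_real, Real.norm_of_nonneg (Real.rpow_nonneg hs.1.le _),
        add_comm b, Real.rpow_add hs.1, Real.rpow_natCast, ← mul_assoc]
      exact mul_le_mul_of_nonneg_right (hC s ⟨hs.1.le, hs.2⟩) (Real.rpow_nonneg hs.1.le _)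
  set c : ℕ → ℂ := fun j => iteratedDeriv j h 0 / (j.factorial : ℂ) with hc
  -- The counterterms cancel the lower-limit values of the integrated Taylor terms; the upper-limit
  -- values at `A` stay in the limit.
  refine ⟨(∑ j ∈ Finset.range n, c j * ((A ^ (b + 1 + j) / (b + 1 + j) : ℝ) : ℂ))
    + ∫ s in (0 : ℝ)..A, R s, ?_⟩
  refine (tendsto_const_nhds.add (tendsto_integral_lower hA hRint)).congr' ?_
  filter_upwards [Ioo_mem_nhdsGT hA] with ε hε
  have hsub : uIcc ε A ⊆ Ioi 0 := by
    rw [uIcc_of_le hε.2.le]; exact fun s hs => hε.1.trans_le hs.1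
  have hcts : ∀ j ∈ Finset.range n, ContinuousOn
      (fun s : ℝ => c j * ((s ^ (b + j) : ℝ) : ℂ)) (uIcc ε A) := by
    intro j _
    refine continuousOn_const.mul fun s hs => ?_
    exact (Complex.continuous_ofReal.continuousAt.comp
      (Real.continuousAt_rpow_const s _ (Or.inl (ne_of_gt (hsub hs))))).continuousWithinAt
  have hterm : ∀ j ∈ Finset.range n, IntervalIntegrable
      (fun s : ℝ => c j * ((s ^ (b + j) : ℝ) : ℂ)) volume ε A := fun j hj =>
    (hcts j hj).intervalIntegrable
  have hsumi : IntervalIntegrable (fun s : ℝ => ∑ j ∈ Finset.range n,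
      c j * ((s ^ (b + j) : ℝ) : ℂ)) volume ε A :=
    (continuousOn_finsetSum _ hcts).intervalIntegrable
  have hRi : IntervalIntegrable R volume ε A := hRint.mono_set
    (by rw [uIcc_of_le hε.2.le, uIcc_of_le hA.le]; exact Icc_subset_Icc_left hε.1.le)
  have hsplit : ∫ s in ε..A, h s * ((s ^ b : ℝ) : ℂ) = (∫ s in ε..A, R s)
      + ∑ j ∈ Finset.range n, ∫ s in ε..A, c j * ((s ^ (b + j) : ℝ) : ℂ) := by
    rw [← intervalIntegral.integral_finsetSum hterm, ← intervalIntegral.integral_add hRi hsumi]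
    refine intervalIntegral.integral_congr fun s hs => ?_
    have hs0 : 0 < s := hsub hs
    simp only [hRdef, taylorPoly_eval]
    have : ∀ j ∈ Finset.range n, c j * ((s ^ (b + j) : ℝ) : ℂ)
        = c j * (s : ℂ) ^ j * ((s ^ b : ℝ) : ℂ) := fun j _ => by
      rw [Real.rpow_add hs0, Real.rpow_natCast]; push_cast; ring
    rw [Finset.sum_congr rfl this, ← Finset.sum_mul]
    ring
  have hint : ∀ j ∈ Finset.range n, ∫ s in ε..A, c j * ((s ^ (b + j) : ℝ) : ℂ)
      = c j * ((A ^ (b + 1 + j) / (b + 1 + j) : ℝ) : ℂ)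
        - c j * ((ε ^ (b + 1 + j) / (b + 1 + j) : ℝ) : ℂ) := by
    intro j hj
    have hne := hb j (Finset.mem_range.1 hj)
    rw [intervalIntegral.integral_const_mul, intervalIntegral.integral_ofReal,
      integral_rpow (Or.inr ⟨fun h => hne (by linarith), fun h0 => lt_irrefl (0 : ℝ) (hsub h0)⟩),
      show b + j + 1 = b + 1 + j by ring]
    push_cast
    ring
  rw [hsplit, Finset.sum_congr rfl hint, Finset.sum_sub_distrib]
  ring

/-! ### The regularised integral converges to the finite part -/

theorem contDiff_sinc : ContDiff ℝ ∞ Real.sinc := by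
  refine contDiff_iff_contDiffAt.2 fun x => ?_
  rcases eq_or_ne x 0 with rfl | hx
  · obtain ⟨p, hp⟩ := (Real.analyticAt_sin (x := 0))
    rw [Real.sinc_eq_dslope]
    exact hp.has_fpower_series_dslope_fslope.analyticAt.contDiffAt
  · have h1 : ContDiffAt ℝ ∞ (fun y => Real.sin y / y) x :=
      Real.contDiff_sin.contDiffAt.div contDiffAt_id hx
    refine h1.congr_of_eventuallyEq ?_
    filter_upwards [isOpen_ne.mem_nhds hx] with y hy using Real.sinc_of_ne_zero hy

theorem sinc_pos_of_abs_lt_pi {x : ℝ} (hx : |x| < π) : 0 < Real.sinc x := by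
  have h : ∀ y, 0 < y → y < π → 0 < Real.sinc y := fun y h0 h1 => by
    rw [Real.sinc_of_ne_zero h0.ne']
    exact div_pos (Real.sin_pos_of_pos_of_lt_pi h0 h1) h0
  rcases lt_trichotomy x 0 with h0 | rfl | h0
  · rw [← Real.sinc_neg]
    exact h _ (by linarith) (by rwa [abs_of_neg h0] at hx)
  · simp
  · exact h _ h0 (by rwa [abs_of_pos h0] at hx)

theorem contDiffAt_sinc_rpow (b : ℝ) {x : ℝ} (hx : |x| < π) :
    ContDiffAt ℝ ∞ (fun s => Real.sinc s ^ b) x :=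
  contDiff_sinc.contDiffAt.rpow_const_of_ne (sinc_pos_of_abs_lt_pi hx).ne'

theorem contDiffAt_mul_sinc_rpow (b : ℝ) {x : ℝ} (hx : |x| < π) {f : ℝ → ℂ}
    (hf : ContDiffAt ℝ ∞ f x) :
    ContDiffAt ℝ ∞ (fun s => f s * ((Real.sinc s ^ b : ℝ) : ℂ)) x :=
  hf.mul (Complex.ofRealCLM.contDiff.contDiffAt.comp x (contDiffAt_sinc_rpow b hx))

theorem abs_lt_pi_of_mem {s : ℝ} (hs : s ∈ Icc 0 (π / 2)) : |s| < π := by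
  rw [abs_of_nonneg hs.1]; linarith [hs.2, Real.pi_pos]

theorem sin_rpow_eq (b : ℝ) {s : ℝ} (h0 : 0 < s) (h1 : s < π) :
    Real.sin s ^ b = Real.sinc s ^ b * s ^ b := by
  rw [← Real.mul_rpow (sinc_pos_of_abs_lt_pi (by rwa [abs_of_pos h0])).le h0.le,
    Real.sinc_of_ne_zero h0.ne', div_mul_cancel₀ _ h0.ne']

/-- The integral with both end points cut off. -/
noncomputable def cutoffIntegral (b : ℝ) (f : ℝ → ℂ) (ε : ℝ) : ℂ :=
  ∫ t in (-(π / 2) + ε)..(π / 2 - ε), f t * ((Real.cos t ^ b : ℝ) : ℂ)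

/-- The sum of the two smooth factors at the end points. -/
noncomputable def endpointFactor (b : ℝ) (f : ℝ → ℂ) (s : ℝ) : ℂ :=
  (f (π / 2 - s) + f (s - π / 2)) * ((Real.sinc s ^ b : ℝ) : ℂ)

theorem contDiffAt_endpointFactor (b : ℝ) {f : ℝ → ℂ} (hf : ContDiff ℝ ∞ f) {s : ℝ}
    (hs : |s| < π) : ContDiffAt ℝ ∞ (endpointFactor b f) s :=
  contDiffAt_mul_sinc_rpow b hs (f := fun s => f (π / 2 - s) + f (s - π / 2))
    ((hf.comp (contDiff_const.sub contDiff_id)).add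
      (hf.comp (contDiff_id.sub contDiff_const))).contDiffAt

theorem taylorPlus_add_taylorMinus (d : ℕ) (ν : ℝ) {f : ℝ → ℂ} (hf : ContDiff ℝ ∞ f) (j : ℕ) :
    taylorPlus d ν f j + taylorMinus d ν f j
      = iteratedDeriv j (endpointFactor (-deltaMinus d ν) f) 0 / (j.factorial : ℂ) := by
  have h0 : |(0 : ℝ)| < π := by rw [abs_zero]; exact Real.pi_pos
  have h1 := contDiffAt_mul_sinc_rpow (-deltaMinus d ν) h0 (f := fun s => f (π / 2 - s))
    (hf.comp (contDiff_const.sub contDiff_id)).contDiffAt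
  have h2 := contDiffAt_mul_sinc_rpow (-deltaMinus d ν) h0 (f := fun s => f (s - π / 2))
    (hf.comp (contDiff_id.sub contDiff_const)).contDiffAt
  have e : endpointFactor (-deltaMinus d ν) f = fun s =>
      f (π / 2 - s) * ((Real.sinc s ^ (-deltaMinus d ν) : ℝ) : ℂ)
        + f (s - π / 2) * ((Real.sinc s ^ (-deltaMinus d ν) : ℝ) : ℂ) :=
    funext fun s => by rw [endpointFactor, add_mul]
  rw [e, taylorPlus, taylorMinus, ← add_div, ← iteratedDeriv_fun_add
    (h1.of_le (by exact_mod_cast le_top)) (h2.of_le (by exact_mod_cast le_top))]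

theorem continuousOn_mul_cos_rpow (b : ℝ) {f : ℝ → ℂ} (hf : Continuous f) :
    ContinuousOn (fun t => f t * ((Real.cos t ^ b : ℝ) : ℂ)) (Ioo (-(π / 2)) (π / 2)) :=
  hf.continuousOn.mul fun _ ht => (Complex.continuous_ofReal.continuousAt.comp
    (Real.continuous_cos.continuousAt.rpow_const
      (Or.inl (Real.cos_pos_of_mem_Ioo ht).ne'))).continuousWithinAt

theorem uIcc_cutoff_subset {ε : ℝ} (hε : ε ∈ Ioo 0 (π / 2)) :
    uIcc (-(π / 2) + ε) (π / 2 - ε) ⊆ Ioo (-(π / 2)) (π / 2) := by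
  rw [uIcc_of_le (by linarith [hε.2])]
  exact fun t ht => ⟨by linarith [ht.1, hε.1], by linarith [ht.2, hε.1]⟩

/-- Splitting at `t = 0` and reflecting one half expresses both halves through the distance `s` to
the end point, where `cos t = sin s`. The two ends then need only one expansion. -/
theorem cutoffIntegral_eq (b : ℝ) {f : ℝ → ℂ} (hf : Continuous f) {ε : ℝ}
    (hε : ε ∈ Ioo 0 (π / 2)) :
    cutoffIntegral b f ε
      = ∫ s in ε..(π / 2), endpointFactor b f s * ((s ^ b : ℝ) : ℂ) := by
  have hc := continuousOn_mul_cos_rpow b hf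
  have hpi := Real.pi_pos
  have m1 : -(π / 2) + ε ∈ Ioo (-(π / 2)) (π / 2) := ⟨by linarith [hε.1], by linarith [hε.2]⟩
  have m2 : π / 2 - ε ∈ Ioo (-(π / 2)) (π / 2) := ⟨by linarith [hε.2], by linarith [hε.1]⟩
  have m0 : (0 : ℝ) ∈ Ioo (-(π / 2)) (π / 2) := ⟨by linarith, by linarith⟩
  have hconv : OrdConnected (Ioo (-(π / 2)) (π / 2)) := ordConnected_Ioo
  have i1 := (hc.mono (hconv.uIcc_subset m1 m0)).intervalIntegrable (μ := volume)
  have i2 := (hc.mono (hconv.uIcc_subset m0 m2)).intervalIntegrable (μ := volume)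
  have e1 := intervalIntegral.integral_comp_sub_left (a := ε) (b := π / 2)
    (fun t => f t * ((Real.cos t ^ b : ℝ) : ℂ)) (π / 2)
  have e2 := intervalIntegral.integral_comp_sub_right (a := ε) (b := π / 2)
    (fun t => f t * ((Real.cos t ^ b : ℝ) : ℂ)) (π / 2)
  rw [sub_self] at e1 e2
  have hsub : uIcc ε (π / 2) ⊆ Ioc 0 (π / 2) := by
    rw [uIcc_of_le hε.2.le]; exact fun s hs => ⟨hε.1.trans_le hs.1, hs.2⟩
  have j1 : IntervalIntegrable (fun s => f (π / 2 - s) * ((Real.cos (π / 2 - s) ^ b : ℝ) : ℂ))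
      volume ε (π / 2) := by
    refine ContinuousOn.intervalIntegrable (hc.comp (by fun_prop) fun s hs => ?_)
    have := hsub hs
    exact ⟨by linarith [this.2], by linarith [this.1]⟩
  have j2 : IntervalIntegrable (fun s => f (s - π / 2) * ((Real.cos (s - π / 2) ^ b : ℝ) : ℂ))
      volume ε (π / 2) := by
    refine ContinuousOn.intervalIntegrable (hc.comp (by fun_prop) fun s hs => ?_)
    have := hsub hs
    exact ⟨by linarith [this.1], by linarith [this.2]⟩
  rw [cutoffIntegral, ← intervalIntegral.integral_add_adjacent_intervals i1 i2, ← e1,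
    show -(π / 2) + ε = ε - π / 2 by ring, ← e2, ← intervalIntegral.integral_add j2 j1]
  refine intervalIntegral.integral_congr fun s hs => ?_
  have hs' := hsub hs
  simp only [endpointFactor]
  rw [Real.cos_pi_div_two_sub, Real.cos_sub_pi_div_two,
    sin_rpow_eq b hs'.1 (by linarith [hs'.2])]
  push_cast
  ring

theorem regularized_eq {d n₀ : ℕ} {ν : ℝ} {f : ℝ → ℂ} (hf : ContDiff ℝ ∞ f) {ε : ℝ}
    (hε : ε ∈ Ioo 0 (π / 2)) :
    regularized d n₀ ν f ε = (∑ j ∈ Finset.range n₀,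
      iteratedDeriv j (endpointFactor (-deltaMinus d ν) f) 0 / (j.factorial : ℂ)
        * ((ε ^ (-deltaMinus d ν + 1 + j) / (-deltaMinus d ν + 1 + j) : ℝ) : ℂ))
      + ∫ s in ε..(π / 2), endpointFactor (-deltaMinus d ν) f s
        * ((s ^ (-deltaMinus d ν) : ℝ) : ℂ) := by
  rw [← cutoffIntegral_eq _ hf.continuous hε]
  simp only [regularized, taylorPlus_add_taylorMinus d ν hf]
  rfl

theorem hasDerivAt_deriv {f : ℝ → ℂ} (hf : ContDiff ℝ ∞ f) (t : ℝ) :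
    HasDerivAt f (deriv f t) t := (hf.differentiable (by simp) t).hasDerivAt

theorem contDiff_deriv {f : ℝ → ℂ} (hf : ContDiff ℝ ∞ f) : ContDiff ℝ ∞ (deriv f) :=
  (contDiff_infty_iff_deriv.1 hf).2

/-- The boundary terms of the integration by parts. -/
noncomputable def boundaryFactor (a : ℝ) (f : ℝ → ℂ) (s : ℝ) : ℂ :=
  (-(a : ℂ) * (Real.cos s : ℂ) * (f (π / 2 - s) + f (s - π / 2))
    - (Real.sin s : ℂ) * (deriv f (π / 2 - s) - deriv f (s - π / 2)))
    * ((Real.sinc s ^ (a - 1) : ℝ) : ℂ)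

theorem contDiffAt_boundaryFactor (a : ℝ) {f : ℝ → ℂ} (hf : ContDiff ℝ ∞ f) {s : ℝ}
    (hs : |s| < π) : ContDiffAt ℝ ∞ (boundaryFactor a f) s := by
  have h1 : ContDiff ℝ ∞ fun s => f (π / 2 - s) + f (s - π / 2) :=
    (hf.comp (contDiff_const.sub contDiff_id)).add (hf.comp (contDiff_id.sub contDiff_const))
  have h2 : ContDiff ℝ ∞ fun s => deriv f (π / 2 - s) - deriv f (s - π / 2) :=
    ((contDiff_deriv hf).comp (contDiff_const.sub contDiff_id)).sub
      ((contDiff_deriv hf).comp (contDiff_id.sub contDiff_const))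
  have h3 : ContDiff ℝ ∞ fun s : ℝ => (Real.cos s : ℂ) :=
    Complex.ofRealCLM.contDiff.comp Real.contDiff_cos
  have h4 : ContDiff ℝ ∞ fun s : ℝ => (Real.sin s : ℂ) :=
    Complex.ofRealCLM.contDiff.comp Real.contDiff_sin
  exact contDiffAt_mul_sinc_rpow (a - 1) hs
    (((contDiff_const.mul h3).mul h1).sub (h4.mul h2)).contDiffAt

theorem hasDerivAt_cos_rpow_ofReal {a t : ℝ} (ht : 0 < Real.cos t) :
    HasDerivAt (fun t => ((Real.cos t ^ a : ℝ) : ℂ))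
      (-((a * (Real.sin t * Real.cos t ^ (a - 1)) : ℝ) : ℂ)) t := by
  have h := ((Real.hasDerivAt_cos t).rpow_const (p := a) (Or.inl ht.ne')).ofReal_comp
  refine h.congr_deriv ?_
  rw [← Complex.ofReal_neg]
  congr 1
  ring

/-- The cut-off version of the recursion defining `finitePart`, with its boundary terms kept. These
are `ε^{b+1}` times a smooth function. -/
theorem cutoffIntegral_parts {b : ℝ} {f : ℝ → ℂ} (hf : ContDiff ℝ ∞ f) {ε : ℝ}
    (hε : ε ∈ Ioo 0 (π / 2)) :
    (((b + 2) * (b + 1) : ℝ) : ℂ) * cutoffIntegral b f ε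
      = ((ε ^ (b + 1) : ℝ) : ℂ) * boundaryFactor (b + 2) f ε
        + cutoffIntegral (b + 2)
          (fun t => deriv (deriv f) t + (((b + 2) ^ 2 : ℝ) : ℂ) * f t) ε := by
  have hpi := Real.pi_pos
  have hf1 := contDiff_deriv hf
  have hf2 := contDiff_deriv hf1
  set f₂ : ℝ → ℂ := fun t => deriv (deriv f) t + (((b + 2) ^ 2 : ℝ) : ℂ) * f t with hf₂
  have hf₂c : Continuous f₂ := hf2.continuous.add (continuous_const.mul hf.continuous)
  -- `W = (cos^{b+2})' f - cos^{b+2} f'`, whose derivative is the difference of the two integrands.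
  set W : ℝ → ℂ := fun t => (-((((b + 2) * (Real.sin t * Real.cos t ^ (b + 1)) : ℝ)) : ℂ)) * f t
    - ((Real.cos t ^ (b + 2) : ℝ) : ℂ) * deriv f t with hW
  have hsub := uIcc_cutoff_subset hε
  have hderiv : ∀ t ∈ uIcc (-(π / 2) + ε) (π / 2 - ε), HasDerivAt W
      ((((b + 2) * (b + 1) : ℝ) : ℂ) * (f t * ((Real.cos t ^ b : ℝ) : ℂ))
        - f₂ t * ((Real.cos t ^ (b + 2) : ℝ) : ℂ)) t := by
    intro t ht
    have hc : 0 < Real.cos t := Real.cos_pos_of_mem_Ioo (hsub ht)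
    have h1 : HasDerivAt (fun t => Real.cos t ^ (b + 1))
        (-Real.sin t * (b + 1) * Real.cos t ^ b) t := by
      have := (Real.hasDerivAt_cos t).rpow_const (p := b + 1) (Or.inl hc.ne')
      rwa [add_sub_cancel_right] at this
    have h2 := ((((Real.hasDerivAt_sin t).fun_mul h1).const_mul (b + 2)).ofReal_comp).fun_neg
    have h3 := hasDerivAt_cos_rpow_ofReal (a := b + 2) hc
    have h4 := (h2.fun_mul (hasDerivAt_deriv hf t)).fun_sub
      (h3.fun_mul (hasDerivAt_deriv hf1 t))
    refine h4.congr_deriv ?_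
    have e1 : Real.cos t ^ (b + 2 - 1) = Real.cos t ^ b * Real.cos t := by
      rw [show b + 2 - 1 = b + 1 by ring, Real.rpow_add_one hc.ne']
    have e2 : Real.cos t ^ (b + 2) = Real.cos t ^ b * Real.cos t ^ 2 := by
      rw [Real.rpow_add hc, Real.rpow_two]
    have e3 : Real.cos t ^ (b + 1) = Real.cos t ^ b * Real.cos t := Real.rpow_add_one hc.ne' b
    have e4 : (Real.sin t : ℂ) ^ 2 = 1 - (Real.cos t : ℂ) ^ 2 := by
      have := Real.sin_sq_add_cos_sq t
      rw [eq_sub_iff_add_eq]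
      exact_mod_cast this
    simp only [hf₂]
    rw [e1, e2, e3]
    generalize Real.cos t ^ b = X
    simp only [Complex.ofReal_mul, Complex.ofReal_add, Complex.ofReal_neg, Complex.ofReal_pow]
    push_cast [-Complex.ofReal_cos, -Complex.ofReal_sin]
    linear_combination ((b : ℂ) + 2) * (b + 1) * X * f t * e4
  have hi1 := ((continuousOn_mul_cos_rpow b hf.continuous).mono hsub).intervalIntegrable
    (μ := volume)
  have hi2 := ((continuousOn_mul_cos_rpow (b + 2) hf₂c).mono hsub).intervalIntegrable
    (μ := volume)
  have key := intervalIntegral.integral_eq_sub_of_hasDerivAt hderiv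
    ((hi1.const_mul _).sub hi2)
  rw [intervalIntegral.integral_sub (hi1.const_mul _) hi2,
    intervalIntegral.integral_const_mul] at key
  have hbdry : W (π / 2 - ε) - W (-(π / 2) + ε)
      = ((ε ^ (b + 1) : ℝ) : ℂ) * boundaryFactor (b + 2) f ε := by
    have hs : 0 < Real.sin ε := Real.sin_pos_of_pos_of_lt_pi hε.1 (by linarith [hε.2])
    rw [show -(π / 2) + ε = ε - π / 2 by ring]
    simp only [hW, boundaryFactor]
    rw [Real.cos_pi_div_two_sub, Real.cos_sub_pi_div_two, Real.sin_pi_div_two_sub,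
      Real.sin_sub_pi_div_two, show b + 2 - 1 = b + 1 by ring,
      show Real.sin ε ^ (b + 2) = Real.sin ε ^ (b + 1) * Real.sin ε by
        rw [← Real.rpow_add_one hs.ne']; congr 1; ring,
      sin_rpow_eq (b + 1) hε.1 (by linarith [hε.2])]
    generalize Real.sinc ε ^ (b + 1) = X
    generalize ε ^ (b + 1) = Y
    simp only [Complex.ofReal_mul, Complex.ofReal_add, Complex.ofReal_neg]
    push_cast [-Complex.ofReal_cos, -Complex.ofReal_sin]
    ring
  rw [hbdry] at key
  rw [cutoffIntegral, cutoffIntegral]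
  linear_combination key

theorem intervalIntegrable_cos_rpow_right {b : ℝ} (hb : -1 < b) {f : ℝ → ℂ}
    (hf : Continuous f) :
    IntervalIntegrable (fun t => f t * ((Real.cos t ^ b : ℝ) : ℂ)) volume 0 (π / 2) := by
  have hpi := Real.pi_pos
  have h0 := intervalIntegral.intervalIntegrable_rpow' (a := 0) (b := π / 2) hb
  have h1 : IntervalIntegrable (fun s : ℝ => ((s ^ b : ℝ) : ℂ)) volume 0 (π / 2) :=
    ⟨h0.1.ofReal, h0.2.ofReal⟩
  have h2 : ContinuousOn (fun s => f (π / 2 - s) * ((Real.sinc s ^ b : ℝ) : ℂ))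
      (uIcc 0 (π / 2)) := by
    rw [uIcc_of_le (by positivity)]
    exact fun s hs => ((hf.continuousAt.comp (by fun_prop)).mul
      (Complex.continuous_ofReal.continuousAt.comp
        (contDiffAt_sinc_rpow b (abs_lt_pi_of_mem hs)).continuousAt)).continuousWithinAt
  have h3 := h1.continuousOn_mul h2
  have h4 : IntervalIntegrable (fun s => f (π / 2 - s) * ((Real.cos (π / 2 - s) ^ b : ℝ) : ℂ))
      volume 0 (π / 2) := by
    refine h3.congr fun s hs => ?_
    rw [uIoc_of_le (by positivity)] at hs
    rw [Real.cos_pi_div_two_sub, sin_rpow_eq b hs.1 (by linarith [hs.2])]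
    push_cast
    ring
  have h5 := (h4.comp_sub_left (π / 2)).symm
  simpa using h5

theorem intervalIntegrable_cos_rpow {b : ℝ} (hb : -1 < b) {f : ℝ → ℂ} (hf : Continuous f) :
    IntervalIntegrable (fun t => f t * ((Real.cos t ^ b : ℝ) : ℂ)) volume (-(π / 2)) (π / 2) := by
  have h1 := intervalIntegrable_cos_rpow_right hb hf
  have h2 := intervalIntegrable_cos_rpow_right hb (f := fun t => f (-t)) (by fun_prop)
  have h3 := (h2.comp_sub_left 0).symm
  simp only [zero_sub, neg_neg, Real.cos_neg, sub_zero] at h3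
  exact h3.trans h1

theorem tendsto_cutoffIntegral {b : ℝ} (hb : -1 < b) {f : ℝ → ℂ} (hf : Continuous f) :
    Tendsto (cutoffIntegral b f) (𝓝[>] 0)
      (𝓝 (∫ t in (-(π / 2))..(π / 2), f t * ((Real.cos t ^ b : ℝ) : ℂ))) := by
  have hpi := Real.pi_pos
  have hle : -(π / 2) ≤ π / 2 := by linarith
  have hi := intervalIntegrable_cos_rpow hb hf
  set g := fun t => f t * ((Real.cos t ^ b : ℝ) : ℂ)
  have h0 := intervalIntegral.continuousOn_primitive_interval' hi left_mem_uIcc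
  rw [uIcc_of_le hle] at h0
  have hev : ∀ᶠ ε : ℝ in 𝓝[>] 0, ε ∈ Ioo 0 (π / 2) := Ioo_mem_nhdsGT (by positivity)
  have lim : ∀ (k : ℝ → ℝ) (x : ℝ), Continuous k → k 0 = x → x ∈ Icc (-(π / 2)) (π / 2) →
      (∀ ε ∈ Ioo 0 (π / 2), k ε ∈ Icc (-(π / 2)) (π / 2)) →
      Tendsto (fun ε => ∫ t in (-(π / 2))..(k ε), g t) (𝓝[>] 0)
        (𝓝 (∫ t in (-(π / 2))..x, g t)) := by
    intro k x hk hkx hx hmem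
    refine (h0 x hx).tendsto.comp (tendsto_nhdsWithin_iff.2 ⟨?_, ?_⟩)
    · rw [← hkx]
      exact (hk.tendsto 0).mono_left nhdsWithin_le_nhds
    · filter_upwards [hev] with ε hε using hmem ε hε
  have l1 := lim (fun ε => π / 2 - ε) (π / 2) (by fun_prop) (sub_zero _) ⟨hle, le_rfl⟩
    fun ε hε => ⟨by linarith [hε.2], by linarith [hε.1]⟩
  have l2 := lim (fun ε => -(π / 2) + ε) (-(π / 2)) (by fun_prop) (add_zero _) ⟨le_rfl, hle⟩
    fun ε hε => ⟨by linarith [hε.1], by linarith [hε.2]⟩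
  rw [intervalIntegral.integral_same] at l2
  have l3 := l1.sub l2
  rw [sub_zero] at l3
  refine l3.congr' ?_
  filter_upwards [hev] with ε hε
  have hsub : ∀ x ∈ Icc (-(π / 2)) (π / 2), IntervalIntegrable g volume (-(π / 2)) x :=
    fun x hx => hi.mono_set (by
      rw [uIcc_of_le hle, uIcc_of_le hx.1]; exact Icc_subset_Icc_right hx.2)
  exact intervalIntegral.integral_interval_sub_left
    (hsub _ ⟨by linarith [hε.2], by linarith [hε.1]⟩)
    (hsub _ ⟨by linarith [hε.1], by linarith [hε.2]⟩)

/-- Each integration by parts raises `b` by 2 and changes the finite part only by the prefactor,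
until the weight is integrable. Nonvanishing of `b + 1` and `b + 2` permits the division. -/
theorem hasFinitePart_cutoffIntegral (m : ℕ) {b : ℝ} (hm : -1 < b + 2 * m)
    (hb : ∀ j : ℕ, b + 1 + j ≠ 0) {f : ℝ → ℂ} (hf : ContDiff ℝ ∞ f) :
    HasFinitePart b (cutoffIntegral b f) (finitePart m b f) := by
  induction m generalizing b f with
  | zero =>
    have := tendsto_cutoffIntegral (by simpa using hm) hf.continuous (b := b)
    simp only [finitePart, mul_comm _ (f _)]
    exact HasFinitePart.of_tendsto this
  | succ m ih =>
    have hf2 : ContDiff ℝ ∞ fun t => deriv (deriv f) t + (((b + 2) ^ 2 : ℝ) : ℂ) * f t :=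
      (contDiff_deriv (contDiff_deriv hf)).add (contDiff_const.mul hf)
    have h1 := (ih (b := b + 2) (by push_cast at hm; linarith)
      (fun j => by have := hb (j + 2); push_cast at this; convert this using 1; ring)
      hf2).of_add_two
    have h2 := hasFinitePart_rpow_mul (b := b) (k := boundaryFactor (b + 2) f) (A := π / 2)
      (by positivity) fun s hs => contDiffAt_boundaryFactor _ hf (abs_lt_pi_of_mem hs)
    have h3 := (h2.add h1).const_mul (((b + 2) * (b + 1) : ℝ) : ℂ)⁻¹
    rw [zero_add] at h3
    refine h3.congr ?_
    filter_upwards [Ioo_mem_nhdsGT (show (0 : ℝ) < π / 2 by positivity)] with ε hε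
    have hne : (((b + 2) * (b + 1) : ℝ) : ℂ) ≠ 0 := by
      have n1 : b + 1 ≠ 0 := by simpa using hb 0
      have n2 : b + 2 ≠ 0 := by
        have := hb 1
        convert this using 1; push_cast; ring
      exact_mod_cast mul_ne_zero n2 n1
    rw [← cutoffIntegral_parts hf hε, inv_mul_cancel_left₀ hne]

/-- The regularised integral of a smooth function converges to its finite part. -/
theorem tendsto_regularized {d n₀ m : ℕ} {ν : ℝ} (hn : 0 < -deltaMinus d ν + 1 + n₀)
    (hne : Nonexceptional d n₀ ν) (hm : -1 < -deltaMinus d ν + 2 * m) {f : ℝ → ℂ}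
    (hf : ContDiff ℝ ∞ f) :
    Tendsto (regularized d n₀ ν f) (𝓝[>] 0) (𝓝 (finitePart m (-deltaMinus d ν) f)) := by
  set b := -deltaMinus d ν with hbdef
  have hb : ∀ j : ℕ, b + 1 + j ≠ 0 := by
    intro j
    rcases lt_or_ge j n₀ with h | h
    · exact hne j h
    · have : (n₀ : ℝ) ≤ j := by exact_mod_cast h
      have : 0 < b + 1 + j := by linarith
      exact this.ne'
  have hev : ∀ᶠ ε : ℝ in 𝓝[>] 0, ε ∈ Ioo 0 (π / 2) := Ioo_mem_nhdsGT (by positivity)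
  obtain ⟨L, hL⟩ := exists_tendsto_regularized (h := endpointFactor b f) (A := π / 2)
    (by positivity) (fun s hs => contDiffAt_endpointFactor b hf (abs_lt_pi_of_mem hs)) hn hne
  have hreg : Tendsto (regularized d n₀ ν f) (𝓝[>] 0) (𝓝 L) := by
    refine hL.congr' ?_
    filter_upwards [hev] with ε hε using (regularized_eq hf hε).symm
  -- Both numbers are finite parts of the same cut-off integral: the explicit counterterms are
  -- themselves `ε^{b+1}` times a polynomial, so uniqueness applies.
  suffices h : L = finitePart m b f by rwa [← h]
  refine HasFinitePart.unique hb ?_ (hasFinitePart_cutoffIntegral m hm hb hf)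
  refine ⟨-∑ j ∈ Finset.range n₀, Polynomial.C ((taylorPlus d ν f j + taylorMinus d ν f j)
    / ((b + 1 + j : ℝ) : ℂ)) * Polynomial.X ^ j, hreg.congr' ?_⟩
  filter_upwards [hev] with ε hε
  simp only [Polynomial.eval_neg, Polynomial.eval_finsetSum, Polynomial.eval_mul,
    Polynomial.eval_C, Polynomial.eval_pow, Polynomial.eval_X, mul_neg, sub_neg_eq_add,
    Finset.mul_sum]
  rw [regularized, add_comm]
  congr 1
  refine Finset.sum_congr rfl fun j _ => ?_
  rw [← hbdef, Real.rpow_add hε.1 (b + 1), Real.rpow_natCast]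
  push_cast
  ring

/-! ### Reconstruction of the bulk field from its boundary value -/

theorem neg_deltaMinus (d : ℕ) (ν : ℝ) : -deltaMinus d ν = deltaPlus d ν - d := by
  rw [deltaMinus, deltaPlus]; ring

theorem sphereMeasure_real_univ {d : ℕ} (hd : 0 < d) :
    (sphereMeasure d).real univ = 2 * √π ^ d / Real.Gamma ((d : ℝ) / 2) := by
  have : Nonempty (Fin d) := ⟨⟨0, hd⟩⟩
  have hd' : (0 : ℝ) < d := by exact_mod_cast hd
  rw [sphereMeasure, Measure.toSphere_real_apply_univ, Measure.real, EuclideanSpace.volume_ball]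
  have hG := Real.Gamma_add_one (show (d : ℝ) / 2 ≠ 0 by positivity)
  have hpos : 0 < Real.Gamma ((d : ℝ) / 2) := Real.Gamma_pos_of_pos (by positivity)
  have hnn : 0 ≤ √π ^ d / Real.Gamma ((d : ℝ) / 2 + 1) := by
    rw [hG]; positivity
  simp only [finrank_euclideanSpace, Fintype.card_fin, ENNReal.ofReal_one, one_pow, one_mul]
  rw [ENNReal.toReal_ofReal hnn, hG]
  field_simp

/-- The area `2 π^{d/2} / Γ(d/2)` appears because averages are unnormalised: at the origin the
average is the area times the field. -/
theorem reconstructConst_eq_mul_hkllConst {d m : ℕ} (hd : d = 2 * m + 1) {ν : ℝ}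
    (hΔ : 1 < deltaPlus d ν) (hm : (m : ℝ) < deltaPlus d ν)
    (hne : ∀ j : ℕ, deltaPlus d ν - 2 * m + j ≠ 0) :
    reconstructConst (deltaPlus d ν) m = (sphereMeasure d).real univ * hkllConst d ν := by
  rw [reconstructConst_eq hΔ m hm hne, sphereMeasure_real_univ (by omega), hkllConst,
    show (d - 1) / 2 = m by omega]
  set Δ := deltaPlus d ν
  have hdm : (d : ℝ) = 2 * m + 1 := by rw [hd]; push_cast; ring
  have e1 : Δ - m + 1 / 2 = Δ - d / 2 + 1 := by rw [hdm]; ring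
  have e2 : (m : ℝ) + 1 / 2 = d / 2 := by rw [hdm]; ring
  have e3 : Δ - 2 * m = Δ - d + 1 := by rw [hdm]; ring
  have e4 : (2 : ℝ) ^ (Δ - 2 * m - 1) = 2 * 2 ^ (Δ - d - 1) := by
    rw [show Δ - 2 * m - 1 = 1 + (Δ - d - 1) by rw [hdm]; ring, Real.rpow_add two_pos,
      Real.rpow_one]
  have e5 : √π ^ d = π ^ ((d : ℝ) / 2) := by
    rw [Real.sqrt_eq_rpow, ← Real.rpow_natCast, ← Real.rpow_mul Real.pi_pos.le]
    congr 1; ring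
  have n1 : Real.Gamma (Δ - d + 1) ≠ 0 := by
    refine Real.Gamma_ne_zero fun j hj => hne j ?_
    rw [e3, hj]; ring
  have n2 : Real.Gamma ((d : ℝ) / 2) ≠ 0 :=
    (Real.Gamma_pos_of_pos (by rw [hdm]; positivity)).ne'
  have n3 : π ^ ((d : ℝ) / 2) ≠ 0 := (Real.rpow_pos_of_pos Real.pi_pos _).ne'
  rw [e1, e2, e4, e3, e5]
  field_simp

section Boundary

variable {d : ℕ} {G : (ℝ × ℝ) × Space d → ℂ} {φ : ℝ → Sph d → ℂ}

theorem contDiff_boundary_section (hG : ContDiffOn ℝ ∞ G (familyDomain d)) (Ω : Sph d) :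
    ContDiff ℝ ∞ fun t => G ((t, π / 2), (Ω : Space d)) :=
  contDiffOn_univ.1 (hG.comp (f := fun t : ℝ => ((t, π / 2), (Ω : Space d)))
    (ContDiff.contDiffOn (by fun_prop))
    fun _ _ => mem_familyDomain (mem_strip.2 ⟨by positivity, le_rfl⟩) Ω)

theorem continuous_boundary (hG : ContDiffOn ℝ ∞ G (familyDomain d)) :
    Continuous fun x : ℝ × Sph d => G ((x.1, π / 2), (x.2 : Space d)) :=
  hG.continuousOn.comp_continuous (by fun_prop)
    fun x => mem_familyDomain (mem_strip.2 ⟨by positivity, le_rfl⟩) x.2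

end Boundary

/-- The data extracted from a Dirichlet field and its boundary value. -/
theorem IsDirichletField.reconstruct {d m : ℕ} (hm : d = 2 * m + 1) (hm1 : 1 ≤ m) {ν : ℝ}
    (hν : 0 < ν) {F : ℝ → Space d → ℂ} {φ : ℝ → Sph d → ℂ} (hF : IsDirichletField d ν F)
    (hφ : IsBoundaryValue d ν F φ) :
    (∀ Ω, ContDiff ℝ ∞ fun t => φ t Ω) ∧ (Continuous fun x : ℝ × Sph d => φ x.1 x.2) ∧
    (Continuous fun Ω => finitePart m (-deltaMinus d ν) fun t => φ t Ω) ∧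
    ((∀ j : ℕ, -deltaMinus d ν + 1 + j ≠ 0) → F 0 0 = (hkllConst d ν : ℂ)
      * ∫ Ω, finitePart m (-deltaMinus d ν) (fun t => φ t Ω) ∂sphereMeasure d) := by
  obtain ⟨G, hG, hval, hwave⟩ := hF.exists_family (by omega)
  have hφG := hφ.eq_family hG hval
  have hpi := Real.pi_pos
  have hdm : (d : ℝ) = 2 * m + 1 := by rw [hm]; push_cast; ring
  have hm1' : (1 : ℝ) ≤ m := by exact_mod_cast hm1
  set Δ := deltaPlus d ν with hΔdef
  have hΔ : Δ = d / 2 + ν := rfl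
  have hb : -deltaMinus d ν = Δ - 2 * m - 1 := by rw [neg_deltaMinus, hdm]; ring
  obtain ⟨h1, h2⟩ := integral_finitePart_family hG m (b := -deltaMinus d ν)
    (by rw [hb]; linarith)
  simp only [hφG]
  refine ⟨contDiff_boundary_section hG, continuous_boundary hG, h1, fun hne => ?_⟩
  have hne' : ∀ j : ℕ, Δ - 2 * m + j ≠ 0 := fun j => by
    have := hne j
    rw [hb] at this
    convert this using 1
    ring
  have hw : RadialWave (2 * m) (2 * Δ - 2 * m) Δ (average G) := by
    convert hwave using 1
    · rw [hdm]; ring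
    · rw [hdm]; ring
  have key := hw.reconstruct (by linarith) m (by linarith) hne' (smoothOnStrip_average hG)
  rw [reconstructConst_eq_mul_hkllConst hm (by linarith) (by linarith) hne', ← hb, ← h2] at key
  -- At `ρ = 0` the family does not depend on the angle, so the area factors out and cancels against
  -- the one in the constant.
  have h0 : average G (0, 0) = ((sphereMeasure d).real univ : ℂ) * F 0 0 := by
    have h3 : ∀ Ω : Sph d, G ((0, 0), (Ω : Space d)) = F 0 0 := fun Ω => by
      have := hval 0 0 ⟨le_rfl, by positivity⟩ Ω
      rw [zero_smul, Real.cos_zero, Real.one_rpow, Complex.ofReal_one, one_mul] at this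
      exact this.symm
    simp only [average, h3, integral_const, Complex.real_smul]
  have hS : ((sphereMeasure d).real univ : ℂ) ≠ 0 := by
    rw [sphereMeasure_real_univ (by omega)]
    have : 0 < Real.Gamma ((d : ℝ) / 2) := Real.Gamma_pos_of_pos (by rw [hdm]; positivity)
    have : 0 < 2 * √π ^ d / Real.Gamma ((d : ℝ) / 2) := by positivity
    exact_mod_cast this.ne'
  rw [h0] at key
  push_cast at key
  rw [mul_assoc] at key
  exact mul_left_cancel₀ hS key

theorem convergesAbsolutely_of_continuous {d : ℕ} {ν : ℝ} (hb : -1 < -deltaMinus d ν)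
    {φ : ℝ → Sph d → ℂ} (hφ : Continuous fun x : ℝ × Sph d => φ x.1 x.2) :
    ConvergesAbsolutely d ν φ := by
  have hpi := Real.pi_pos
  have h1 := intervalIntegrable_cos_rpow hb (f := fun _ => 1) continuous_const
  rw [intervalIntegrable_iff_integrableOn_Ioo_of_le (by linarith)] at h1
  have h2 : Integrable (fun p : ℝ × Sph d => ((Real.cos p.1 ^ (-deltaMinus d ν) : ℝ) : ℂ))
      ((volume.restrict (Ioo (-(π / 2)) (π / 2))).prod (sphereMeasure d)) := by
    simpa using Integrable.comp_fst h1 (sphereMeasure d)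
  rw [ConvergesAbsolutely]
  rw [← Measure.restrict_univ (μ := sphereMeasure d), Measure.prod_restrict] at h2 ⊢
  exact IntegrableOn.continuousOn_mul_of_subset (K := Icc (-(π / 2)) (π / 2) ×ˢ univ)
    hφ.continuousOn h2
    (isCompact_Icc.prod isCompact_univ) (measurableSet_Ioo.prod MeasurableSet.univ)
    (prod_mono Ioo_subset_Icc_self subset_rfl)

/-! ### Divergence -/

/-- Near the end point `|f|` exceeds half its limit, and `sin s ≤ s` with `b < 0` gives `(sin s)^b ≥
s^b`, which is not integrable at 0 for `b ≤ -1`. -/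
theorem not_integrableOn_mul_cos_rpow {b : ℝ} (hb : b ≤ -1) {f : ℝ → ℂ} (hf : Continuous f)
    (h0 : f (π / 2) ≠ 0) :
    ¬ IntegrableOn (fun t => f t * ((Real.cos t ^ b : ℝ) : ℂ)) (Ioo 0 (π / 2)) := by
  intro h
  have hpi := Real.pi_pos
  set c := ‖f (π / 2)‖ / 2 with hc
  have hc0 : 0 < c := by have := norm_pos_iff.2 h0; positivity
  have hev : ∀ᶠ s in 𝓝 (0 : ℝ), c < ‖f (π / 2 - s)‖ := by
    have h1 : Continuous fun s => ‖f (π / 2 - s)‖ := by fun_prop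
    refine (h1.tendsto 0).eventually (lt_mem_nhds ?_)
    rw [sub_zero, hc]
    have := norm_pos_iff.2 h0
    linarith
  obtain ⟨δ, hδ, hball⟩ := Metric.eventually_nhds_iff.1 hev
  have h1 : IntervalIntegrable (fun t => f t * ((Real.cos t ^ b : ℝ) : ℂ)) volume 0 (π / 2) :=
    (intervalIntegrable_iff_integrableOn_Ioo_of_le (by positivity)).2 h
  have h2 := (h1.comp_sub_left (π / 2)).symm
  rw [sub_self, sub_zero, intervalIntegrable_iff_integrableOn_Ioo_of_le (by positivity)] at h2
  set r := min δ (π / 2) with hr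
  have hr0 : 0 < r := lt_min hδ (by positivity)
  have h3 := h2.mono_set (Ioo_subset_Ioo_right (min_le_right δ (π / 2)))
  have h4 : IntegrableOn (fun s : ℝ => s ^ b) (Ioo 0 r) := by
    refine (h3.norm.const_mul c⁻¹).mono' ?_ ?_
    · exact (ContinuousOn.aestronglyMeasurable (fun s hs =>
        (Real.continuousAt_rpow_const s b (Or.inl hs.1.ne')).continuousWithinAt)
        measurableSet_Ioo)
    · refine (ae_restrict_iff' measurableSet_Ioo).2 (Filter.Eventually.of_forall fun s hs => ?_)
      have hsπ : s < π / 2 := hs.2.trans_le (min_le_right _ _)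
      have hfs : c < ‖f (π / 2 - s)‖ := hball (by
        rw [Real.dist_eq, sub_zero, abs_of_pos hs.1]
        exact hs.2.trans_le (min_le_left _ _))
      have hsin : 0 < Real.sin s := Real.sin_pos_of_pos_of_lt_pi hs.1 (by linarith)
      rw [Real.norm_of_nonneg (Real.rpow_nonneg hs.1.le _), norm_mul, Complex.norm_real,
        Real.cos_pi_div_two_sub, Real.norm_of_nonneg (Real.rpow_nonneg hsin.le _),
        ← mul_assoc]
      have h5 : s ^ b ≤ Real.sin s ^ b :=
        Real.rpow_le_rpow_of_nonpos hsin (Real.sin_le hs.1.le) (by linarith)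
      have h6 : 1 ≤ c⁻¹ * ‖f (π / 2 - s)‖ := by
        rw [← div_eq_inv_mul, le_div_iff₀ hc0, one_mul]; exact hfs.le
      calc s ^ b = 1 * s ^ b := (one_mul _).symm
        _ ≤ c⁻¹ * ‖f (π / 2 - s)‖ * Real.sin s ^ b :=
          mul_le_mul h6 h5 (Real.rpow_nonneg hs.1.le _) (by positivity)
  have := (intervalIntegral.integrableOn_Ioo_rpow_iff hr0).1 h4
  linarith

theorem not_integrableOn_integrand {d : ℕ} {ν : ℝ} (hb : -deltaMinus d ν ≤ -1) {f : ℝ → ℂ}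
    (hf : Continuous f) (h0 : f (π / 2) ≠ 0 ∨ f (-(π / 2)) ≠ 0) :
    ¬ IntegrableOn (integrand d ν f) (Ioo (-(π / 2)) (π / 2)) := by
  intro h
  have hpi := Real.pi_pos
  rcases h0 with h0 | h0
  · exact not_integrableOn_mul_cos_rpow hb hf h0
      (h.mono_set (Ioo_subset_Ioo_left (by linarith)))
  · refine not_integrableOn_mul_cos_rpow hb (f := fun t => f (-t)) (by fun_prop) h0 ?_
    have h1 : IntervalIntegrable (integrand d ν f) volume (-(π / 2)) 0 :=
      (intervalIntegrable_iff_integrableOn_Ioo_of_le (by linarith)).2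
        (h.mono_set (Ioo_subset_Ioo_right (by linarith)))
    have h2 := (h1.comp_sub_left 0).symm
    simp only [zero_sub, neg_neg, sub_zero, integrand, Real.cos_neg] at h2
    exact (intervalIntegrable_iff_integrableOn_Ioo_of_le (by positivity)).1 h2

/-- By Fubini, joint integrability would give integrability for almost every angle, hence zero end
point values almost everywhere. By continuity, and since the surface measure charges open sets, they
would vanish everywhere. -/
theorem not_convergesAbsolutely {d : ℕ} {ν : ℝ} (hb : -deltaMinus d ν ≤ -1)
    {φ : ℝ → Sph d → ℂ} (hφ : Continuous fun x : ℝ × Sph d => φ x.1 x.2)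
    (h0 : ∃ Ω : Sph d, φ (π / 2) Ω ≠ 0 ∨ φ (-(π / 2)) Ω ≠ 0) :
    ¬ ConvergesAbsolutely d ν φ := by
  intro h
  have h1 : ∀ᵐ Ω ∂sphereMeasure d, IntegrableOn (integrand d ν fun τ => φ τ Ω)
      (Ioo (-(π / 2)) (π / 2)) := Integrable.prod_left_ae h
  have hcont : ∀ Ω, Continuous fun t => φ t Ω := fun Ω =>
    hφ.comp (continuous_id.prodMk continuous_const)
  have h2 : ∀ᵐ Ω ∂sphereMeasure d, φ (π / 2) Ω = 0 ∧ φ (-(π / 2)) Ω = 0 := by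
    filter_upwards [h1] with Ω hΩ
    by_contra hne
    exact not_integrableOn_integrand hb (hcont Ω) (by tauto) hΩ
  have h3 : ∀ t : ℝ, (∀ᵐ Ω ∂sphereMeasure d, φ t Ω = 0) → ∀ Ω, φ t Ω = 0 := by
    intro t ht
    have hc : Continuous fun Ω => φ t Ω := hφ.comp (continuous_const.prodMk continuous_id)
    exact congrFun ((Continuous.ae_eq_iff_eq (sphereMeasure d) hc continuous_zero).1 ht)
  obtain ⟨Ω, hΩ | hΩ⟩ := h0
  · exact hΩ (h3 _ (h2.mono fun _ h => h.1) Ω)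
  · exact hΩ (h3 _ (h2.mono fun _ h => h.2) Ω)

/-! ### The regulating terms as distributions -/

theorem deltaDeriv_apply (a : ℝ) (k : ℕ) (ψ : 𝓢(ℝ, ℂ)) :
    deltaDeriv a k ψ = (-1) ^ k * iteratedDeriv k ψ a := by
  induction k generalizing ψ with
  | zero => simp [deltaDeriv]
  | succ k ih =>
    have h1 : deltaDeriv a (k + 1) ψ = deltaDeriv a k (-SchwartzMap.derivCLM ℂ ℂ ψ) := by
      rw [deltaDeriv, Function.iterate_succ_apply']
      rfl
    have h2 : ((-SchwartzMap.derivCLM ℂ ℂ ψ : 𝓢(ℝ, ℂ)) : ℝ → ℂ) = fun t => -deriv ψ t := rfl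
    rw [h1, ih, h2, iteratedDeriv_fun_neg, iteratedDeriv_succ']
    ring

theorem iteratedDeriv_ofReal {g : ℝ → ℝ} {x : ℝ} (hg : ContDiffAt ℝ ∞ g x) (n : ℕ) :
    iteratedDeriv n (fun s => (g s : ℂ)) x = ((iteratedDeriv n g x : ℝ) : ℂ) := by
  have h := Complex.ofRealCLM.iteratedFDeriv_comp_left (hg.of_le (n := ∞) (m := n)
    (by exact_mod_cast le_top)) le_rfl
  rw [iteratedDeriv_eq_iteratedFDeriv, iteratedDeriv_eq_iteratedFDeriv]
  exact DFunLike.congr_fun h fun _ => 1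

theorem iteratedDeriv_endpoint (b : ℝ) {f : ℝ → ℂ} (hf : ContDiff ℝ ∞ f) (j : ℕ) :
    iteratedDeriv j (fun s => f s * ((Real.sinc s ^ b : ℝ) : ℂ)) 0 / (j.factorial : ℂ)
      = ∑ k ∈ Finset.range (j + 1), ((iteratedDeriv (j - k) (fun s => Real.sinc s ^ b) 0
        / ((j - k).factorial : ℝ) / (k.factorial : ℝ) : ℝ) : ℂ) * iteratedDeriv k f 0 := by
  have h0 : |(0 : ℝ)| < π := by rw [abs_zero]; exact Real.pi_pos
  have hs := contDiffAt_sinc_rpow b h0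
  have hs' : ContDiffAt ℝ ∞ (fun s => ((Real.sinc s ^ b : ℝ) : ℂ)) 0 :=
    Complex.ofRealCLM.contDiff.contDiffAt.comp 0 hs
  rw [iteratedDeriv_fun_mul (hf.contDiffAt.of_le (by exact_mod_cast le_top))
    (hs'.of_le (by exact_mod_cast le_top)), Finset.sum_div]
  refine Finset.sum_congr rfl fun k hk => ?_
  have hkj : k ≤ j := Nat.lt_succ_iff.1 (Finset.mem_range.1 hk)
  rw [iteratedDeriv_ofReal hs, Nat.cast_choose ℂ hkj]
  have n1 : (j.factorial : ℂ) ≠ 0 := by exact_mod_cast j.factorial_ne_zero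
  have n2 : (k.factorial : ℂ) ≠ 0 := by exact_mod_cast k.factorial_ne_zero
  have n3 : ((j - k).factorial : ℂ) ≠ 0 := by exact_mod_cast (j - k).factorial_ne_zero
  push_cast
  field_simp

theorem regulatingDistribution_apply (d : ℕ) (ν : ℝ) (j : ℕ) (ψ : 𝓢(ℝ, ℂ)) :
    regulatingDistribution d ν j ψ = ∑ k ∈ Finset.range (j + 1),
      ((sincCoeff d ν (j - k) / (k.factorial : ℝ) : ℝ) : ℂ) *
        (deltaDeriv (π / 2) k ψ + (-1 : ℂ) ^ k * deltaDeriv (-(π / 2)) k ψ) := by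
  simp [regulatingDistribution, mul_add]

/-- The Leibniz rule with the Taylor coefficients of the `sinc` power. At `t = π/2` the sign
`(-1)^k` of the reflected variable is the one in `δ^{(k)}`; at `t = -π/2` there is no reflection, so
`(-1)^k` must be inserted. -/
theorem taylor_add_eq_regulatingDistribution (d : ℕ) (ν : ℝ) (ψ : 𝓢(ℝ, ℂ)) (j : ℕ) :
    taylorPlus d ν ψ j + taylorMinus d ν ψ j = regulatingDistribution d ν j ψ := by
  have hψ : ContDiff ℝ ∞ (ψ : ℝ → ℂ) := ψ.smooth'
  rw [taylorPlus, taylorMinus,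
    iteratedDeriv_endpoint _ (f := fun s => ψ (π / 2 - s))
      (hψ.comp (contDiff_const.sub contDiff_id)),
    iteratedDeriv_endpoint _ (f := fun s => ψ (s - π / 2))
      (hψ.comp (contDiff_id.sub contDiff_const)), ← Finset.sum_add_distrib]
  rw [regulatingDistribution_apply]
  refine Finset.sum_congr rfl fun k _ => ?_
  have hsq : ((-1 : ℂ) ^ k) * (-1) ^ k = 1 := by
    rw [← mul_pow, neg_one_mul, neg_neg, one_pow]
  simp only [deltaDeriv_apply, iteratedDeriv_comp_const_sub, iteratedDeriv_comp_sub_const,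
    sub_zero, zero_sub, sincCoeff, Complex.real_smul]
  push_cast
  linear_combination (-((iteratedDeriv (j - k) (fun s => Real.sinc s ^ (-deltaMinus d ν)) 0 : ℝ) : ℂ)
    / ((j - k).factorial : ℂ) / (k.factorial : ℂ) * iteratedDeriv k ψ (-(π / 2))) * hsq

/-! ### The extended kernel -/

/-- Agreement on a neighbourhood of the closed interval is assumed so that it passes to the
derivatives in the recursion. -/
theorem finitePart_congr (m : ℕ) (b : ℝ) {f g : ℝ → ℂ}
    (h : ∀ᶠ t in 𝓝ˢ (Icc (-(π / 2)) (π / 2)), f t = g t) :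
    finitePart m b f = finitePart m b g := by
  induction m generalizing b f g with
  | zero =>
    simp only [finitePart]
    refine intervalIntegral.integral_congr fun t ht => ?_
    rw [uIcc_of_le (by linarith [Real.pi_pos])] at ht
    simp only [h.self_of_nhdsSet t ht]
  | succ m ih =>
    simp only [finitePart]
    congr 1
    refine ih _ ?_
    rw [eventually_nhdsSet_iff_forall] at h ⊢
    intro t ht
    have h1 : f =ᶠ[𝓝 t] g := h t ht
    filter_upwards [h1.deriv.deriv, h1] with s hs1 hs2
    rw [hs1, hs2]

/-- After `m` steps the functional is integration of derivatives of `ψ` against an integrable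
weight, which is bounded by a Schwartz seminorm. The extended kernel is a multiple of this
functional. -/
theorem exists_finitePart_clm (m : ℕ) {b : ℝ} (hb : -1 < b + 2 * m) :
    ∃ T : 𝓢(ℝ, ℂ) →L[ℂ] ℂ, ∀ ψ : 𝓢(ℝ, ℂ), T ψ = finitePart m b ψ := by
  induction m generalizing b with
  | zero =>
    have hb' : -1 < b := by simpa using hb
    have hle : -(π / 2) ≤ π / 2 := by linarith [Real.pi_pos]
    have hi : ∀ ψ : 𝓢(ℝ, ℂ), IntervalIntegrable
        (fun t => ((Real.cos t ^ b : ℝ) : ℂ) * ψ t) volume (-(π / 2)) (π / 2) := fun ψ => by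
      simpa only [mul_comm] using intervalIntegrable_cos_rpow hb' ψ.continuous
    have h1 := intervalIntegrable_cos_rpow hb' (f := fun _ => 1) continuous_const
    simp only [one_mul] at h1
    refine ⟨SchwartzMap.mkCLMtoNormedSpace (σ := RingHom.id ℂ)
      (fun ψ => ∫ t in (-(π / 2))..(π / 2), ((Real.cos t ^ b : ℝ) : ℂ) * ψ t) ?_ ?_ ?_, ?_⟩
    · intro ψ χ
      rw [← intervalIntegral.integral_add (hi ψ) (hi χ)]
      congr 1; funext t
      rw [add_apply, mul_add]
    · intro a ψ
      rw [RingHom.id_apply, smul_eq_mul, ← intervalIntegral.integral_const_mul]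
      congr 1; funext t
      rw [smul_apply, smul_eq_mul]; ring
    · refine ⟨{0}, ∫ t in (-(π / 2))..(π / 2), ‖((Real.cos t ^ b : ℝ) : ℂ)‖,
        intervalIntegral.integral_nonneg hle fun _ _ => norm_nonneg _, fun ψ => ?_⟩
      rw [Finset.sup_singleton, ← intervalIntegral.integral_mul_const]
      refine (intervalIntegral.norm_integral_le_integral_norm hle).trans ?_
      refine intervalIntegral.integral_mono_on hle (hi ψ).norm (h1.norm.mul_const _) fun t _ => ?_
      rw [norm_mul]
      exact mul_le_mul_of_nonneg_left (SchwartzMap.norm_le_seminorm ℂ ψ t) (norm_nonneg _)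
    · exact fun ψ => rfl
  | succ m ih =>
    obtain ⟨T, hT⟩ := ih (b := b + 2) (by push_cast at hb; linarith)
    refine ⟨(((b + 2) * (b + 1) : ℝ) : ℂ)⁻¹ • T.comp
      ((SchwartzMap.derivCLM ℂ ℂ).comp (SchwartzMap.derivCLM ℂ ℂ)
        + (((b + 2) ^ 2 : ℝ) : ℂ) • ContinuousLinearMap.id ℂ _), fun ψ => ?_⟩
    change (((b + 2) * (b + 1) : ℝ) : ℂ)⁻¹ * T (SchwartzMap.derivCLM ℂ ℂ
      (SchwartzMap.derivCLM ℂ ℂ ψ) + (((b + 2) ^ 2 : ℝ) : ℂ) • ψ) = _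
    rw [hT]
    rfl

/-- On functions supported away from the end points the finite part is the integral. -/
theorem finitePart_eq_integral_of_tsupport (m : ℕ) {b : ℝ} (hm : -1 < b + 2 * m)
    (hb : ∀ j : ℕ, b + 1 + j ≠ 0) {f : ℝ → ℂ} (hf : ContDiff ℝ ∞ f)
    (hcpt : HasCompactSupport f) (hsupp : tsupport f ⊆ Ioo (-(π / 2)) (π / 2)) :
    finitePart m b f = ∫ t, f t * ((Real.cos t ^ b : ℝ) : ℂ) := by
  refine HasFinitePart.unique hb (hasFinitePart_cutoffIntegral m hm hb hf)
    (HasFinitePart.of_tendsto ?_)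
  have hpi := Real.pi_pos
  -- The support keeps a distance `δ` from the end points, so for `ε < δ` the cut-off integral
  -- already equals the full one.
  obtain ⟨δ, hδ, hsub⟩ : ∃ δ ∈ Ioo 0 (π / 2), tsupport f ⊆ Ioc (-(π / 2) + δ) (π / 2 - δ) := by
    obtain ⟨r, hr, hsub⟩ := hcpt.isCompact.exists_thickening_subset_open isOpen_Ioo hsupp
    refine ⟨min (r / 2) (π / 4), ⟨lt_min (by positivity) (by positivity),
      (min_le_right _ _).trans_lt (by linarith)⟩, fun x hx => ?_⟩
    set δ := min (r / 2) (π / 4)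
    have hδ0 : 0 < δ := lt_min (by positivity) (by positivity)
    have hδr : δ < r := (min_le_left _ _).trans_lt (by linarith)
    have h1 := hsub (Metric.mem_thickening_iff.2 ⟨x, hx, show dist (x + δ) x < r by
      rwa [Real.dist_eq, add_sub_cancel_left, abs_of_pos hδ0]⟩)
    have h2 := hsub (Metric.mem_thickening_iff.2 ⟨x, hx, show dist (x - δ) x < r by
      rwa [Real.dist_eq, sub_sub_cancel_left, abs_neg, abs_of_pos hδ0]⟩)
    exact ⟨by linarith [h2.1], by linarith [h1.2]⟩
  refine tendsto_const_nhds.congr' ?_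
  filter_upwards [Ioo_mem_nhdsGT hδ.1] with ε hε
  refine (intervalIntegral.integral_eq_integral_of_support_subset fun t ht => ?_).symm
  have h1 : t ∈ tsupport f := subset_tsupport f (left_ne_zero_of_mul ht)
  have := hsub h1
  exact ⟨by linarith [this.1, hε.2], by linarith [this.2, hε.2]⟩

/-- Testing on the open interval forces `k = c (cos t)^b` almost everywhere there. Local
integrability of `k` at `π/2` then contradicts `b ≤ -1`. -/
theorem not_isIntegralKernel {m : ℕ} {b : ℝ} (hm : -1 < b + 2 * m) (hb1 : b ≤ -1)
    (hb : ∀ j : ℕ, b + 1 + j ≠ 0) {c : ℂ} (hc : c ≠ 0) {K : 𝓢'(ℝ, ℂ)}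
    (hK : ∀ ψ : 𝓢(ℝ, ℂ), K ψ = c * finitePart m b ψ) : ¬ IsIntegralKernel K := by
  rintro ⟨k, hk, hKk⟩
  have hpi := Real.pi_pos
  have hcos := continuousOn_mul_cos_rpow b (f := fun _ => c) continuous_const
  have hloc : LocallyIntegrableOn (fun t => k t - c * ((Real.cos t ^ b : ℝ) : ℂ))
      (Ioo (-(π / 2)) (π / 2)) :=
    (hk.locallyIntegrableOn _).sub (hcos.locallyIntegrableOn measurableSet_Ioo)
  have hae := isOpen_Ioo.ae_eq_zero_of_integral_contDiff_smul_eq_zero hloc (by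
    intro g hg hgc hgs
    set ψ : ℝ → ℂ := fun t => (g t : ℂ) with hψ
    have hψs : ContDiff ℝ ∞ ψ := Complex.ofRealCLM.contDiff.comp hg
    have hψc : HasCompactSupport ψ := hgc.comp_left (g := ((↑) : ℝ → ℂ)) Complex.ofReal_zero
    have hψt : tsupport ψ ⊆ Ioo (-(π / 2)) (π / 2) :=
      (tsupport_comp_subset Complex.ofReal_zero g).trans hgs
    have e1 := hK (hψc.toSchwartzMap hψs)
    rw [hKk (hψc.toSchwartzMap hψs) hψc] at e1
    have e2 := finitePart_eq_integral_of_tsupport m hm hb hψs hψc hψt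
    have e3 : ∫ t, k t * ψ t = c * ∫ t, ψ t * ((Real.cos t ^ b : ℝ) : ℂ) := by
      rw [← e2]; exact e1
    have i1 : Integrable fun t => g t • k t :=
      hk.integrable_smul_left_of_hasCompactSupport hg.continuous hgc
    have i2 : Integrable fun t => g t • (c * ((Real.cos t ^ b : ℝ) : ℂ)) := by
      have hsub : tsupport (fun t => g t • (c * ((Real.cos t ^ b : ℝ) : ℂ))) ⊆ tsupport g :=
        closure_mono fun t ht h0 => ht (by simp only [h0, zero_smul])
      refine (continuous_of_tsupport fun t ht => ?_).integrable_of_hasCompactSupport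
        (HasCompactSupport.smul_right (f := g) hgc)
      exact hg.continuous.continuousAt.smul
        (hcos.continuousAt (isOpen_Ioo.mem_nhds (hgs (hsub ht))))
    simp only [smul_sub]
    rw [integral_sub i1 i2, sub_eq_zero]
    simp only [Complex.real_smul]
    rw [← integral_const_mul] at e3
    calc ∫ t, (g t : ℂ) * k t = ∫ t, k t * ψ t := by
          congr 1; funext t; exact mul_comm _ _
      _ = ∫ t, c * (ψ t * ((Real.cos t ^ b : ℝ) : ℂ)) := e3
      _ = ∫ t, (g t : ℂ) * (c * ((Real.cos t ^ b : ℝ) : ℂ)) := by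
          congr 1; funext t; simp only [hψ]; ring)
  have h1 : IntegrableOn k (Ioo 0 (π / 2)) :=
    (hk.integrableOn_isCompact isCompact_Icc).mono_set Ioo_subset_Icc_self
  refine not_integrableOn_mul_cos_rpow hb1 (f := fun _ => c) continuous_const hc ?_
  refine h1.congr ?_
  rw [EventuallyEq, ae_restrict_iff' measurableSet_Ioo]
  filter_upwards [hae] with t ht hmem
  exact sub_eq_zero.1 (ht ⟨by linarith [hmem.1], hmem.2⟩)

/-- The constant vanishes only at poles of `Γ(Δ₊ - d + 1)`, where `Real.Gamma` is 0 and so is the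
quotient. Those are the exceptional `ν`, since `Δ₊ - d = -Δ₋`. -/
theorem hkllConst_ne_zero {d : ℕ} {ν : ℝ} (hν : 0 < ν)
    (hne : ∀ j : ℕ, -deltaMinus d ν + 1 + j ≠ 0) : hkllConst d ν ≠ 0 := by
  have h1 : Real.Gamma (deltaPlus d ν - d / 2 + 1) ≠ 0 := by
    refine (Real.Gamma_pos_of_pos ?_).ne'
    rw [deltaPlus]; linarith
  have h2 : Real.Gamma (deltaPlus d ν - d + 1) ≠ 0 := by
    refine Real.Gamma_ne_zero fun j hj => hne j ?_
    rw [neg_deltaMinus, hj]; ring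
  have h3 : π ^ ((d : ℝ) / 2) ≠ 0 := (Real.rpow_pos_of_pos Real.pi_pos _).ne'
  have h4 : (2 : ℝ) ^ (deltaPlus d ν - d - 1) ≠ 0 := (Real.rpow_pos_of_pos two_pos _).ne'
  rw [hkllConst]
  exact div_ne_zero (mul_ne_zero (mul_ne_zero (pow_ne_zero _ (by norm_num)) h4) h1)
    (mul_ne_zero h3 h2)

theorem not_exceptional {d n₀ : ℕ} {ν : ℝ} (hν : ν ∈ extendedRange d n₀)
    (hne : Nonexceptional d n₀ ν) (j : ℕ) : -deltaMinus d ν + 1 + j ≠ 0 := by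
  rcases lt_or_ge j n₀ with h | h
  · exact hne j h
  · have h1 : (n₀ : ℝ) ≤ j := by exact_mod_cast h
    have h2 := hν.2
    have h3 : 0 < -deltaMinus d ν + 1 + j := by rw [deltaMinus]; linarith
    exact h3.ne'

theorem extendedRange_pos {d n₀ : ℕ} {ν : ℝ} (hν : ν ∈ extendedRange d n₀) :
    0 < -deltaMinus d ν + 1 + n₀ := by
  have h2 := hν.2
  rw [deltaMinus]; linarith

/-- The case `n₀ = 0`: without counterterms the regularised limit is both the convergent integral
and the finite part. -/
theorem originalIntegral_eq {d m : ℕ} {ν : ℝ} (hb : -1 < -deltaMinus d ν)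
    {φ : ℝ → Sph d → ℂ} (hφ : ∀ Ω, ContDiff ℝ ∞ fun t => φ t Ω) :
    originalIntegral d ν φ = (hkllConst d ν : ℂ)
      * ∫ Ω, finitePart m (-deltaMinus d ν) (fun t => φ t Ω) ∂sphereMeasure d := by
  rw [originalIntegral]
  congr 2
  funext Ω
  have h1 := tendsto_regularized (d := d) (n₀ := 0) (m := m) (ν := ν)
    (by push_cast; linarith) (fun j hj => absurd hj (Nat.not_lt_zero j))
    (by have : (0 : ℝ) ≤ m := m.cast_nonneg
        linarith) (hφ Ω)
  have h2 := tendsto_cutoffIntegral hb (hφ Ω).continuous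
  refine tendsto_nhds_unique (h2.congr fun ε => ?_) h1
  rw [regularized, Finset.sum_range_zero, zero_add]
  rfl

theorem exists_extendedKernel {d n₀ m : ℕ} {ν : ℝ} (hν : ν ∈ extendedRange d n₀)
    (hne : Nonexceptional d n₀ ν) (hm : -1 < -deltaMinus d ν + 2 * m) :
    ∃ K : 𝓢'(ℝ, ℂ), IsExtendedKernel d n₀ ν K ∧
      ∀ ψ : 𝓢(ℝ, ℂ), K ψ = (hkllConst d ν : ℂ) * finitePart m (-deltaMinus d ν) ψ := by
  obtain ⟨T, hT⟩ := exists_finitePart_clm m hm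
  have hK : ∀ ψ : 𝓢(ℝ, ℂ), (((hkllConst d ν : ℂ) • T).toPointwiseConvergenceCLM _ _ _ _
      : 𝓢'(ℝ, ℂ)) ψ = (hkllConst d ν : ℂ) * finitePart m (-deltaMinus d ν) ψ := fun ψ => by
    rw [← hT]
    rfl
  refine ⟨((hkllConst d ν : ℂ) • T).toPointwiseConvergenceCLM _ _ _ _, fun ψ => ?_, hK⟩
  rw [hK]
  refine ((tendsto_regularized (extendedRange_pos hν) hne hm
    (f := (ψ : ℝ → ℂ)) ψ.smooth').const_mul _).congr fun ε => ?_
  rw [regularized]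
  congr 2
  refine Finset.sum_congr rfl fun j _ => ?_
  rw [taylor_add_eq_regulatingDistribution, mul_comm]

end HKLL

theorem mainTheorem4 (d : ℕ) (hd : Odd d) (hd3 : 3 ≤ d)
    (Φ : ℝ → ℝ → HKLL.Space d → ℂ) (φ : ℝ → ℝ → HKLL.Sph d → ℂ)
    (hΦ : ∀ ν : ℝ, 0 < ν → HKLL.IsDirichletField d ν (Φ ν))
    (hΦan : ∀ (t : ℝ) (x : HKLL.Space d), ‖x‖ < π / 2 →
      AnalyticOnNhd ℝ (fun ν : ℝ => Φ ν t x) (Ioi 0))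
    (hφ : ∀ ν : ℝ, 0 < ν → HKLL.IsBoundaryValue d ν (Φ ν) (φ ν)) :
    -- the original integral diverges for `Δ₊ ≤ d - 1`
    (∀ ν : ℝ, 0 < ν → HKLL.deltaPlus d ν ≤ d - 1 →
      (∀ Ω : HKLL.Sph d, (φ ν (π / 2) Ω ≠ 0 ∨ φ ν (-(π / 2)) Ω ≠ 0) →
        ¬ IntegrableOn (HKLL.integrand d ν (fun τ => φ ν τ Ω)) (Ioo (-(π / 2)) (π / 2))) ∧
      ((∃ Ω : HKLL.Sph d, φ ν (π / 2) Ω ≠ 0 ∨ φ ν (-(π / 2)) Ω ≠ 0) →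
        ¬ HKLL.ConvergesAbsolutely d ν (φ ν))) ∧
    -- the extension with `n₀` regulating terms
    (∀ n₀ : ℕ,
      (∃ g : ℝ → ℂ,
        AnalyticOnNhd ℝ g (HKLL.extendedRange d n₀) ∧
        (∀ ν ∈ HKLL.extendedRange d n₀, HKLL.Nonexceptional d n₀ ν →
          (∀ Ω : HKLL.Sph d, ∃ L : ℂ,
            Tendsto (HKLL.regularized d n₀ ν (fun τ => φ ν τ Ω)) (𝓝[>] (0 : ℝ)) (𝓝 L)) ∧
          Integrable (fun Ω => HKLL.regularizedLimit d n₀ ν (fun τ => φ ν τ Ω))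
            (HKLL.sphereMeasure d) ∧
          g ν = HKLL.extendedIntegral d n₀ ν (φ ν)) ∧
        (∀ ν ∈ HKLL.extendedRange d n₀, (d : ℝ) - 1 < HKLL.deltaPlus d ν →
          HKLL.ConvergesAbsolutely d ν (φ ν) ∧ g ν = HKLL.originalIntegral d ν (φ ν)) ∧
        (∀ ν ∈ HKLL.extendedRange d n₀, g ν = Φ ν 0 0)) ∧
      -- the extended kernel, which contains derivatives of delta functions
      (∀ ν ∈ HKLL.extendedRange d n₀, HKLL.Nonexceptional d n₀ ν →
        (∀ (ψ : 𝓢(ℝ, ℂ)) (j : ℕ),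
          HKLL.taylorPlus d ν ψ j + HKLL.taylorMinus d ν ψ j
            = HKLL.regulatingDistribution d ν j ψ) ∧
        (∃ K : 𝓢'(ℝ, ℂ),
          HKLL.IsExtendedKernel d n₀ ν K ∧
          (∀ (Ω : HKLL.Sph d) (ψ : 𝓢(ℝ, ℂ)),
            (∀ᶠ t in 𝓝ˢ (Icc (-(π / 2)) (π / 2)), ψ t = φ ν t Ω) →
            (HKLL.hkllConst d ν : ℂ) * HKLL.regularizedLimit d n₀ ν (fun τ => φ ν τ Ω) = K ψ) ∧
          (HKLL.deltaPlus d ν ≤ d - 1 → ¬ HKLL.IsIntegralKernel K)))) := by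
  obtain ⟨m, hm⟩ := hd
  have hm1 : 1 ≤ m := by omega
  have hdm : (d : ℝ) = 2 * m + 1 := by rw [hm]; push_cast; ring
  have data := fun ν (hν : 0 < ν) => (hΦ ν hν).reconstruct hm hm1 hν (hφ ν hν)
  have hbm : ∀ ν : ℝ, 0 < ν → -1 < -HKLL.deltaMinus d ν + 2 * m := fun ν hν => by
    have : (0 : ℝ) ≤ m := m.cast_nonneg
    rw [HKLL.deltaMinus, hdm]; linarith
  have hlow : ∀ ν : ℝ, HKLL.deltaPlus d ν ≤ d - 1 → -HKLL.deltaMinus d ν ≤ -1 := fun ν h => by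
    rw [HKLL.neg_deltaMinus]; linarith
  have hreg : ∀ (n₀ : ℕ), ∀ ν ∈ HKLL.extendedRange d n₀, HKLL.Nonexceptional d n₀ ν → ∀ Ω,
      Tendsto (HKLL.regularized d n₀ ν (fun τ => φ ν τ Ω)) (𝓝[>] (0 : ℝ))
        (𝓝 (HKLL.finitePart m (-HKLL.deltaMinus d ν) fun τ => φ ν τ Ω)) :=
    fun n₀ ν hν hne Ω => HKLL.tendsto_regularized (HKLL.extendedRange_pos hν) hne
      (hbm ν hν.1) ((data ν hν.1).1 Ω)
  -- The extension is the bulk field at the origin. It does not depend on `n₀`, is analytic by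
  -- hypothesis, and is defined also at exceptional `ν`, where no formula is claimed.
  refine ⟨fun ν hν hΔ => ⟨fun Ω hΩ => ?_, fun hΩ => ?_⟩, fun n₀ => ⟨⟨fun ν => Φ ν 0 0, ?_, ?_, ?_,
    fun ν _ => rfl⟩, fun ν hν hne => ⟨fun ψ j => ?_, ?_⟩⟩⟩
  · exact HKLL.not_integrableOn_integrand (hlow ν hΔ) ((data ν hν).1 Ω).continuous hΩ
  · exact HKLL.not_convergesAbsolutely (hlow ν hΔ) (data ν hν).2.1 hΩ
  · exact (hΦan 0 0 (by rw [norm_zero]; positivity)).mono fun ν hν => hν.1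
  · intro ν hν hne
    have hlim : ∀ Ω, HKLL.regularizedLimit d n₀ ν (fun τ => φ ν τ Ω)
        = HKLL.finitePart m (-HKLL.deltaMinus d ν) fun τ => φ ν τ Ω := fun Ω =>
      (hreg n₀ ν hν hne Ω).limUnder_eq
    refine ⟨fun Ω => ⟨_, hreg n₀ ν hν hne Ω⟩, ?_, ?_⟩
    · simp only [hlim]
      exact (data ν hν.1).2.2.1.integrable_of_hasCompactSupport
        (HasCompactSupport.of_compactSpace _)
    · simp only [HKLL.extendedIntegral, hlim]
      exact (data ν hν.1).2.2.2 (HKLL.not_exceptional hν hne)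
  · intro ν hν hΔ
    have hb : -1 < -HKLL.deltaMinus d ν := by rw [HKLL.neg_deltaMinus]; linarith
    refine ⟨HKLL.convergesAbsolutely_of_continuous hb (data ν hν.1).2.1, ?_⟩
    rw [HKLL.originalIntegral_eq (m := m) hb (data ν hν.1).1]
    refine (data ν hν.1).2.2.2 fun j => ?_
    -- In the convergent range every exponent `-Δ₋ + 1 + j` is positive, so nonexceptionality need
    -- not be assumed.
    have h1 : (0 : ℝ) ≤ j := j.cast_nonneg
    have h2 : 0 < -HKLL.deltaMinus d ν + 1 + j := by linarith
    exact h2.ne'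
  · exact HKLL.taylor_add_eq_regulatingDistribution d ν ψ j
  · obtain ⟨K, hK, hKψ⟩ := HKLL.exists_extendedKernel hν hne (hbm ν hν.1)
    refine ⟨K, hK, fun Ω ψ hψ => ?_, fun hΔ => ?_⟩
    · rw [hKψ, HKLL.finitePart_congr m _ hψ]
      congr 1
      exact (hreg n₀ ν hν hne Ω).limUnder_eq
    · have hne' := HKLL.not_exceptional hν hne
      refine HKLL.not_isIntegralKernel (hbm ν hν.1) (hlow ν hΔ) hne' ?_ hKψ
      exact_mod_cast HKLL.hkllConst_ne_zero hν.1 hne'
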